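/- Theorem (One-term block-encoding). There is an absolute constant $c>0$, and for every $r\in\mathbb N$ there is a constant $C>0$ depending only on $r$, such that the following holds. Let $n\ge 1$, let $-1<a<b<1$, $\Delta x=\frac{b-a}{2^n-1}$ and $x_j=a+j\Delta x$ for $0\le j<2^n$. Let $f:[a,b]\to\mathbb C$ be piecewise polynomial with $G_f$ pieces: there are $a=K_0<K_1<\dots<K_{G_f}=b$ and complex polynomials $p_1,\dots,p_{G_f}$ of degrees at most $Q_1,\dots,Q_{G_f}$ (where $Q_g\ge 1$) such that $f=p_1$ on $[K_0,K_1]$ and $f=p_g$ on $(K_{g-1},K_g]$ for $g\ge2$. Let $D$ be a complex $2^n\times 2^n$ finite-difference matrix for $\frac{\partial^m}{\partial x^m}$ with Robin (or other) boundary rows, in the following sense. 1. The entries of $D$ lie on $\kappa$ cyclic diagonals: there is a set $S\subset\mathbb Z/2^n$ with $|S|=\kappa$ such that $D_{ij}\neq0$ only if $j-i\in S$ modulo $2^n$ (entries on these diagonals may vanish). 2. There are indices $0\le \mathcal K_1\le \mathcal K_2<2^n$ with $\mathcal K_1+2^n-\mathcal K_2\le r$ and a finitely supported real stencil $(\gamma_l)_{l\in\mathbb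 Z}$, consistent with the $m$-th derivative ($\sum_l\gamma_l l^q=m!\,\delta_{qm}$ for $0\le q\le m$, with $0^0=1$), such that for every row $\mathcal K_1\le i\le \mathcal K_2$ the stencil stays inside the grid and $D_{ij}=\gamma_{j-i}/(\Delta x)^m$ for all $j$. The remaining (boundary) rows may have arbitrary complex entries on the $\kappa$ diagonals; this includes the rows obtained from the stencil by eliminating ghost points through Robin conditions. Let $\mathcal N_D\ge\max_{i,j}|D_{ij}|$ and $\mathcal N_f>0$ with $\mathcal N_f\ge c\,\max_{x\in[a,b]}|f(x)|$. Then there is a quantum circuit of one-qubit gates and C-NOT gates whose unitary $U$ is an $(\mathcal N_D\mathcal N_f\kappa,\ s,\ 0)$-block-encoding of the matrix $A_k$ with entries $(A_k)_{ij}=f(x_i)D_{ij}$, where $s=\lceil\log_2 n\rceil+\lceil\log_2 G_f\rceil+\lceil\log_2\kappa\rceil+4$, and which uses $2n$ pure ancillas; that is, for every $n$-qubit vector $|\psi\rangle$ one has $$U|0\rangle^{2n}|0\rangle^{s}|\psi\rangle=|0\rangle^{2n}|\phi\rangle,\qquad (\langle0|^{s}\otimes I)|\phi\rangle=\frac{A_k}{\mathcal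 N_D\mathcal N_f\kappa}|\psi\rangle .$$ The number of gates is at most $$C\Big(\sum_{g=1}^{G_f}Q_g\,n\log_2 n+\kappa n\Big).$$ -/

import Mathlib

/-! ### Quantum circuits

The wires of a circuit form a finite type `ι`; a computational basis state is `b : ι → Fin 2`. -/

/-- Elementary gates: an arbitrary one-qubit gate, and C-NOT. -/
inductive QGate (ι : Type) : Type
  | single (i : ι) (u : Matrix.unitaryGroup (Fin 2) ℂ) : QGate ι
  | cnot (ctrl tgt : ι) (h : ctrl ≠ tgt) : QGate ι

/-- The matrix of a gate in the computational basis. -/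
def QGate.matrix {ι : Type} [Fintype ι] [DecidableEq ι] :
    QGate ι → Matrix (ι → Fin 2) (ι → Fin 2) ℂ
  | .single i u => fun b b' =>
      if ∀ k, k ≠ i → b k = b' k then (u : Matrix (Fin 2) (Fin 2) ℂ) (b i) (b' i) else 0
  | .cnot c t _ => fun b b' =>
      if b = Function.update b' t (b' t + b' c) then 1 else 0

/-- A circuit is a list of elementary gates, the head being applied first.
Its gate count is the length of the list. -/
abbrev QCircuit (ι : Type) : Type := List (QGate ι)

/-- The matrix of a circuit in the computational basis. -/
def QCircuit.matrix {ι : Type} [Fintype ι] [DecidableEq ι] :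
    QCircuit ι → Matrix (ι → Fin 2) (ι → Fin 2) ℂ
  | [] => 1
  | g :: gs => QCircuit.matrix gs * g.matrix

/-! ### Block-encodings -/

/-- The vector `|0⟩^k ⊗ φ`. -/
def zeroTensor {k : ℕ} {ι : Type} (φ : (ι → Fin 2) → ℂ) : (Fin k ⊕ ι → Fin 2) → ℂ :=
  fun b => if ∀ i : Fin k, b (Sum.inl i) = 0 then φ (fun i => b (Sum.inr i)) else 0

/-- The vector `(⟨0|^k ⊗ I) φ`. -/
def zeroProj {k : ℕ} {ι : Type} (φ : (Fin k ⊕ ι → Fin 2) → ℂ) : (ι → Fin 2) → ℂ :=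
  fun b => φ (Sum.elim (fun _ => 0) b)

/-- The `2^n × 2^n` matrix `A` as an operator on `n` qubits, the basis state with bits
`b 0, …, b (n-1)` being `|j⟩` for `j = ∑ i, b i * 2 ^ i`. -/
def qubitOperator {n : ℕ} (A : Matrix (Fin (2 ^ n)) (Fin (2 ^ n)) ℂ) :
    Matrix (Fin n → Fin 2) (Fin n → Fin 2) ℂ :=
  A.submatrix finFunctionFinEquiv finFunctionFinEquiv

/-- `U` is an `(α, s, ε)`-block-encoding of `A` which uses `a` pure ancillas:
`U |0⟩^a |0⟩^s |ψ⟩ = |0⟩^a |φ⟩`, `(⟨0|^s ⊗ I) |φ⟩ = Ã |ψ⟩` and `‖A - α Ã‖ ≤ ε`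
(operator norm). -/
def IsBlockEncoding {a s n : ℕ} (α ε : ℝ) (A : Matrix (Fin (2 ^ n)) (Fin (2 ^ n)) ℂ)
    (U : Matrix (Fin a ⊕ (Fin s ⊕ Fin n) → Fin 2) (Fin a ⊕ (Fin s ⊕ Fin n) → Fin 2) ℂ) : Prop :=
  0 < α ∧ U ∈ Matrix.unitaryGroup (Fin a ⊕ (Fin s ⊕ Fin n) → Fin 2) ℂ ∧
  ∃ A' : Matrix (Fin n → Fin 2) (Fin n → Fin 2) ℂ,
    (∀ ψ : (Fin n → Fin 2) → ℂ, ∃ φ : (Fin s ⊕ Fin n → Fin 2) → ℂ,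
      U.mulVec (zeroTensor (zeroTensor ψ)) = zeroTensor φ ∧ zeroProj φ = A'.mulVec ψ) ∧
    ‖Matrix.toEuclideanCLM (𝕜 := ℂ) (qubitOperator A - (α : ℂ) • A')‖ ≤ ε

/-! ### Grid, coefficient function, derivative matrix -/

/-- The step of the uniform grid with `2^n` points on `[a, b]`, end points included. -/
noncomputable def gridStep (a b : ℝ) (n : ℕ) : ℝ := (b - a) / (2 ^ n - 1)

/-- The grid points `x_j = a + j Δx`. -/
noncomputable def gridPoint (a b : ℝ) (n : ℕ) (j : Fin (2 ^ n)) : ℝ :=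
  a + (j : ℕ) * gridStep a b n

/-- `f` is piecewise polynomial on `[a, b]` with `G` pieces, the `g`-th one of degree at most
`Q g`; the first piece lives on `[K 0, K 1]`, the later ones on `(K g, K (g+1)]`. -/
def IsPiecewisePolynomial {G : ℕ} (f : ℝ → ℂ) (a b : ℝ) (Q : Fin G → ℕ) : Prop :=
  ∃ (K : Fin (G + 1) → ℝ) (p : Fin G → Polynomial ℂ),
    StrictMono K ∧ K 0 = a ∧ K (Fin.last G) = b ∧
    (∀ g, (p g).natDegree ≤ Q g) ∧
    (∀ g : Fin G, ∀ x ∈ Set.Ioc (K g.castSucc) (K g.succ), f x = (p g).eval (x : ℂ)) ∧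
    (∀ g : Fin G, (g : ℕ) = 0 → f a = (p g).eval (a : ℂ))

/-- The coefficients `γ` form a consistent finite-difference scheme for `d^m/dx^m`:
`u^(m)(x) ≈ (Δx)^(-m) ∑ l, γ l * u (x + l Δx)`, that is, the Taylor coefficients of the right-hand
side agree with those of the left-hand side up to order `m`. -/
def IsStencil (m : ℕ) (γ : ℤ →₀ ℝ) : Prop :=
  ∀ q ≤ m, (γ.sum fun l c => c * (l : ℝ) ^ q) = if q = m then (m.factorial : ℝ) else 0

/-- `D` is a finite-difference matrix for `d^m/dx^m` with modified boundary rows.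
* `band`: the entries of `D` lie on `κ` cyclic diagonals (some of these entries may vanish).
* `bulk`: the rows `K₁ ≤ i ≤ K₂` carry one and the same scheme for `d^m/dx^m`, which does not
  reach over the ends of the grid from there. The number of remaining rows is bounded through `r`.
The boundary rows may have arbitrary complex entries on the `κ` diagonals. This covers the rows that
arise when ghost points are eliminated by means of Robin conditions, with any constants in the
conditions and any formula for the elimination; see `robinMatrix` and
`robinMatrix_isRobinDerivative`. -/
structure IsRobinDerivative (m n κ r : ℕ) (Δx : ℝ)
    (D : Matrix (Fin (2 ^ n)) (Fin (2 ^ n)) ℂ) : Prop where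
  band : ∃ S : Finset (Fin (2 ^ n)), S.card = κ ∧ ∀ i j, D i j ≠ 0 → j - i ∈ S
  bulk : ∃ γ : ℤ →₀ ℝ, IsStencil m γ ∧ ∃ K₁ K₂ : ℕ,
    K₁ ≤ K₂ ∧ K₂ < 2 ^ n ∧ K₁ + 2 ^ n ≤ K₂ + r ∧
    ∀ i : Fin (2 ^ n), K₁ ≤ (i : ℕ) → (i : ℕ) ≤ K₂ →
      (∀ l ∈ γ.support, 0 ≤ ((i : ℕ) : ℤ) + l ∧ ((i : ℕ) : ℤ) + l < 2 ^ n) ∧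
      ∀ j : Fin (2 ^ n), D i j = ((γ (((j : ℕ) : ℤ) - ((i : ℕ) : ℤ)) / Δx ^ m : ℝ) : ℂ)

/-- The matrix of the scheme `γ` (supported in `[-w, w]`) for `d^m/dx^m` under the Robin conditions
`u'(a) + 𝒜 u(a) = 𝒜'` and `u'(b) + ℬ u(b) = ℬ'`, where the ghost values are eliminated by
`u_{-k} = u_k - 2kΔx (𝒜' - 𝒜 u_0)` and `u_{N-1+k} = u_{N-1-k} + 2kΔx (ℬ' - ℬ u_{N-1})`, `N = 2^n`
(the constants `𝒜'`, `ℬ'` go to the inhomogeneous term). -/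
noncomputable def robinMatrix (m n w : ℕ) (Δx : ℝ) (𝒜 ℬ : ℂ) (γ : ℤ →₀ ℝ) :
    Matrix (Fin (2 ^ n)) (Fin (2 ^ n)) ℂ := fun i j =>
  ((γ ((j : ℕ) - (i : ℕ)) : ℂ)
    + ∑ k ∈ Finset.Icc 1 w, (γ (-k - (i : ℕ)) : ℂ) *
        ((if (j : ℕ) = k then 1 else 0) + if (j : ℕ) = 0 then 2 * k * Δx * 𝒜 else 0)
    + ∑ k ∈ Finset.Icc 1 w, (γ (2 ^ n - 1 + k - (i : ℕ)) : ℂ) *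
        ((if (j : ℕ) + k = 2 ^ n - 1 then 1 else 0)
          - if (j : ℕ) = 2 ^ n - 1 then 2 * k * Δx * ℬ else 0)) / (Δx : ℂ) ^ m

theorem robinMatrix_isRobinDerivative (m n w : ℕ) (Δx : ℝ) (𝒜 ℬ : ℂ) (γ : ℤ →₀ ℝ)
    (hγ : IsStencil m γ) (hw : ∀ l, γ l ≠ 0 → -(w : ℤ) ≤ l ∧ l ≤ w) (hn : 2 * w < 2 ^ n) :
    IsRobinDerivative m n (2 * w + 1) (2 * w + 1) Δx (robinMatrix m n w Δx 𝒜 ℬ γ) := by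
  have hN : ((2 ^ n : ℕ) : ℤ) = 2 ^ n := by push_cast; rfl
  have hw' : ∀ l : ℤ, (l < -w ∨ (w : ℤ) < l) → γ l = 0 := by
    intro l hl
    by_contra h
    have := hw l h
    omega
  refine ⟨⟨Finset.univ.filter fun s : Fin (2 ^ n) => (s : ℕ) ≤ w ∨ 2 ^ n ≤ (s : ℕ) + w, ?_, ?_⟩,
    γ, hγ, w, 2 ^ n - 1 - w, by omega, by omega, by omega, ?_⟩
  · have h : (Finset.univ.filter fun s : Fin (2 ^ n) => (s : ℕ) ≤ w ∨ 2 ^ n ≤ (s : ℕ) + w).map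
        Fin.valEmbedding = Finset.range (w + 1) ∪ Finset.Ico (2 ^ n - w) (2 ^ n) := by
      ext s
      simp only [Finset.mem_map, Finset.mem_filter, Finset.mem_univ, true_and, Finset.mem_union,
        Finset.mem_range, Finset.mem_Ico, Fin.valEmbedding_apply]
      constructor
      · rintro ⟨x, hx, rfl⟩
        have := x.2
        omega
      · intro hs
        exact ⟨⟨s, by omega⟩, by simp only; omega, rfl⟩
    rw [← Finset.card_map Fin.valEmbedding, h, Finset.card_union_of_disjoint]
    · simp only [Finset.card_range, Nat.card_Ico]
      omega
    · rw [Finset.disjoint_left]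
      intro x hx hx'
      simp only [Finset.mem_range, Finset.mem_Ico] at hx hx'
      omega
  · intro i j hij
    by_contra hS
    apply hij
    have hi := i.2
    have hj := j.2
    have hfar : (j : ℕ) + w < i ∨ (i : ℕ) + w < j := by
      by_contra hc
      apply hS
      simp only [Finset.mem_filter, Finset.mem_univ, true_and]
      rcases le_or_gt i j with h | h
      · left
        rw [Fin.sub_val_of_le h]
        omega
      · right
        have h' : (i : ℕ) ≤ 2 ^ n + j := by omega
        have h'' : (j : ℕ) < i := h
        rw [Fin.coe_sub_iff_lt.2 h]
        omega
    simp only [robinMatrix]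
    rw [hw' ((j : ℕ) - (i : ℕ)) (by omega), Finset.sum_eq_zero, Finset.sum_eq_zero]
    · simp
    · intro k hk
      rw [Finset.mem_Icc] at hk
      by_cases hc : (2 : ℤ) ^ n - 1 + k - (i : ℕ) ≤ w
      · rw [if_neg (by omega), if_neg (by omega)]
        simp
      · rw [hw' _ (by omega)]
        simp
    · intro k hk
      rw [Finset.mem_Icc] at hk
      by_cases hc : -(w : ℤ) ≤ -k - (i : ℕ)
      · rw [if_neg (by omega), if_neg (by omega)]
        simp
      · rw [hw' _ (by omega)]
        simp
  · intro i h1 h2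
    refine ⟨fun l hl => ?_, fun j => ?_⟩
    · have := hw l (Finsupp.mem_support_iff.1 hl)
      omega
    · simp only [robinMatrix]
      rw [Finset.sum_eq_zero, Finset.sum_eq_zero]
      · push_cast
        simp
      · intro k hk
        rw [Finset.mem_Icc] at hk
        rw [hw' _ (by omega)]
        simp
      · intro k hk
        rw [Finset.mem_Icc] at hk
        rw [hw' _ (by omega)]
        simp

/-- The discretized operator `f(x) d^m/dx^m`, with entries `f(x_i) D_ij`. -/
noncomputable def oneTermMatrix {n : ℕ} (f : ℝ → ℂ) (a b : ℝ)
    (D : Matrix (Fin (2 ^ n)) (Fin (2 ^ n)) ℂ) : Matrix (Fin (2 ^ n)) (Fin (2 ^ n)) ℂ :=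
  Matrix.diagonal (fun i => f (gridPoint a b n i)) * D

/-!
The block-encoding of `A i j = f (x i) * D i j` is the product of a block-encoding of `D` with loss
`2 ^ k * N_D`, where `2 ^ k` is the least power of two not below `κ`, and one of the diagonal
matrix with the entries `2 ^ k * f (x i) / (κ * N_f)`. As `2 ^ k ≤ 2 * κ`, these entries have modulus
at most `1 / 2` once `N_f ≥ 4 * max |f|`, which leaves room for signal processing.

The circuit for `D` (`exists_diagonals`) superposes the `2 ^ k` values of a register by Hadamard
gates, adds the offset of the corresponding cyclic diagonal to the position, and rotates one qubit so
that its amplitude is the entry of `D`. In the bulk rows the entry depends only on the diagonal, since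
the stencil stays inside the grid (`IsRobinDerivative.exists_boundary`); so there is one rotation for
each diagonal, controlled by `k` bits, and there is one for each diagonal and each of the at most `r`
boundary rows, controlled by `k + n` bits. With the adder `Impl.add` and the controlled gates
`Impl.ctrl_pattern` this takes `O((1 + r) κ n)` gates.

The circuit for the diagonal matrix treats the pieces of `f` one by one. A polynomial of degree `d` on
an interval of grid points costs `O(d n log n)` gates (`Enc.interval`):

* The position on a dyadic block is `∑ i, b i * 2 ^ i`, so up to scaling it is a convex combination
  of the signs `(-1) ^ b i`, with geometric weights. These weights are prepared in an index register
  of only `⌈log₂ n⌉` qubits by one-qubit gates (`exists_geometric_weights`), and a sign is applied for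
  each `i`. This gives an involution `S` whose corner entry is the affine image of the position
  (`exists_coordMatrix`).
* By qubitization, the walk operator `W = R S`, with `R` the reflection at the zero state, satisfies
  `(W + W⁻¹) e = -2 S 0 0 e` at the zero state `e` (`walk_add_inv_mulVec`).
* Since `z ^ d * p ((z + z⁻¹) / 2)` is a polynomial in `z` of degree `2 d`, generalized quantum signal
  processing implements it at `z = W` on a signal qubit by `2 d` controlled walk steps
  (`exists_signalPair`). The complementary polynomial that is needed comes from the Fejér–Riesz theorem
  (`exists_fejerRiesz`). Multiplication by `W⁻¹ ^ d` leaves `p` of the coordinate (`Blk.polynomial`).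
* An interval of positions is the union of two pieces of dyadic blocks and one point; a flag for the
  piece is computed by comparisons with constants, and it controls the signal processing.

For `n ≤ 3` there are at most eight grid points, and the values of `f` are encoded one by one.

A circuit enters through the transformation of state vectors that it carries out (`Impl`), and
the circuits for the diagonal matrix through their action on the signal qubit and the index register
for fixed values of all other qubits (`Blk`). All claims are about states with clean ancillas; they
are made for the qubits `Wire`, which are finally embedded into those of the statement.
-/

set_option linter.unusedSectionVars false

/-! ### The action of circuits on state vectors -/

section Exact

open Matrix Function

variable {ι : Type} [Fintype ι] [DecidableEq ι]

theorem QGate.matrix_single_apply (i : ι) (u : Matrix.unitaryGroup (Fin 2) ℂ) (b b' : ι → Fin 2) :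
    (QGate.single i u).matrix b b' =
      if ∀ k, k ≠ i → b k = b' k then (u : Matrix (Fin 2) (Fin 2) ℂ) (b i) (b' i) else 0 := rfl

theorem QGate.matrix_cnot_apply (c t : ι) (h : c ≠ t) (b b' : ι → Fin 2) :
    (QGate.cnot c t h).matrix b b' = if b' = update b t (b t + b c) then 1 else 0 := by
  have h2 : ∀ x y : Fin 2, x + y + y = x := by decide
  have aux : ∀ b : ι → Fin 2,
      update (update b t (b t + b c)) t (update b t (b t + b c) t + update b t (b t + b c) c) = b := by
    intro b
    simp [update_of_ne h, h2]
  have key : b = update b' t (b' t + b' c) ↔ b' = update b t (b t + b c) :=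
    ⟨fun h => by rw [h, aux], fun h => by rw [h, aux]⟩
  exact if_congr key rfl rfl

theorem QGate.single_mulVec (i : ι) (u : Matrix.unitaryGroup (Fin 2) ℂ) (ψ : (ι → Fin 2) → ℂ) :
    (QGate.single i u).matrix *ᵥ ψ =
      fun b => ∑ x, (u : Matrix (Fin 2) (Fin 2) ℂ) (b i) x * ψ (update b i x) := by
  funext b
  symm
  refine Fintype.sum_of_injective (fun x => update b i x) (update_injective b i) _ _ ?_ ?_
  · intro b' hb'
    simp only [QGate.matrix]
    rw [if_neg, zero_mul]
    intro h
    refine hb' ⟨b' i, ?_⟩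
    funext k
    by_cases hk : k = i
    · subst hk; simp
    · simp [hk, h k hk]
  · intro x
    simp only [QGate.matrix]
    rw [if_pos]
    · simp
    · intro k hk
      simp [hk]

theorem QGate.cnot_mulVec (c t : ι) (h : c ≠ t) (ψ : (ι → Fin 2) → ℂ) :
    (QGate.cnot c t h).matrix *ᵥ ψ = fun b => ψ (update b t (b t + b c)) := by
  funext b
  simp only [Matrix.mulVec, dotProduct, QGate.matrix_cnot_apply, ite_mul, one_mul, zero_mul,
    Finset.sum_ite_eq', Finset.mem_univ, if_true]

/-- The inverse of an elementary gate, which is again an elementary gate. -/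
def QGate.inv : QGate ι → QGate ι
  | .single i u => .single i u⁻¹
  | .cnot c t h => .cnot c t h

theorem QGate.inv_matrix (g : QGate ι) : g.inv.matrix = star g.matrix := by
  ext b b'
  cases g with
  | single i u =>
    simp only [QGate.inv, QGate.matrix_single_apply, Matrix.star_apply, Matrix.UnitaryGroup.inv_val]
    by_cases h : ∀ k, k ≠ i → b k = b' k
    · rw [if_pos h, if_pos fun k hk => (h k hk).symm]
    · rw [if_neg h, if_neg fun h' => h fun k hk => (h' k hk).symm, star_zero]
  | cnot c t h =>
    have hr : (QGate.cnot c t h).matrix b' b = if b' = update b t (b t + b c) then 1 else 0 := rfl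
    rw [QGate.inv, Matrix.star_apply, QGate.matrix_cnot_apply, hr]
    split_ifs <;> simp

theorem QGate.inv_matrix_mul (g : QGate ι) : g.inv.matrix * g.matrix = 1 := by
  apply Matrix.ext_of_mulVec_single
  intro j
  rw [← Matrix.mulVec_mulVec, Matrix.one_mulVec]
  generalize (Pi.single j 1 : (ι → Fin 2) → ℂ) = ψ
  cases g with
  | single i u =>
    rw [QGate.inv, QGate.single_mulVec, QGate.single_mulVec]
    funext b
    have hu : star (u : Matrix (Fin 2) (Fin 2) ℂ) * (u : Matrix (Fin 2) (Fin 2) ℂ) = 1 :=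
      Unitary.coe_star_mul_self u
    simp only [update_self, update_idem, Matrix.UnitaryGroup.inv_val, Finset.mul_sum]
    rw [Finset.sum_comm]
    simp only [← mul_assoc, ← Finset.sum_mul]
    have : ∀ y, ∑ x, (star (u : Matrix (Fin 2) (Fin 2) ℂ)) (b i) x *
        (u : Matrix (Fin 2) (Fin 2) ℂ) x y = if b i = y then 1 else 0 := by
      intro y
      rw [← Matrix.mul_apply, hu, Matrix.one_apply]
    simp only [this, ite_mul, one_mul, zero_mul, Finset.sum_ite_eq, Finset.mem_univ, if_true,
      update_eq_self]
  | cnot c t h =>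
    rw [QGate.inv, QGate.cnot_mulVec, QGate.cnot_mulVec]
    funext b
    have h2 : ∀ x y : Fin 2, x + y + y = x := by decide
    simp [update_of_ne h, h2]

theorem QGate.matrix_mem_unitaryGroup (g : QGate ι) :
    g.matrix ∈ Matrix.unitaryGroup (ι → Fin 2) ℂ := by
  rw [Matrix.mem_unitaryGroup_iff', ← QGate.inv_matrix, QGate.inv_matrix_mul]

theorem QCircuit.matrix_append (U V : QCircuit ι) :
    QCircuit.matrix (U ++ V) = QCircuit.matrix V * QCircuit.matrix U := by
  induction U with
  | nil => simp [QCircuit.matrix]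
  | cons g gs ih => rw [List.cons_append, QCircuit.matrix, QCircuit.matrix, ih, mul_assoc]

theorem QCircuit.matrix_mem_unitaryGroup (U : QCircuit ι) :
    QCircuit.matrix U ∈ Matrix.unitaryGroup (ι → Fin 2) ℂ := by
  induction U with
  | nil => exact one_mem _
  | cons g gs ih => exact mul_mem ih g.matrix_mem_unitaryGroup

theorem QCircuit.exists_inv (U : QCircuit ι) :
    ∃ V : QCircuit ι, V.length = U.length ∧ QCircuit.matrix V * QCircuit.matrix U = 1 := by
  induction U with
  | nil => exact ⟨[], rfl, by simp [QCircuit.matrix]⟩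
  | cons g gs ih =>
    obtain ⟨V, hV, h⟩ := ih
    refine ⟨V ++ [g.inv], by simp [hV], ?_⟩
    rw [QCircuit.matrix_append, QCircuit.matrix, QCircuit.matrix, QCircuit.matrix, one_mul,
      mul_assoc, ← mul_assoc (QCircuit.matrix V), h, one_mul, QGate.inv_matrix_mul]

/-- The transformation `T` of state vectors is carried out by a circuit of at most `N` gates. -/
def Impl (N : ℕ) (T : ((ι → Fin 2) → ℂ) → (ι → Fin 2) → ℂ) : Prop :=
  ∃ U : QCircuit ι, U.length ≤ N ∧ ∀ ψ, QCircuit.matrix U *ᵥ ψ = T ψ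

/-- The gate on wire `i` whose matrix `M b` is selected by the basis state `b` (in the
applications `M b` does not depend on the bit `b i`). -/
def mux (i : ι) (M : (ι → Fin 2) → Matrix (Fin 2) (Fin 2) ℂ) (ψ : (ι → Fin 2) → ℂ) :
    (ι → Fin 2) → ℂ :=
  fun b => ∑ x, M b (b i) x * ψ (update b i x)

open Classical in
/-- The one-qubit gate `u` on wire `i`, controlled by the condition `P` on the other wires. -/
noncomputable def ctrl (P : (ι → Fin 2) → Prop) (i : ι) (u : Matrix (Fin 2) (Fin 2) ℂ) :
    ((ι → Fin 2) → ℂ) → (ι → Fin 2) → ℂ :=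
  mux i fun b => if P b then u else 1

/-- The map of basis states which adds the bit `g b` to the bit on wire `t`. -/
def flipBy (t : ι) (g : (ι → Fin 2) → Fin 2) (b : ι → Fin 2) : ι → Fin 2 :=
  update b t (b t + g b)

namespace Impl

variable {N N' : ℕ} {T T' : ((ι → Fin 2) → ℂ) → (ι → Fin 2) → ℂ}

theorem mono (h : Impl N T) (hN : N ≤ N') : Impl N' T := by
  obtain ⟨U, hU, h⟩ := h
  exact ⟨U, hU.trans hN, h⟩

theorem comp (h' : Impl N' T') (h : Impl N T) : Impl (N + N') (fun ψ => T' (T ψ)) := by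
  obtain ⟨U, hU, h⟩ := h
  obtain ⟨U', hU', h'⟩ := h'
  refine ⟨U ++ U', by simp only [List.length_append]; omega, fun ψ => ?_⟩
  rw [QCircuit.matrix_append, ← Matrix.mulVec_mulVec, h, h']

theorem id : Impl 0 (fun ψ : (ι → Fin 2) → ℂ => ψ) :=
  ⟨[], le_rfl, fun ψ => by simp [QCircuit.matrix]⟩

theorem single (i : ι) (u : Matrix.unitaryGroup (Fin 2) ℂ) : Impl 1 (mux i fun _ => u) :=
  ⟨[.single i u], le_rfl, fun ψ => by
    rw [QCircuit.matrix, QCircuit.matrix, one_mul, QGate.single_mulVec]; rfl⟩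

theorem cnot {c t : ι} (h : c ≠ t) :
    Impl 1 (fun ψ : (ι → Fin 2) → ℂ => ψ ∘ flipBy t fun b => b c) :=
  ⟨[.cnot c t h], le_rfl, fun ψ => by
    rw [QCircuit.matrix, QCircuit.matrix, one_mul, QGate.cnot_mulVec]; rfl⟩

theorem perm_comp {π π' : (ι → Fin 2) → ι → Fin 2}
    (h : Impl N fun ψ => ψ ∘ π) (h' : Impl N' fun ψ => ψ ∘ π') :
    Impl (N + N') fun ψ => ψ ∘ (π ∘ π') :=
  h'.comp h

/-- A circuit that permutes the basis states is inverted by its inverse circuit. -/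
theorem perm_symm {π : Equiv.Perm (ι → Fin 2)} (h : Impl N fun ψ => ψ ∘ π) :
    Impl N fun ψ => ψ ∘ π.symm := by
  obtain ⟨U, hU, h⟩ := h
  obtain ⟨V, hV, hVU⟩ := QCircuit.exists_inv U
  refine ⟨V, hV.trans_le hU, fun ψ => ?_⟩
  have : ψ = QCircuit.matrix U *ᵥ (ψ ∘ π.symm) := by
    rw [h]; funext b; simp
  conv_lhs => rw [this]
  rw [Matrix.mulVec_mulVec, hVU, Matrix.one_mulVec]

theorem mux_mul {i : ι} {M M' : (ι → Fin 2) → Matrix (Fin 2) (Fin 2) ℂ}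
    (h' : Impl N' (mux i M')) (h : Impl N (mux i M)) (hM : ∀ b x, M (update b i x) = M b) :
    Impl (N + N') (mux i fun b => M' b * M b) := by
  convert h'.comp h using 1
  funext ψ b
  simp only [mux, update_self, update_idem, hM, Finset.mul_sum, Matrix.mul_apply, Finset.sum_mul]
  rw [Finset.sum_comm]
  simp only [mul_assoc]

/-- Conjugation by a classical involution replaces the selecting function `M` by `M ∘ π`. -/
theorem mux_conj {i : ι} {M : (ι → Fin 2) → Matrix (Fin 2) (Fin 2) ℂ}
    {π : (ι → Fin 2) → ι → Fin 2} (hπ : Impl N' fun ψ => ψ ∘ π) (h : Impl N (mux i M))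
    (hinv : ∀ b, π (π b) = b) (hi : ∀ b, π b i = b i)
    (hup : ∀ b x, π (update b i x) = update (π b) i x) :
    Impl (N + 2 * N') (mux i fun b => M (π b)) := by
  convert (hπ.comp (h.comp hπ)) using 1
  · omega
  · funext ψ b
    simp only [mux, Function.comp_apply, hi]
    refine Finset.sum_congr rfl fun x _ => ?_
    rw [← hup, hinv]

end Impl

theorem flipBy_apply_self (t : ι) (g : (ι → Fin 2) → Fin 2) (b : ι → Fin 2) :
    flipBy t g b t = b t + g b := by simp [flipBy]

theorem flipBy_apply_of_ne {t k : ι} (h : k ≠ t) (g : (ι → Fin 2) → Fin 2) (b : ι → Fin 2) :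
    flipBy t g b k = b k := by simp [flipBy, h]

theorem flipBy_flipBy {t : ι} {g : (ι → Fin 2) → Fin 2} (hg : ∀ b x, g (update b t x) = g b)
    (b : ι → Fin 2) : flipBy t g (flipBy t g b) = b := by
  have h2 : ∀ x y : Fin 2, x + y + y = x := by decide
  simp [flipBy, hg, h2]

theorem flipBy_update {t i : ι} (hti : i ≠ t) {g : (ι → Fin 2) → Fin 2}
    (hg : ∀ b x, g (update b i x) = g b) (b : ι → Fin 2) (x : Fin 2) :
    flipBy t g (update b i x) = update (flipBy t g b) i x := by
  simp [flipBy, hg, update_comm hti, update_of_ne hti.symm]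

theorem Impl.flipBy_add {N N' : ℕ} {t : ι} {g g' : (ι → Fin 2) → Fin 2}
    (h : Impl N fun ψ => ψ ∘ flipBy t g) (h' : Impl N' fun ψ => ψ ∘ flipBy t g')
    (hg : ∀ b x, g (update b t x) = g b) :
    Impl (N + N') fun ψ => ψ ∘ flipBy t fun b => g b + g' b := by
  convert h.perm_comp h' using 3
  funext b
  have h2 : ∀ x y z : Fin 2, x + (y + z) = x + z + y := by decide
  simp [flipBy, hg, h2]

end Exact

/-! ### Unitary matrices of size two -/

section TwoByTwo

open Matrix Function

/-- The unitary matrix with first column `(x, y)` and determinant one. -/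
theorem exists_unitary_of_column {x y : ℂ} (h : ‖x‖ ^ 2 + ‖y‖ ^ 2 = 1) :
    !![x, -star y; y, star x] ∈ Matrix.unitaryGroup (Fin 2) ℂ := by
  have h' : x * star x + y * star y = 1 := by
    have h1 : ∀ z : ℂ, z * star z = ((‖z‖ ^ 2 : ℝ) : ℂ) := fun z => by
      rw [Complex.star_def, Complex.mul_conj, Complex.normSq_eq_norm_sq]
    rw [h1, h1, ← Complex.ofReal_add, h, Complex.ofReal_one]
  rw [Matrix.mem_unitaryGroup_iff']
  ext i j
  fin_cases i <;> fin_cases j <;>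
    simp [Matrix.mul_apply, Fin.sum_univ_two] at h' ⊢ <;> first | ring1 | linear_combination h'

theorem norm_sq_col_of_unitary {u : Matrix (Fin 2) (Fin 2) ℂ}
    (hu : u ∈ Matrix.unitaryGroup (Fin 2) ℂ) (j : Fin 2) : ‖u 0 j‖ ^ 2 + ‖u 1 j‖ ^ 2 = 1 := by
  have h := congrFun (congrFun (Matrix.mem_unitaryGroup_iff'.1 hu) j) j
  rw [Matrix.mul_apply, Fin.sum_univ_two, Matrix.star_apply, Matrix.star_apply,
    Matrix.one_apply_eq, Complex.star_def, mul_comm _ (u 0 j),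
    mul_comm _ (u 1 j), Complex.mul_conj, Complex.mul_conj, Complex.normSq_eq_norm_sq, Complex.normSq_eq_norm_sq] at h
  exact_mod_cast h

/-- Every complex number of modulus at most one is the corner of a unitary matrix. -/
theorem exists_unitary_of_corner {z : ℂ} (hz : ‖z‖ ≤ 1) :
    ∃ u : Matrix.unitaryGroup (Fin 2) ℂ, (u : Matrix (Fin 2) (Fin 2) ℂ) 0 0 = z := by
  have h : ‖z‖ ^ 2 + ‖((Real.sqrt (1 - ‖z‖ ^ 2) : ℝ) : ℂ)‖ ^ 2 = 1 := by
    rw [Complex.norm_real, Real.norm_eq_abs, sq_abs, Real.sq_sqrt]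
    · ring
    · nlinarith [norm_nonneg z]
  exact ⟨⟨_, exists_unitary_of_column h⟩, rfl⟩

/-- A unitary `2 × 2` matrix is unitarily diagonalizable. -/
theorem exists_diagonalization (u : Matrix.unitaryGroup (Fin 2) ℂ) :
    ∃ (w : Matrix.unitaryGroup (Fin 2) ℂ) (p q : ℂ), ‖p‖ = 1 ∧ ‖q‖ = 1 ∧
      (u : Matrix (Fin 2) (Fin 2) ℂ) = w * diagonal ![p, q] * star (w : Matrix (Fin 2) (Fin 2) ℂ) := by
  obtain ⟨μ, hμ⟩ := Module.End.exists_eigenvalue (Matrix.toLin' (u : Matrix (Fin 2) (Fin 2) ℂ))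
  obtain ⟨v, hv⟩ := hμ.exists_hasEigenvector
  have hv1 : (u : Matrix (Fin 2) (Fin 2) ℂ) *ᵥ v = μ • v := by
    simpa using hv.apply_eq_smul
  have hv0 : 0 < ‖v 0‖ ^ 2 + ‖v 1‖ ^ 2 := by
    by_contra hc
    apply hv.2
    have h0 : ‖v 0‖ ^ 2 = 0 := by nlinarith [sq_nonneg ‖v 0‖, sq_nonneg ‖v 1‖]
    have h1 : ‖v 1‖ ^ 2 = 0 := by nlinarith [sq_nonneg ‖v 0‖, sq_nonneg ‖v 1‖]
    funext i
    fin_cases i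
    · simpa using h0
    · simpa using h1
  set r : ℝ := Real.sqrt (‖v 0‖ ^ 2 + ‖v 1‖ ^ 2) with hr
  have hrpos : 0 < r := Real.sqrt_pos.2 hv0
  have hr2 : r ^ 2 = ‖v 0‖ ^ 2 + ‖v 1‖ ^ 2 := Real.sq_sqrt hv0.le
  have hcol : ‖v 0 / r‖ ^ 2 + ‖v 1 / r‖ ^ 2 = 1 := by
    rw [norm_div, norm_div, Complex.norm_real, Real.norm_of_nonneg hrpos.le, div_pow, div_pow,
      ← add_div, ← hr2, div_self (by positivity)]
  set w : Matrix (Fin 2) (Fin 2) ℂ := !![v 0 / r, -star (v 1 / r); v 1 / r, star (v 0 / r)] with hw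
  have hwU : w ∈ Matrix.unitaryGroup (Fin 2) ℂ := exists_unitary_of_column hcol
  have hwcol : ∀ i, w i 0 = v i / r := by
    intro i
    fin_cases i <;> simp [hw]
  set t : Matrix (Fin 2) (Fin 2) ℂ := star w * u * w with ht
  have htU : t ∈ Matrix.unitaryGroup (Fin 2) ℂ :=
    mul_mem (mul_mem (Unitary.star_mem hwU) u.2) hwU
  have huw : ∀ i, ((u : Matrix (Fin 2) (Fin 2) ℂ) * w) i 0 = μ * w i 0 := by
    intro i
    have := congrFun hv1 i
    rw [Matrix.mulVec, dotProduct] at this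
    rw [Matrix.mul_apply, hwcol]
    simp only [hwcol, ← mul_div_assoc]
    rw [← Finset.sum_div, this]
    simp
  have ht0 : ∀ i, t i 0 = μ * (1 : Matrix (Fin 2) (Fin 2) ℂ) i 0 := by
    intro i
    rw [ht, mul_assoc, Matrix.mul_apply]
    simp only [huw]
    rw [← Matrix.mem_unitaryGroup_iff'.1 hwU, Matrix.mul_apply, Finset.mul_sum]
    exact Finset.sum_congr rfl fun k _ => by ring
  have ht10 : t 1 0 = 0 := by simpa using ht0 1
  have hc0 := norm_sq_col_of_unitary htU 0
  have hc1 := norm_sq_col_of_unitary htU 1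
  rw [ht10, norm_zero] at hc0
  have ht00 : t 0 0 ≠ 0 := by
    intro h
    simp [h] at hc0
  have ht01 : t 0 1 = 0 := by
    have h := congrFun (congrFun (Matrix.mem_unitaryGroup_iff'.1 htU) 0) 1
    simp [Matrix.mul_apply, Fin.sum_univ_two, Matrix.star_apply, ht10, ht00] at h
    exact h
  rw [ht01, norm_zero] at hc1
  refine ⟨⟨w, hwU⟩, t 0 0, t 1 1, ?_, ?_, ?_⟩
  · have : ‖t 0 0‖ ^ 2 = 1 := by linarith
    nlinarith [norm_nonneg (t 0 0)]
  · have : ‖t 1 1‖ ^ 2 = 1 := by linarith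
    nlinarith [norm_nonneg (t 1 1)]
  · have hd : diagonal ![t 0 0, t 1 1] = t := by
      ext i j
      fin_cases i <;> fin_cases j <;> simp [ht10, ht01]
    have hww := Matrix.mem_unitaryGroup_iff.1 hwU
    change (u : Matrix (Fin 2) (Fin 2) ℂ) = w * _ * star w
    rw [hd, ht, show w * (star w * (u : Matrix (Fin 2) (Fin 2) ℂ) * w) * star w =
      (w * star w) * u * (w * star w) by simp only [mul_assoc], hww, one_mul, mul_one]

theorem diagonal_mem_unitaryGroup {p q : ℂ} (hp : ‖p‖ = 1) (hq : ‖q‖ = 1) :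
    diagonal ![p, q] ∈ Matrix.unitaryGroup (Fin 2) ℂ := by
  have h1 : ∀ z : ℂ, ‖z‖ = 1 → star z * z = 1 := fun z hz => by
    rw [Complex.star_def, mul_comm, Complex.mul_conj, Complex.normSq_eq_norm_sq, hz]; simp
  rw [Matrix.mem_unitaryGroup_iff', Matrix.star_eq_conjTranspose, diagonal_conjTranspose,
    diagonal_mul_diagonal, ← diagonal_one]
  congr 1
  funext i
  fin_cases i
  · simpa using h1 p hp
  · simpa using h1 q hq

/-- The `NOT` gate. -/
def notGate : Matrix (Fin 2) (Fin 2) ℂ := !![0, 1; 1, 0]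

theorem notGate_mem : notGate ∈ Matrix.unitaryGroup (Fin 2) ℂ := by
  rw [Matrix.mem_unitaryGroup_iff']
  ext i j
  fin_cases i <;> fin_cases j <;> simp [notGate, Matrix.mul_apply, Fin.sum_univ_two]

/-- A unitary square root of the `NOT` gate. -/
noncomputable def sqrtNot : Matrix (Fin 2) (Fin 2) ℂ :=
  !![(1 + Complex.I) / 2, (1 - Complex.I) / 2; (1 - Complex.I) / 2, (1 + Complex.I) / 2]

theorem sqrtNot_mem : sqrtNot ∈ Matrix.unitaryGroup (Fin 2) ℂ := by
  rw [Matrix.mem_unitaryGroup_iff']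
  ext i j
  fin_cases i <;> fin_cases j <;>
    simp [sqrtNot, Matrix.mul_apply, Fin.sum_univ_two, map_ofNat] <;> ring_nf <;> simp <;> norm_num

theorem sqrtNot_mul_self : sqrtNot * sqrtNot = notGate := by
  ext i j
  fin_cases i <;> fin_cases j <;>
    simp [sqrtNot, notGate, Matrix.mul_apply, Fin.sum_univ_two] <;> ring_nf <;> simp <;> norm_num

end TwoByTwo

/-! ### Gates with one control -/

section Controlled

open Matrix Function

variable {ι : Type} [Fintype ι] [DecidableEq ι]

theorem mux_diagonal (i : ι) (d : (ι → Fin 2) → Fin 2 → ℂ) (ψ : (ι → Fin 2) → ℂ)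
    (b : ι → Fin 2) : mux i (fun b => diagonal (d b)) ψ b = d b (b i) * ψ b := by
  simp [mux, diagonal_apply]

/-- A controlled one-qubit gate. With `u = w diag(p, q) w*` and `y² = q / p`, the diagonal part is
`diag(1, y*)` on the target conjugated by C-NOT, times `diag(1, y)` on the target and
`diag(1, p y)` on the control. -/
theorem Impl.ctrl_one {c t : ι} (hct : c ≠ t) (u : Matrix.unitaryGroup (Fin 2) ℂ) :
    Impl 7 (ctrl (fun b => b c = 1) t (u : Matrix (Fin 2) (Fin 2) ℂ)) := by
  obtain ⟨w, p, q, hp, hq, hu⟩ := exists_diagonalization u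
  obtain ⟨y, hy⟩ := IsAlgClosed.exists_pow_nat_eq (q / p) (n := 2) (by norm_num)
  have hp0 : p ≠ 0 := by rintro rfl; simp at hp
  have hy1 : ‖y‖ = 1 := by
    have : ‖y‖ ^ 2 = 1 := by rw [← norm_pow, hy, norm_div, hp, hq, div_one]
    nlinarith [norm_nonneg y]
  have hyy : star y * y = 1 := by
    rw [Complex.star_def, mul_comm, Complex.mul_conj, Complex.normSq_eq_norm_sq, hy1]; simp
  have hpy : p * y * y = q := by
    rw [mul_assoc, ← sq, hy, mul_div_cancel₀ _ hp0]
  have hsy : ‖star y‖ = 1 := by rw [norm_star, hy1]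
  have h1 : ‖(1 : ℂ)‖ = 1 := norm_one
  have hpy1 : ‖p * y‖ = 1 := by rw [norm_mul, hp, hy1, one_mul]
  -- the phases `(p, q)` on the target, controlled by `c`
  have hdiag : Impl 5 (ctrl (fun b : ι → Fin 2 => b c = 1) t (diagonal ![p, q])) := by
    have hA := Impl.single t ⟨_, diagonal_mem_unitaryGroup h1 hsy⟩
    have hB := Impl.single t ⟨_, diagonal_mem_unitaryGroup h1 hy1⟩
    have hC := Impl.single c ⟨_, diagonal_mem_unitaryGroup h1 hpy1⟩
    have hX := Impl.cnot hct
    convert hC.comp (hB.comp ((hX.comp hA).comp hX)) using 1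
    funext ψ b
    have hb : ∀ x : Fin 2, x = 0 ∨ x = 1 := by decide
    have h11 : (1 : Fin 2) + 1 = 0 := by decide
    have hyy' : (starRingEnd ℂ) y * y = 1 := hyy
    have hff : flipBy t (fun b => b c) (flipBy t (fun b => b c) b) = b :=
      flipBy_flipBy (fun b x => by simp [hct]) b
    have hctrl : ctrl (fun b : ι → Fin 2 => b c = 1) t (diagonal ![p, q]) ψ b =
        (if b c = 1 then ![p, q] (b t) else 1) * ψ b := by
      unfold ctrl
      rw [← mux_diagonal t (fun b k => if b c = 1 then ![p, q] k else 1) ψ b]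
      congr 1
      funext b
      split_ifs
      · rfl
      · exact diagonal_one.symm
    have hbt : flipBy t (fun b => b c) b t = b t + b c := flipBy_apply_self _ _ _
    rw [hctrl, mux_diagonal, mux_diagonal, Function.comp_apply, mux_diagonal, Function.comp_apply,
      hff, hbt]
    rcases hb (b c) with hc | hc <;> rcases hb (b t) with ht | ht <;> simp only [hc, ht]
    · simp
    · simp
      linear_combination (-ψ b) * hyy'
    · simp
      linear_combination (-p * ψ b) * hyy'
    · simp [h11]
      linear_combination (-ψ b) * hpy
  have hw := Impl.single t w
  have hw' := Impl.single t w⁻¹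
  have hcw : ∀ b x, (fun _ : ι → Fin 2 => (w⁻¹).1) (update b t x) = (fun _ => (w⁻¹).1) b :=
    fun _ _ => rfl
  have hcd : ∀ b x, (if (update b t x : ι → Fin 2) c = 1 then diagonal ![p, q] else 1) =
      if b c = 1 then diagonal ![p, q] else 1 := fun b x => by simp [hct]
  convert hw.mux_mul (hdiag.mux_mul hw' hcw) (fun b x => by simp [hct]) using 1
  unfold ctrl
  congr 1
  funext b
  have hww : (w : Matrix (Fin 2) (Fin 2) ℂ) * star (w : Matrix (Fin 2) (Fin 2) ℂ) = 1 :=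
    Matrix.mem_unitaryGroup_iff.1 w.2
  split_ifs
  · rw [hu, Matrix.UnitaryGroup.inv_val, mul_assoc]
  · rw [one_mul, Matrix.UnitaryGroup.inv_val, hww]

theorem mux_notGate (t : ι) (P : (ι → Fin 2) → Prop) [DecidablePred P] :
    ctrl P t notGate = fun ψ => ψ ∘ flipBy t fun b => if P b then 1 else 0 := by
  funext ψ b
  have hb : ∀ x : Fin 2, x = 0 ∨ x = 1 := by decide
  have h11 : (1 : Fin 2) + 1 = 0 := by decide
  have hbt := update_eq_self t b
  by_cases hP : P b
  · rcases hb (b t) with ht | ht <;>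
      simp [ctrl, mux, hP, notGate, Fin.sum_univ_two, flipBy, ht, h11]
  · simp [ctrl, mux, hP, flipBy, Matrix.one_apply]

theorem Impl.not (t : ι) : Impl 1 fun ψ : (ι → Fin 2) → ℂ => ψ ∘ flipBy t fun _ => 1 := by
  convert Impl.single t ⟨_, notGate_mem⟩ using 1
  have := mux_notGate t (fun _ : ι → Fin 2 => True)
  simp only [if_true] at this
  rw [← this]
  simp [ctrl]

/-- The Toffoli gate. -/
theorem Impl.toffoli {c d t : ι} (hcd : c ≠ d) (hct : c ≠ t) (hdt : d ≠ t) :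
    Impl 23 fun ψ : (ι → Fin 2) → ℂ => ψ ∘ flipBy t fun b => b c * b d := by
  set V : Matrix.unitaryGroup (Fin 2) ℂ := ⟨sqrtNot, sqrtNot_mem⟩ with hV
  have hA := Impl.ctrl_one hct V
  have hB := Impl.ctrl_one hdt V
  have hC : Impl (7 + 2 * 1) _ := (Impl.cnot hcd).mux_conj (Impl.ctrl_one hdt V⁻¹)
    (flipBy_flipBy fun b x => by simp [hcd])
    (fun b => flipBy_apply_of_ne hdt.symm _ b)
    (flipBy_update hdt.symm fun b x => by simp [hct])
  have hflip : ∀ b : ι → Fin 2, flipBy d (fun b => b c) b d = b d + b c :=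
    fun b => flipBy_apply_self _ _ _
  simp only [hflip] at hC
  have key := hA.mux_mul (hC.mux_mul hB (fun b x => by simp [hdt])) (fun b x => by
    simp [hdt, hct])
  convert key using 1
  have h := mux_notGate t (fun b : ι → Fin 2 => b c = 1 ∧ b d = 1)
  have h' : (fun b : ι → Fin 2 => if b c = 1 ∧ b d = 1 then (1 : Fin 2) else 0) =
      fun b => b c * b d := by
    funext b
    generalize b c = x
    generalize b d = y
    revert x y
    decide
  rw [h'] at h
  rw [← h]
  unfold ctrl
  congr 1
  funext b
  have hb : ∀ x : Fin 2, x = 0 ∨ x = 1 := by decide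
  have h11 : (1 : Fin 2) + 1 = 0 := by decide
  have hVV : (V : Matrix (Fin 2) (Fin 2) ℂ) * V = notGate := sqrtNot_mul_self
  have hV1 : (V : Matrix (Fin 2) (Fin 2) ℂ) * (V⁻¹ : Matrix.unitaryGroup (Fin 2) ℂ) = 1 := by
    rw [Matrix.UnitaryGroup.inv_val]; exact Matrix.mem_unitaryGroup_iff.1 V.2
  have hV2 : ((V⁻¹ : Matrix.unitaryGroup (Fin 2) ℂ) : Matrix (Fin 2) (Fin 2) ℂ) * V = 1 := by
    rw [Matrix.UnitaryGroup.inv_val]; exact Matrix.mem_unitaryGroup_iff'.1 V.2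
  rcases hb (b c) with hc | hc <;> rcases hb (b d) with hd | hd <;>
    simp only [hc, hd, h11, zero_add, add_zero, and_self, and_true, and_false, if_true,
      if_false, zero_ne_one, one_mul, mul_one, hVV, hV1, hV2]

end Controlled

/-! ### Gates with several controls -/

section MultiControlled

open Matrix Function

variable {ι : Type} [Fintype ι] [DecidableEq ι]

/-- Adding to a bit the indicator of `b c = 1 ∧ b w = v`. -/
theorem Impl.flipBy_and {c w t : ι} (v : Fin 2) (hcw : c ≠ w) (hct : c ≠ t) (hwt : w ≠ t) :
    Impl 24 fun ψ : (ι → Fin 2) → ℂ =>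
      ψ ∘ flipBy t fun b => if b c = 1 ∧ b w = v then 1 else 0 := by
  have h := Impl.toffoli hcw hct hwt
  have hv : v = 0 ∨ v = 1 := by revert v; decide
  rcases hv with rfl | rfl
  · convert h.flipBy_add (Impl.cnot hct) (fun b x => by simp [hct, hwt]) using 4
    funext b
    generalize b c = x
    generalize b w = y
    revert x y
    decide
  · convert h.mono (by norm_num : 23 ≤ 24) using 4
    funext b
    generalize b c = x
    generalize b w = y
    revert x y
    decide

theorem Impl.flipBy_eq {w t : ι} (v : Fin 2) (hwt : w ≠ t) :
    Impl 2 fun ψ : (ι → Fin 2) → ℂ => ψ ∘ flipBy t fun b => if b w = v then 1 else 0 := by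
  have h := Impl.cnot hwt
  have hv : v = 0 ∨ v = 1 := by revert v; decide
  rcases hv with rfl | rfl
  · convert h.flipBy_add (Impl.not t) (fun b x => by simp [hwt]) using 4
    funext b
    generalize b w = y
    revert y
    decide
  · convert h.mono (by norm_num : 1 ≤ 2) using 4
    funext b
    generalize b w = y
    revert y
    decide

/-- Conjugating a controlled gate by a flip of an ancilla. -/
theorem Impl.ctrl_conj {N N' : ℕ} {i a : ι} {g : (ι → Fin 2) → Fin 2} {P : (ι → Fin 2) → Prop}
    {u : Matrix (Fin 2) (Fin 2) ℂ} (hg : Impl N' fun ψ : (ι → Fin 2) → ℂ => ψ ∘ flipBy a g)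
    (h : Impl N (ctrl P i u)) (hia : i ≠ a) (hga : ∀ b x, g (update b a x) = g b)
    (hgi : ∀ b x, g (update b i x) = g b) :
    Impl (N + 2 * N') (ctrl (fun b => P (flipBy a g b)) i u) :=
  hg.mux_conj h (flipBy_flipBy hga) (fun b => flipBy_apply_of_ne hia g b) (flipBy_update hia hgi)

theorem Impl.ctrl_pattern_of_wire {i : ι} (u : Matrix.unitaryGroup (Fin 2) ℂ)
    (L : List (ι × Fin 2)) :
    ∀ (c : ι) (as : List ι), L.length ≤ as.length → as.Nodup → i ∉ as → c ∉ as → c ≠ i →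
      (∀ p ∈ L, p.1 ≠ i ∧ p.1 ∉ as ∧ p.1 ≠ c) →
      ∃ P : (ι → Fin 2) → Prop, Impl (48 * L.length + 7) (ctrl P i u) ∧
        (∀ b, (∀ a ∈ as, b a = 0) → (P b ↔ b c = 1 ∧ ∀ p ∈ L, b p.1 = p.2)) ∧
        ∀ b x, P (update b i x) ↔ P b := by
  induction L with
  | nil =>
    intro c as _ _ _ _ hci _
    exact ⟨fun b => b c = 1, (Impl.ctrl_one hci u).mono (by simp), by simp, by simp [hci]⟩
  | cons p L ih =>
    intro c as hlen hnd hi hc hci hL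
    obtain _ | ⟨a, as⟩ := as
    · simp at hlen
    rw [List.forall_mem_cons] at hL
    simp only [List.nodup_cons, List.mem_cons, not_or, List.length_cons] at hnd hi hc hL hlen
    obtain ⟨⟨hpi, ⟨hpa, hpas⟩, hpc⟩, hL⟩ := hL
    obtain ⟨P, hP, hPb, hPi⟩ := ih a as (by omega) hnd.2 hi.2 hnd.1 (Ne.symm hi.1)
      fun p hp => ⟨(hL p hp).1, (hL p hp).2.1.2, (hL p hp).2.1.1⟩
    have hg := Impl.flipBy_and p.2 (Ne.symm hpc) hc.1 hpa
    refine ⟨_, (hg.ctrl_conj hP hi.1 (fun b x => by simp [hc.1, hpa])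
      (fun b x => by simp [hpi, hci])).mono (by simp only [List.length_cons]; omega), ?_, ?_⟩
    · intro b hb
      simp only [List.forall_mem_cons] at hb
      rw [hPb _ fun a' ha' => by
        rw [flipBy_apply_of_ne (by rintro rfl; exact hnd.1 ha')]; exact hb.2 a' ha',
        flipBy_apply_self, hb.1, List.forall_mem_cons, ← and_assoc]
      refine and_congr ?_ (forall₂_congr fun p hp => ?_)
      · split_ifs with h <;> simp [h]
      · rw [flipBy_apply_of_ne (hL p hp).2.1.1]
    · intro b x
      rw [flipBy_update hi.1 (fun b x => by simp [hpi, hci]), hPi]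

/-- A gate controlled by prescribed values of the bits on a list of wires. The conjunction of the
conditions is accumulated in the clean wires `as`; the behaviour for other values on `as` is left
unspecified. -/
theorem Impl.ctrl_pattern {i : ι} (u : Matrix.unitaryGroup (Fin 2) ℂ)
    (L : List (ι × Fin 2)) (as : List ι) (hlen : L.length ≤ as.length) (hnd : as.Nodup)
    (hi : i ∉ as) (hL : ∀ p ∈ L, p.1 ≠ i ∧ p.1 ∉ as) :
      ∃ P : (ι → Fin 2) → Prop, Impl (48 * L.length + 7) (ctrl P i u) ∧
        (∀ b, (∀ a ∈ as, b a = 0) → (P b ↔ ∀ p ∈ L, b p.1 = p.2)) ∧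
        ∀ b x, P (update b i x) ↔ P b := by
  obtain _ | ⟨p, L⟩ := L
  · refine ⟨fun _ => True, ?_, by simp, by simp⟩
    have h : ctrl (fun _ => True) i (u : Matrix (Fin 2) (Fin 2) ℂ) = mux i fun _ => u := by
      unfold ctrl
      simp only [if_true]
    rw [h]
    exact (Impl.single i u).mono (by simp)
  obtain _ | ⟨a, as⟩ := as
  · simp at hlen
  rw [List.forall_mem_cons] at hL
  simp only [List.nodup_cons, List.mem_cons, not_or, List.length_cons] at hnd hi hL hlen
  obtain ⟨⟨hpi, hpa, hpas⟩, hL⟩ := hL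
  have hg := Impl.flipBy_eq p.2 hpa
  obtain ⟨P, hP, hPb, hPi⟩ := Impl.ctrl_pattern_of_wire (i := i) u L a as (by omega) hnd.2 hi.2
    hnd.1 (Ne.symm hi.1) fun p hp => ⟨(hL p hp).1, (hL p hp).2.2, (hL p hp).2.1⟩
  refine ⟨_, (hg.ctrl_conj hP hi.1 (fun b x => by simp [hpa]) (fun b x => by simp [hpi])).mono
    (by simp only [List.length_cons]; omega), ?_, ?_⟩
  · intro b hb
    simp only [List.forall_mem_cons] at hb
    rw [hPb _ fun a' ha' => by
      rw [flipBy_apply_of_ne (by rintro rfl; exact hnd.1 ha')]; exact hb.2 a' ha',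
      flipBy_apply_self, hb.1, List.forall_mem_cons]
    refine and_congr ?_ (forall₂_congr fun p hp => ?_)
    · split_ifs with h <;> simp [h]
    · rw [flipBy_apply_of_ne (hL p hp).2.1]
  · intro b x
    rw [flipBy_update hi.1 (fun b x => by simp [hpi]), hPi]

open Classical in
/-- A gate selected from a table by the value `val b` of a function of the other bits. -/
theorem Impl.mux_table {β : Type*} {N : ℕ} {i : ι} (val : (ι → Fin 2) → β)
    (u : β → Matrix.unitaryGroup (Fin 2) ℂ) (clean : (ι → Fin 2) → Prop) (T : Finset β)
    (h : ∀ v ∈ T, ∃ P : (ι → Fin 2) → Prop, Impl N (ctrl P i (u v)) ∧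
      (∀ b, clean b → (P b ↔ val b = v)) ∧ ∀ b x, P (update b i x) ↔ P b) :
    ∃ M : (ι → Fin 2) → Matrix (Fin 2) (Fin 2) ℂ, Impl (T.card * N) (mux i M) ∧
      (∀ b, clean b → M b = if val b ∈ T then (u (val b) : Matrix (Fin 2) (Fin 2) ℂ) else 1) ∧
      ∀ b x, M (update b i x) = M b := by
  induction T using Finset.induction_on with
  | empty =>
    refine ⟨fun _ => 1, ?_, by simp, by simp⟩
    convert Impl.id (ι := ι) using 1
    · simp
    · funext ψ b
      simp [mux, Matrix.one_apply]
  | insert v T hv ih =>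
    obtain ⟨M, hM, hMb, hMi⟩ := ih fun v' hv' => h v' (Finset.mem_insert_of_mem hv')
    obtain ⟨P, hP, hPb, hPi⟩ := h v (Finset.mem_insert_self v T)
    refine ⟨_, (Impl.mux_mul hP hM hMi).mono ?_, ?_, ?_⟩
    · rw [Finset.card_insert_of_notMem hv]; ring_nf; rfl
    · intro b hb
      simp only [hMb b hb, hPb b hb, Finset.mem_insert]
      by_cases h1 : val b = v
      · rw [if_pos h1, if_neg (h1 ▸ hv), if_pos (Or.inl h1), mul_one, h1]
      · simp [h1]
    · intro b x
      simp only [hPi, hMi]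

end MultiControlled

/-! ### Addition of constants -/

section Adder

open Matrix Function

variable {ι : Type} [Fintype ι] [DecidableEq ι]

/-- The number whose binary digits, the lowest one first, are the bits on the wires in the list. -/
def bitsVal (b : ι → Fin 2) : List ι → ℕ
  | [] => 0
  | w :: ws => (b w : ℕ) + 2 * bitsVal b ws

theorem bitsVal_congr {b b' : ι → Fin 2} {ws : List ι} (h : ∀ w ∈ ws, b w = b' w) :
    bitsVal b ws = bitsVal b' ws := by
  induction ws with
  | nil => rfl
  | cons w ws ih =>
    rw [List.forall_mem_cons] at h
    rw [bitsVal, bitsVal, h.1, ih h.2]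

theorem eq_of_bitsVal_eq {b b' : ι → Fin 2} {ws : List ι} (h : bitsVal b ws = bitsVal b' ws) :
    ∀ w ∈ ws, b w = b' w := by
  induction ws with
  | nil => simp
  | cons w ws ih =>
    rw [bitsVal, bitsVal] at h
    have h1 := (b w).2
    have h2 := (b' w).2
    rw [List.forall_mem_cons]
    exact ⟨Fin.ext (by omega), ih (by omega)⟩

theorem Impl.flipBy_sum {F c w : ι} (s : Fin 2) (hFc : F ≠ c) (hFw : F ≠ w) (hcw : c ≠ w) :
    Impl 24 fun ψ : (ι → Fin 2) → ℂ => ψ ∘ flipBy w fun b => b F * (b c + s) := by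
  have h := Impl.toffoli hFc hFw hcw
  have hv : s = 0 ∨ s = 1 := by revert s; decide
  rcases hv with rfl | rfl
  · simpa using h.mono (by norm_num : 23 ≤ 24)
  · convert h.flipBy_add (Impl.cnot hFw) (fun b x => by simp [hcw, hFw]) using 4
    funext b
    generalize b F = x
    generalize b c = y
    revert x y
    decide

theorem Impl.flipBy_carry {a c w : ι} (s : Fin 2) (hac : c ≠ a) (haw : w ≠ a) (hcw : c ≠ w) :
    Impl 25 fun ψ : (ι → Fin 2) → ℂ => ψ ∘ flipBy a fun b => b c * b w + s * (b c + b w) := by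
  have h := Impl.toffoli hcw hac haw
  have hv : s = 0 ∨ s = 1 := by revert s; decide
  rcases hv with rfl | rfl
  · convert h.mono (by norm_num : 23 ≤ 25) using 4
    funext b
    generalize b w = x
    generalize b c = y
    revert x y
    decide
  · convert h.flipBy_add ((Impl.cnot hac).flipBy_add (Impl.cnot haw) (fun b x => by simp [hac]))
      (fun b x => by simp [hac, haw]) using 4
    funext b
    generalize b w = x
    generalize b c = y
    revert x y
    decide

theorem full_adder (F c w s : Fin 2) (V s' M : ℕ) :
    ((w + F * (c + s) : Fin 2) : ℕ) + 2 * ((V + F * (s' + (c * w + s * (c + w) : Fin 2))) % M) =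
      (w + 2 * V + F * (s + 2 * s' + c)) % (2 * M) := by
  rw [Nat.mod_mul]
  have hb : ∀ x : Fin 2, x = 0 ∨ x = 1 := by decide
  have key : ∀ x y z t : ℕ, x = z → y = t → x + 2 * (y % M) = z + 2 * (t % M) := by
    rintro x y _ _ rfl rfl; rfl
  apply key
  · rcases hb F with rfl | rfl <;> rcases hb c with rfl | rfl <;> rcases hb w with rfl | rfl <;>
      rcases hb s with rfl | rfl <;> simp <;> omega
  · rcases hb F with rfl | rfl <;> rcases hb c with rfl | rfl <;> rcases hb w with rfl | rfl <;>
      rcases hb s with rfl | rfl <;> simp <;> omega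

/-- The ripple-carry adder of a constant `s` and the carry bit on wire `c`, controlled by the bit on
wire `F`. The carries are computed in the wires `as`, which have to be clean, and uncomputed. -/
theorem Impl.add (ws : List ι) :
    ∀ (s : ℕ) (F c : ι) (as : List ι), ws.length ≤ as.length + 1 →
      (F :: c :: (ws ++ as)).Nodup →
      ∃ π : (ι → Fin 2) → ι → Fin 2, Impl (74 * ws.length) (fun ψ => ψ ∘ π) ∧
        ∀ b, (∀ a ∈ as, b a = 0) →
          bitsVal (π b) ws = (bitsVal b ws + b F * (s + b c)) % 2 ^ ws.length ∧
          ∀ w, w ∉ ws → π b w = b w := by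
  induction ws with
  | nil =>
    intro s F c as _ _
    exact ⟨_root_.id, by simpa using Impl.id (ι := ι), fun b _ => by simp [bitsVal, Nat.mod_one]⟩
  | cons w ws ih =>
    intro s F c as hlen hnd
    have hs : ((Fin.ofNat 2 s : Fin 2) : ℕ) = s % 2 := rfl
    set s₀ : Fin 2 := Fin.ofNat 2 s with hs₀
    have hss : s = s₀ + 2 * (s / 2) := by rw [hs]; omega
    obtain _ | ⟨w', ws'⟩ := ws
    · simp only [List.cons_append, List.nil_append, List.nodup_cons, List.mem_cons, not_or] at hnd
      refine ⟨_, (Impl.flipBy_sum s₀ hnd.1.1 hnd.1.2.1 hnd.2.1.1).mono (by simp), fun b _ => ?_⟩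
      refine ⟨?_, fun k hk => flipBy_apply_of_ne (by simpa using hk) _ _⟩
      have := full_adder (b F) (b c) (b w) s₀ 0 (s / 2) 1
      rw [← hss, Nat.mod_one] at this
      simpa [bitsVal, flipBy_apply_self] using this
    · obtain _ | ⟨a, as⟩ := as
      · simp at hlen
      set ws := w' :: ws' with hws
      clear_value ws
      have hnd' : (F :: a :: (ws ++ as)).Nodup := by
        simp only [List.cons_append, List.nodup_cons, List.mem_cons, List.mem_append, not_or,
          List.nodup_append] at hnd ⊢
        obtain ⟨⟨h1, h2, h3, h4, h5⟩, ⟨h6, h7, h8, h9⟩, ⟨h10, h11, h12⟩, h13, ⟨h14, h15⟩, h16⟩ := hnd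
        exact ⟨⟨h4, h3, h5⟩, ⟨fun h => h16 a h a (Or.inl rfl) rfl, h14⟩, h13, h15,
          fun x hx y hy => h16 x hx y (Or.inr hy)⟩
      obtain ⟨π, hπ, hπb⟩ := ih (s / 2) F a as (by simpa using hlen) hnd'
      simp only [List.cons_append, List.nodup_cons, List.mem_cons, List.mem_append, not_or] at hnd hnd'
      obtain ⟨⟨hFc, hFw, hFws, hFa, hFas⟩, ⟨hcw, hcws, hca, hcas⟩, ⟨hwws, hwa, hwas⟩, -⟩ := hnd
      obtain ⟨-, ⟨haws, haas⟩, -⟩ := hnd'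
      have hA := Impl.flipBy_carry s₀ hca hwa hcw
      have hW := Impl.flipBy_sum s₀ hFc hFw hcw
      refine ⟨_, (hW.perm_comp (hA.perm_comp (hπ.perm_comp hA))).mono
        (by simp only [List.length_cons]; omega), fun b hb => ?_⟩
      rw [List.forall_mem_cons] at hb
      simp only [Function.comp_apply]
      set g : (ι → Fin 2) → Fin 2 := fun b => b c * b w + s₀ * (b c + b w) with hg
      set b₁ := flipBy a g b with hb₁
      have h1 : ∀ k, k ≠ a → b₁ k = b k := fun k hk => flipBy_apply_of_ne hk _ _
      have h1a : b₁ a = g b := by rw [hb₁, flipBy_apply_self, hb.1, zero_add]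
      obtain ⟨h2v, h2⟩ := hπb b₁ fun a' ha' => by
        rw [h1 a' (by rintro rfl; exact haas ha')]; exact hb.2 a' ha'
      set b₂ := π b₁ with hb₂
      set b₃ := flipBy a g b₂ with hb₃
      have h3 : ∀ k, k ≠ a → b₃ k = b₂ k := fun k hk => flipBy_apply_of_ne hk _ _
      have h2c : b₂ c = b c := by rw [h2 c hcws, h1 c hca]
      have h2w : b₂ w = b w := by rw [h2 w hwws, h1 w hwa]
      have h3a : b₃ a = b a := by
        have hgg : g b₂ = g b := by simp only [hg, h2c, h2w]
        have hzz : ∀ x : Fin 2, x + x = 0 := by decide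
        rw [hb₃, flipBy_apply_self, h2 a haws, h1a, hgg, hb.1, hzz]
      have h3F : b₃ F = b F := by rw [h3 F hFa, h2 F hFws, h1 F hFa]
      have h3c : b₃ c = b c := by rw [h3 c hca, h2c]
      have h3w : b₃ w = b w := by rw [h3 w hwa, h2w]
      refine ⟨?_, fun k hk => ?_⟩
      · have hcons : ∀ b' : ι → Fin 2, bitsVal b' (w :: ws) = b' w + 2 * bitsVal b' ws := fun _ => rfl
        rw [hcons, hcons, flipBy_apply_self, h3w, h3F, h3c,
          bitsVal_congr (b' := b₂) fun k hk => by
            rw [flipBy_apply_of_ne (by rintro rfl; exact hwws hk),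
              h3 k (by rintro rfl; exact haws hk)],
          h2v, h1 F hFa, h1a, bitsVal_congr (b := b₁) (b' := b) fun k hk =>
            h1 k (by rintro rfl; exact haws hk), full_adder, ← hss, List.length_cons, pow_succ']
      · rw [List.mem_cons, not_or] at hk
        rw [flipBy_apply_of_ne hk.1]
        by_cases hka : k = a
        · rw [hka, h3a]
        · rw [h3 k hka, h2 k hk.2, h1 k hka]

theorem Impl.injective {N : ℕ} {π : (ι → Fin 2) → ι → Fin 2} (h : Impl N fun ψ => ψ ∘ π) :
    Injective π := by
  obtain ⟨U, -, h⟩ := h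
  replace h : ∀ ψ, QCircuit.matrix U *ᵥ ψ = ψ ∘ π := h
  intro b b' hbb
  have hU := Matrix.mem_unitaryGroup_iff.1 (QCircuit.matrix_mem_unitaryGroup U)
  have hsurj : ∀ φ : (ι → Fin 2) → ℂ, φ b = φ b' := by
    intro φ
    have : φ = (star (QCircuit.matrix U) *ᵥ φ) ∘ π := by
      rw [← h, Matrix.mulVec_mulVec, hU, Matrix.one_mulVec]
    rw [this, Function.comp_apply, Function.comp_apply, hbb]
  have := hsurj (Pi.single b 1)
  by_contra hne
  rw [Pi.single_eq_same, Pi.single_eq_of_ne (Ne.symm hne)] at this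
  exact one_ne_zero this

end Adder

/-! ### One-qubit gates in parallel -/

section Layer

open Matrix Function

variable {ι : Type} [Fintype ι] [DecidableEq ι]

/-- One-qubit gates applied in parallel to a family of wires. -/
theorem Impl.layer {l : ℕ} (K : Fin l → ι) (hK : Injective K)
    (u : Fin l → Matrix.unitaryGroup (Fin 2) ℂ) :
    Impl l fun ψ b => ∑ x : Fin l → Fin 2,
      (∏ q, (u q : Matrix (Fin 2) (Fin 2) ℂ) (b (K q)) (x q)) * ψ (extend K x b) := by
  induction l with
  | zero =>
    convert Impl.id (ι := ι) using 3
    rename_i ψ b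
    rw [Fintype.sum_unique]
    have : ∀ x, extend K x b = b := fun x => by
      funext k
      exact extend_apply' _ _ _ (by rintro ⟨q, -⟩; exact q.elim0)
    rw [this, Finset.univ_eq_empty, Finset.prod_empty, one_mul]
  | succ l ih =>
    have hK' : Injective fun q : Fin l => K q.succ := hK.comp (Fin.succ_injective l)
    convert (Impl.single (K 0) (u 0)).comp (ih _ hK' fun q => u q.succ) using 1
    funext ψ b
    rw [mux, ← (Fin.consEquiv fun _ : Fin (l + 1) => Fin 2).sum_comp, Fintype.sum_prod_type]
    refine Finset.sum_congr rfl fun x _ => ?_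
    rw [Finset.mul_sum]
    refine Finset.sum_congr rfl fun y _ => ?_
    have h1 : ∀ q : Fin l, update b (K 0) x (K q.succ) = b (K q.succ) := fun q =>
      update_of_ne (fun h => (Fin.succ_ne_zero q) (hK h)) _ _
    have h2 : extend K (Fin.cons x y : Fin (l + 1) → Fin 2) b =
        extend (fun q : Fin l => K q.succ) y (update b (K 0) x) := by
      funext k
      by_cases hk : ∃ q, K q = k
      · obtain ⟨q, rfl⟩ := hk
        rw [hK.extend_apply]
        refine Fin.cases ?_ (fun q => ?_) q
        · rw [extend_apply', update_self, Fin.cons_zero]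
          rintro ⟨q, hq⟩
          exact Fin.succ_ne_zero q (hK hq)
        · rw [hK'.extend_apply (f := fun q : Fin l => K q.succ), Fin.cons_succ]
      · rw [extend_apply' _ _ _ hk, extend_apply', update_of_ne]
        · rintro rfl; exact hk ⟨0, rfl⟩
        · rintro ⟨q, hq⟩; exact hk ⟨_, hq⟩
    replace h2 : extend K ((Fin.consEquiv fun _ : Fin (l + 1) => Fin 2) (x, y)) b = _ := h2
    simp only [Fin.consEquiv_apply, Fin.prod_univ_succ, Fin.cons_zero, Fin.cons_succ, h1,
      mul_assoc]
    rw [h2]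

end Layer

/-! ### The Fejér–Riesz theorem -/

section FejerRiesz

open Matrix Polynomial

/-- On the unit circle, a polynomial is determined by its values. -/
theorem Polynomial.eq_of_eval_circle {F G : ℂ[X]} (h : ∀ z : ℂ, ‖z‖ = 1 → F.eval z = G.eval z) :
    F = G := by
  refine Polynomial.eq_of_infinite_eval_eq F G (Set.Infinite.mono (s := Metric.sphere (0 : ℂ) 1) ?_ ?_)
  · intro z hz
    exact h z (by simpa using hz)
  · have : (Metric.sphere (0 : ℂ) 1).Infinite := by
      have h1 : Set.InjOn (fun t : ℝ => Complex.exp (t * Complex.I)) (Set.Ioc 0 1) := by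
        intro s hs t ht hst
        simp only at hst
        rw [Complex.exp_eq_exp_iff_exists_int] at hst
        obtain ⟨n, hn⟩ := hst
        have h2 : (s : ℂ) = t + n * (2 * Real.pi) := by
          have := Complex.I_ne_zero
          apply mul_right_cancel₀ this
          rw [hn]; ring
        have h3 : s = t + n * (2 * Real.pi) := by exact_mod_cast h2
        have hpi := Real.pi_gt_three
        have h4 : n = 0 := by
          have h5 : (n : ℝ) < 1 := by
            by_contra hc
            nlinarith [hs.1, hs.2, ht.1, ht.2]
          have h6 : (-1 : ℝ) < n := by
            by_contra hc
            nlinarith [hs.1, hs.2, ht.1, ht.2]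
          have h7 : n < 1 := by exact_mod_cast h5
          have h8 : -1 < n := by exact_mod_cast h6
          omega
        rw [h4] at h3
        simpa using h3
      refine ((Set.infinite_image_iff h1).2 (Set.Ioc_infinite one_pos)).mono ?_
      rintro _ ⟨t, -, rfl⟩
      simp [Complex.norm_exp_ofReal_mul_I]
    exact this

/-- The polynomial `z ^ N * conj (P (1 / conj z))`. -/
noncomputable def conjReflect (N : ℕ) (P : ℂ[X]) : ℂ[X] :=
  (P.map (starRingEnd ℂ)).reflect N

theorem conjReflect_coeff_of_le {N k : ℕ} (hk : k ≤ N) (P : ℂ[X]) :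
    (conjReflect N P).coeff k = star (P.coeff (N - k)) := by
  rw [conjReflect, coeff_reflect, revAt_le hk, coeff_map]; rfl

theorem conjReflect_natDegree_le {N : ℕ} {P : ℂ[X]} (hP : P.natDegree ≤ N) :
    (conjReflect N P).natDegree ≤ N := by
  rw [conjReflect]
  refine (natDegree_reflect_le).trans ?_
  simpa using hP

theorem conjReflect_eval {N : ℕ} {P : ℂ[X]} (hP : P.natDegree ≤ N) {z : ℂ} (hz : z ≠ 0) :
    (conjReflect N P).eval z = z ^ N * star (P.eval (star z)⁻¹) := by
  have hz' : z⁻¹ ≠ 0 := inv_ne_zero hz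
  let _ := invertibleOfNonzero hz'
  have h := eval₂_reflect_mul_pow (RingHom.id ℂ) z⁻¹ N (P.map (starRingEnd ℂ))
    (by simpa using hP)
  rw [invOf_eq_inv, inv_inv] at h
  rw [conjReflect, eval, mul_comm]
  have h2 : star (P.eval (star z)⁻¹) = eval₂ (RingHom.id ℂ) z⁻¹ (P.map (starRingEnd ℂ)) := by
    have : z⁻¹ = (starRingEnd ℂ) ((star z)⁻¹) := by simp
    rw [eval₂_id, this, eval_map, eval₂_hom]
    rfl
  rw [h2, ← h, mul_assoc, ← mul_pow, inv_mul_cancel₀ hz, one_pow, mul_one]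

theorem conjReflect_eval_circle {N : ℕ} {P : ℂ[X]} (hP : P.natDegree ≤ N) {z : ℂ} (hz : ‖z‖ = 1) :
    (conjReflect N P).eval z = z ^ N * star (P.eval z) := by
  have hz0 : z ≠ 0 := by rintro rfl; simp at hz
  rw [conjReflect_eval hP hz0]
  congr 3
  rw [Complex.star_def, ← Complex.inv_eq_conj hz, inv_inv]

/-- **Fejér–Riesz theorem** for strictly positive trigonometric polynomials: if
`F(z) = z ^ d * r(z)` with `r > 0` on the unit circle, then `r = |q| ^ 2` there for a polynomial `q`
of degree at most `d`. The roots of `F` off the unit circle come in pairs `w, 1 / conj w`, which are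
split off one after the other. -/
theorem exists_fejerRiesz (d : ℕ) : ∀ (F : ℂ[X]) (r : ℂ → ℝ), F.natDegree ≤ 2 * d →
    (∀ z : ℂ, ‖z‖ = 1 → 0 < r z ∧ F.eval z = z ^ d * r z) →
    ∃ q : ℂ[X], q.natDegree ≤ d ∧ ∀ z : ℂ, ‖z‖ = 1 → r z = ‖q.eval z‖ ^ 2 := by
  induction d with
  | zero =>
    intro F r hF hr
    rw [eq_C_of_natDegree_eq_zero (Nat.le_zero.1 hF)] at hr
    have h1 := hr 1 (by simp)
    simp only [eval_C, pow_zero, one_mul] at hr h1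
    refine ⟨C ((Real.sqrt (r 1) : ℝ) : ℂ), by simp, fun z hz => ?_⟩
    have h2 : r z = r 1 := by
      have := (hr z hz).2
      rw [h1.2] at this
      exact_mod_cast this.symm
    rw [h2, eval_C, Complex.norm_real, Real.norm_eq_abs, sq_abs, Real.sq_sqrt h1.1.le]
  | succ d ih =>
    intro F r hF hr
    have hne : ∀ z : ℂ, ‖z‖ = 1 → z ≠ 0 := fun z hz => by rintro rfl; simp at hz
    have hsym : conjReflect (2 * (d + 1)) F = F := by
      refine eq_of_eval_circle fun z hz => ?_
      rw [conjReflect_eval_circle hF hz, (hr z hz).2, star_mul', star_pow, Complex.star_def,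
        Complex.conj_ofReal, ← Complex.inv_eq_conj hz, two_mul, pow_add, inv_pow]
      have := pow_ne_zero (d + 1) (hne z hz)
      field_simp
    by_cases h0 : F.coeff 0 = 0
    · -- `F` is divisible by `X`, and by symmetry its degree is smaller than `2 * d + 2`
      have htop : F.coeff (2 * (d + 1)) = 0 := by
        rw [← hsym, conjReflect_coeff_of_le le_rfl, Nat.sub_self, h0, star_zero]
      obtain ⟨F₁, rfl⟩ := X_dvd_iff.2 h0
      have hdeg : F₁.natDegree ≤ 2 * d := by
        rw [natDegree_le_iff_coeff_eq_zero]
        intro N hN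
        rcases Nat.lt_or_ge (2 * d + 1) N with h | h
        · rw [← coeff_X_mul]
          exact coeff_eq_zero_of_natDegree_lt (by omega)
        · have : N = 2 * d + 1 := by omega
          rw [← coeff_X_mul, this]
          exact htop
      obtain ⟨q, hq, hqr⟩ := ih F₁ r hdeg fun z hz => by
        refine ⟨(hr z hz).1, ?_⟩
        have h := (hr z hz).2
        rw [eval_mul, eval_X, pow_succ', mul_assoc] at h
        exact mul_left_cancel₀ (hne z hz) h
      exact ⟨q, by omega, hqr⟩
    · have hdegF : F.natDegree = 2 * (d + 1) := by
        refine le_antisymm hF (le_natDegree_of_ne_zero ?_)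
        rw [← hsym, conjReflect_coeff_of_le le_rfl, Nat.sub_self]
        simpa using h0
      obtain ⟨w, hw⟩ := IsAlgClosed.exists_root F (by
        intro h
        have := natDegree_eq_zero_iff_degree_le_zero.2 h.le
        omega)
      have hw0 : w ≠ 0 := by
        rintro rfl
        apply h0
        rw [coeff_zero_eq_eval_zero]; exact hw
      have hw1 : ‖w‖ ≠ 1 := by
        intro h
        have h2 := hr w h
        rw [hw.eq_zero] at h2
        have h3 := mul_ne_zero (pow_ne_zero (d + 1) (hne w h)) (Complex.ofReal_ne_zero.2 h2.1.ne')
        exact h3 h2.2.symm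
      have hws : star w ≠ 0 := by simpa using hw0
      have hw' : F.eval (star w)⁻¹ = 0 := by
        rw [← hsym, conjReflect_eval hF (inv_ne_zero hws)]
        have : (star (star w)⁻¹)⁻¹ = w := by simp
        rw [this, hw.eq_zero, star_zero, mul_zero]
      obtain ⟨F₀, hF₀⟩ := dvd_iff_isRoot.2 hw
      have hww : (star w)⁻¹ - w ≠ 0 := by
        intro h
        apply hw1
        have h1 : (star w)⁻¹ = w := sub_eq_zero.1 h
        have h2 : w * star w = 1 := by
          nth_rewrite 1 [← h1]
          exact inv_mul_cancel₀ hws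
        rw [Complex.star_def, Complex.mul_conj, Complex.normSq_eq_norm_sq] at h2
        have h3 : ‖w‖ ^ 2 = 1 := by exact_mod_cast h2
        nlinarith [norm_nonneg w]
      have hF₀root : IsRoot F₀ (star w)⁻¹ := by
        rw [hF₀, eval_mul, eval_sub, eval_X, eval_C] at hw'
        exact (mul_eq_zero.1 hw').resolve_left hww
      obtain ⟨F₁, hF₁⟩ := dvd_iff_isRoot.2 hF₀root
      have hF0 : F ≠ 0 := by
        rintro rfl; simp at h0
      have hFF : F = (X - C w) * ((X - C (star w)⁻¹) * F₁) := by rw [← hF₁, hF₀]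
      have hF1 : F₁ ≠ 0 := by
        rintro rfl
        apply hF0
        rw [hFF]; simp
      have hdeg : F₁.natDegree ≤ 2 * d := by
        have h := congrArg natDegree hFF
        rw [natDegree_mul (X_sub_C_ne_zero _) (mul_ne_zero (X_sub_C_ne_zero _) hF1),
          natDegree_mul (X_sub_C_ne_zero _) hF1, natDegree_X_sub_C, natDegree_X_sub_C] at h
        omega
      have hzw : ∀ z : ℂ, ‖z‖ = 1 → 0 < ‖z - w‖ := fun z hz => by
        rw [norm_pos_iff, sub_ne_zero]
        rintro rfl
        exact hw1 hz
      obtain ⟨q, hq, hqr⟩ := ih (C (-(star w)⁻¹) * F₁) (fun z => r z / ‖z - w‖ ^ 2)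
        ((natDegree_C_mul_le _ _).trans hdeg) fun z hz => by
          refine ⟨div_pos (hr z hz).1 (pow_pos (hzw z hz) 2), ?_⟩
          have h := (hr z hz).2
          have hz0 := hne z hz
          have hn := (hzw z hz).ne'
          have h1 : z * (((‖z - w‖ ^ 2 : ℝ)) : ℂ) = (z - w) * (1 - star w * z) := by
            have h2 : z * star z = 1 := by
              rw [Complex.star_def, Complex.mul_conj, Complex.normSq_eq_norm_sq, hz]; simp
            rw [← Complex.normSq_eq_norm_sq, ← Complex.mul_conj, map_sub, ← Complex.star_def]
            linear_combination (z - w) * h2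
          rw [hFF, eval_mul, eval_mul, eval_sub, eval_sub, eval_X, eval_C, eval_C] at h
          rw [eval_mul, eval_C, Complex.ofReal_div, ← mul_div_assoc, eq_div_iff (by simpa using hn)]
          apply mul_left_cancel₀ hz0
          calc z * (-(star w)⁻¹ * F₁.eval z * ((‖z - w‖ ^ 2 : ℝ) : ℂ))
              = -(star w)⁻¹ * F₁.eval z * (z * ((‖z - w‖ ^ 2 : ℝ) : ℂ)) := by ring
            _ = (z - w) * ((z - (star w)⁻¹) * F₁.eval z) := by
              rw [h1]
              field_simp
              ring
            _ = z * (z ^ d * r z) := by rw [h]; ring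
      refine ⟨(X - C w) * q, ?_, fun z hz => ?_⟩
      · refine natDegree_mul_le.trans ?_
        rw [natDegree_X_sub_C]
        omega
      · have h := hqr z hz
        rw [div_eq_iff (pow_ne_zero 2 (hzw z hz).ne')] at h
        rw [h, eval_mul, eval_sub, eval_X, eval_C, norm_mul]
        ring

/-- A polynomial of modulus less than one on the unit circle has a complementary polynomial. -/
theorem exists_complementary {d : ℕ} {P : ℂ[X]} (hP : P.natDegree ≤ d)
    (h : ∀ z : ℂ, ‖z‖ = 1 → ‖P.eval z‖ < 1) :
    ∃ Q : ℂ[X], Q.natDegree ≤ d ∧ ∀ z : ℂ, ‖z‖ = 1 → ‖P.eval z‖ ^ 2 + ‖Q.eval z‖ ^ 2 = 1 := by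
  obtain ⟨Q, hQ, hQz⟩ := exists_fejerRiesz d (X ^ d - P * conjReflect d P)
    (fun z => 1 - ‖P.eval z‖ ^ 2) (by
      refine (natDegree_sub_le _ _).trans (max_le ?_ (natDegree_mul_le.trans ?_))
      · rw [natDegree_X_pow]; omega
      · have := conjReflect_natDegree_le hP
        omega) fun z hz => by
      constructor
      · have := h z hz
        nlinarith [norm_nonneg (P.eval z)]
      · rw [eval_sub, eval_mul, eval_pow, eval_X, conjReflect_eval_circle hP hz, Complex.ofReal_sub,
          ← Complex.normSq_eq_norm_sq, ← Complex.mul_conj, Complex.star_def]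
        push_cast
        ring
  exact ⟨Q, hQ, fun z hz => by rw [← hQz z hz]; ring⟩

end FejerRiesz

/-! ### Generalized quantum signal processing -/

section SignalProcessing

open Matrix Polynomial

/-- The pair of polynomials generated from the column `(1, 0)` by one-qubit gates alternating with
`diag(X, 1)`, beginning with the gate `u`; the gates in the list are in reverse order. -/
noncomputable def signalPair (u : Matrix.unitaryGroup (Fin 2) ℂ) :
    List (Matrix.unitaryGroup (Fin 2) ℂ) → Fin 2 → ℂ[X]
  | [], i => C ((u : Matrix (Fin 2) (Fin 2) ℂ) i 0)
  | v :: vs, i => C ((v : Matrix (Fin 2) (Fin 2) ℂ) i 0) * (X * signalPair u vs 0) +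
      C ((v : Matrix (Fin 2) (Fin 2) ℂ) i 1) * signalPair u vs 1

/-- For orthogonal vectors `x, y` there is an orthonormal basis whose first vector is orthogonal to
`x` and whose second one is orthogonal to `y`. -/
theorem exists_unitary_of_orthogonal {x₀ x₁ y₀ y₁ : ℂ} (h : star x₀ * y₀ + star x₁ * y₁ = 0) :
    ∃ u ∈ Matrix.unitaryGroup (Fin 2) ℂ, star (u 0 0) * x₀ + star (u 1 0) * x₁ = 0 ∧
      star (u 0 1) * y₀ + star (u 1 1) * y₁ = 0 := by
  -- normalize a nonzero vector `(s, t)` and complete it to an orthonormal basis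
  have key : ∀ s t : ℂ, (s ≠ 0 ∨ t ≠ 0) → ∃ c : ℂ, c ≠ 0 ∧ ‖c * s‖ ^ 2 + ‖c * t‖ ^ 2 = 1 := by
    intro s t hst
    have hpos : 0 < ‖s‖ ^ 2 + ‖t‖ ^ 2 := by
      rcases hst with h | h
      · have := norm_pos_iff.2 h; positivity
      · have := norm_pos_iff.2 h; positivity
    have hr := Real.sqrt_pos.2 hpos
    refine ⟨((Real.sqrt (‖s‖ ^ 2 + ‖t‖ ^ 2))⁻¹ : ℝ), ?_, ?_⟩
    · exact Complex.ofReal_ne_zero.2 (inv_ne_zero hr.ne')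
    · rw [norm_mul, norm_mul, Complex.norm_real, Real.norm_of_nonneg (inv_nonneg.2 hr.le), mul_pow,
        mul_pow, ← mul_add, inv_pow, Real.sq_sqrt hpos.le, inv_mul_cancel₀ hpos.ne']
  by_cases hx : x₀ ≠ 0 ∨ x₁ ≠ 0
  · obtain ⟨c, hc, h1⟩ := key (-star x₁) (star x₀) (by simpa using hx.symm)
    refine ⟨_, exists_unitary_of_column h1, ?_, ?_⟩
    · simp; ring
    · simp
      simp only [Complex.star_def] at h
      linear_combination (-c) * h
  · push Not at hx
    obtain ⟨rfl, rfl⟩ := hx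
    by_cases hy : y₀ ≠ 0 ∨ y₁ ≠ 0
    · obtain ⟨c, hc, h1⟩ := key y₀ y₁ hy
      refine ⟨_, exists_unitary_of_column h1, by simp, ?_⟩
      simp; ring
    · push Not at hy
      obtain ⟨rfl, rfl⟩ := hy
      exact ⟨1, one_mem _, by simp, by simp⟩

theorem norm_sq_unitary_mul {u : Matrix (Fin 2) (Fin 2) ℂ} (hu : u ∈ Matrix.unitaryGroup (Fin 2) ℂ)
    (x y : ℂ) : ‖star (u 0 0) * x + star (u 1 0) * y‖ ^ 2 + ‖star (u 0 1) * x + star (u 1 1) * y‖ ^ 2 =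
      ‖x‖ ^ 2 + ‖y‖ ^ 2 := by
  have h1 : ∀ z : ℂ, ((‖z‖ ^ 2 : ℝ) : ℂ) = z * star z := fun z => by
    rw [Complex.star_def, Complex.mul_conj, Complex.normSq_eq_norm_sq]
  have h2 : ∀ i j, u i 0 * star (u j 0) + u i 1 * star (u j 1) = if i = j then 1 else 0 := by
    intro i j
    have := congrFun (congrFun (Matrix.mem_unitaryGroup_iff.1 hu) i) j
    rw [Matrix.mul_apply, Fin.sum_univ_two, Matrix.star_apply, Matrix.star_apply,
      Matrix.one_apply] at this
    exact this
  have h00 := h2 0 0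
  have h01 := h2 0 1
  have h10 := h2 1 0
  have h11 := h2 1 1
  simp only [if_true, zero_ne_one, one_ne_zero, if_false] at h00 h01 h10 h11
  apply Complex.ofReal_injective
  rw [Complex.ofReal_add, Complex.ofReal_add, h1, h1, h1, h1]
  simp only [star_add, star_mul', star_star]
  linear_combination (x * star x) * h00 + (y * star y) * h11 + (star x * y) * h01 + (x * star y) * h10

/-- **Generalized quantum signal processing**: every pair of polynomials of degree at most `d` which
is normalized on the unit circle is generated by `d + 1` one-qubit gates. The vectors of lowest and
of highest coefficients are orthogonal, so a one-qubit gate removes the lowest coefficient of the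
first polynomial and the highest one of the second; dividing the first by `X` lowers the degree. -/
theorem exists_signalPair (d : ℕ) : ∀ P Q : ℂ[X], P.natDegree ≤ d → Q.natDegree ≤ d →
    (∀ z : ℂ, ‖z‖ = 1 → ‖P.eval z‖ ^ 2 + ‖Q.eval z‖ ^ 2 = 1) →
    ∃ u vs, List.length vs = d ∧ signalPair u vs = ![P, Q] := by
  induction d with
  | zero =>
    intro P Q hP hQ h
    rw [eq_C_of_natDegree_eq_zero (Nat.le_zero.1 hP), eq_C_of_natDegree_eq_zero (Nat.le_zero.1 hQ)]
      at h ⊢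
    have h1 := h 1 (by simp)
    rw [eval_C, eval_C] at h1
    refine ⟨⟨_, exists_unitary_of_column h1⟩, [], rfl, ?_⟩
    funext i
    fin_cases i <;> rfl
  | succ d ih =>
    intro P Q hP hQ h
    have hPQ : P * conjReflect (d + 1) P + Q * conjReflect (d + 1) Q = X ^ (d + 1) := by
      refine eq_of_eval_circle fun z hz => ?_
      rw [eval_add, eval_mul, eval_mul, conjReflect_eval_circle hP hz,
        conjReflect_eval_circle hQ hz, eval_pow, eval_X]
      have h1 : P.eval z * star (P.eval z) + Q.eval z * star (Q.eval z) = 1 := by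
        rw [Complex.star_def, Complex.mul_conj, Complex.normSq_eq_norm_sq, Complex.mul_conj,
          Complex.normSq_eq_norm_sq]
        exact_mod_cast h z hz
      linear_combination z ^ (d + 1) * h1
    have horth : star (P.coeff 0) * P.coeff (d + 1) + star (Q.coeff 0) * Q.coeff (d + 1) = 0 := by
      have h1 := congrArg (fun F : ℂ[X] => F.coeff (d + 1 + (d + 1))) hPQ
      simp only [coeff_add, coeff_X_pow] at h1
      rw [coeff_mul_add_eq_of_natDegree_le hP (conjReflect_natDegree_le hP),
        coeff_mul_add_eq_of_natDegree_le hQ (conjReflect_natDegree_le hQ),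
        conjReflect_coeff_of_le le_rfl, conjReflect_coeff_of_le le_rfl, Nat.sub_self,
        if_neg (by omega)] at h1
      linear_combination h1
    obtain ⟨v, hv, hv0, hv1⟩ := exists_unitary_of_orthogonal horth
    set P' : ℂ[X] := C (star (v 0 0)) * P + C (star (v 1 0)) * Q with hP'
    set Q' : ℂ[X] := C (star (v 0 1)) * P + C (star (v 1 1)) * Q with hQ'
    have hPd : P'.natDegree ≤ d + 1 :=
      natDegree_add_le_of_degree_le ((natDegree_C_mul_le _ _).trans hP)
        ((natDegree_C_mul_le _ _).trans hQ)
    have hQd' : Q'.natDegree ≤ d + 1 :=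
      natDegree_add_le_of_degree_le ((natDegree_C_mul_le _ _).trans hP)
        ((natDegree_C_mul_le _ _).trans hQ)
    have hP0 : P'.coeff 0 = 0 := by
      simpa only [hP', coeff_add, coeff_C_mul] using hv0
    have hQtop : Q'.coeff (d + 1) = 0 := by
      simpa only [hQ', coeff_add, coeff_C_mul] using hv1
    have hQd : Q'.natDegree ≤ d := by
      rw [natDegree_le_iff_coeff_eq_zero]
      intro N hN
      rcases Nat.lt_or_ge (d + 1) N with h | h
      · exact coeff_eq_zero_of_natDegree_lt (by omega)
      · rw [show N = d + 1 by omega, hQtop]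
    obtain ⟨P₁, hP₁⟩ := X_dvd_iff.2 hP0
    have hP₁d : P₁.natDegree ≤ d := by
      rw [natDegree_le_iff_coeff_eq_zero]
      intro N hN
      rw [← coeff_X_mul, ← hP₁]
      exact coeff_eq_zero_of_natDegree_lt (by omega)
    obtain ⟨u, vs, hlen, huv⟩ := ih P₁ Q' hP₁d hQd fun z hz => by
      have h1 : ‖P₁.eval z‖ = ‖P'.eval z‖ := by
        rw [hP₁, eval_mul, eval_X, norm_mul, hz, one_mul]
      rw [h1, ← h z hz, ← norm_sq_unitary_mul hv (P.eval z) (Q.eval z)]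
      simp only [hP', hQ', eval_add, eval_mul, eval_C]
    refine ⟨u, ⟨v, hv⟩ :: vs, by simp [hlen], ?_⟩
    have h2 : ∀ i j, v i 0 * star (v j 0) + v i 1 * star (v j 1) = if i = j then 1 else 0 := by
      intro i j
      have := congrFun (congrFun (Matrix.mem_unitaryGroup_iff.1 hv) i) j
      rw [Matrix.mul_apply, Fin.sum_univ_two, Matrix.star_apply, Matrix.star_apply,
        Matrix.one_apply] at this
      exact this
    have h3 : ∀ i : Fin 2, C (v i 0) * P' + C (v i 1) * Q' =
        C (if i = 0 then 1 else 0) * P + C (if i = 1 then 1 else 0) * Q := by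
      intro i
      rw [hP', hQ', ← h2 i 0, ← h2 i 1]
      simp only [C_add, C_mul]
      ring
    funext i
    rw [signalPair, huv]
    change C (v i 0) * (X * P₁) + C (v i 1) * Q' = _
    rw [← hP₁, h3]
    fin_cases i <;> simp

end SignalProcessing

/-! ### The Joukowsky substitution -/

section Laurent

open Matrix Polynomial

/-- The polynomial `z ^ d * p ((z + 1 / z) / 2)`. -/
noncomputable def joukowsky (d : ℕ) (p : ℂ[X]) : ℂ[X] :=
  ∑ k ∈ Finset.range (d + 1), C (p.coeff k * (1 / 2) ^ k) * ((X ^ 2 + 1) ^ k * X ^ (d - k))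

theorem joukowsky_natDegree_le (d : ℕ) (p : ℂ[X]) : (joukowsky d p).natDegree ≤ 2 * d := by
  refine natDegree_sum_le_of_forall_le _ _ fun k hk => ?_
  rw [Finset.mem_range] at hk
  refine (natDegree_C_mul_le _ _).trans (natDegree_mul_le.trans ?_)
  rw [natDegree_X_pow]
  have h1 : ((X ^ 2 + 1 : ℂ[X]) ^ k).natDegree ≤ k * 2 := by
    refine natDegree_pow_le_of_le k ?_
    compute_degree
  omega

theorem aeval_joukowsky {A : Type*} [Ring A] [Algebra ℂ A] {d : ℕ} {p : ℂ[X]} (hp : p.natDegree ≤ d)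
    {w w' : A} (h : w * w' = 1) (h' : w' * w = 1) :
    aeval w (joukowsky d p) = w ^ d * aeval ((1 / 2 : ℂ) • (w + w')) p := by
  have hc : Commute w (w + w') := by
    rw [commute_iff_eq, mul_add, add_mul, h, h']
  rw [aeval_eq_sum_range' (Nat.lt_succ_of_le hp), joukowsky, map_sum, Finset.mul_sum]
  refine Finset.sum_congr rfl fun k hk => ?_
  rw [Finset.mem_range] at hk
  have h1 : w ^ 2 + 1 = w * (w + w') := by rw [mul_add, h, sq]
  have h2 : (w * (w + w')) ^ k * w ^ (d - k) = w ^ d * (w + w') ^ k := by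
    rw [hc.mul_pow, mul_assoc, ← (hc.pow_pow (d - k) k).eq, ← mul_assoc, ← pow_add,
      show k + (d - k) = d by omega]
  rw [map_mul, aeval_C, map_mul (aeval w), map_pow, map_pow, map_add, map_pow, map_one, aeval_X,
    h1, h2,
    ← Algebra.smul_def, _root_.smul_pow, smul_smul, mul_smul_comm]

end Laurent

/-! ### Block diagonal circuits -/

/-- The wires: `2 n` pure ancillas, the `n` wires of the position register, an index register
of `l` wires for the qubitization of the coordinate, a register of `k` wires for the diagonals of the
derivative matrix, the signal wire of the signal processing, and the wire whose rotation
carries the entries of the derivative matrix. -/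
inductive Wire (n l k : ℕ) : Type
  | anc (i : Fin (2 * n))
  | pos (i : Fin n)
  | idx (q : Fin l)
  | shf (q : Fin k)
  | sig
  | val
  deriving DecidableEq, Fintype

section Blk

open Matrix Function

variable {n l k : ℕ}

/-- The basis state `b` with the signal bit replaced by `x` and the index register by `y`. -/
def Wire.set (b : Wire n l k → Fin 2) (x : Fin 2) (y : Fin l → Fin 2) : Wire n l k → Fin 2
  | .sig => x
  | .idx q => y q
  | .anc i => b (.anc i)
  | .pos i => b (.pos i)
  | .shf q => b (.shf q)
  | .val => b .val

/-- The components of a state vector for fixed values of all wires except the signal wire and the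
index register. -/
def slice (b : Wire n l k → Fin 2) (ψ : (Wire n l k → Fin 2) → ℂ) :
    Fin 2 → (Fin l → Fin 2) → ℂ :=
  fun x y => ψ (Wire.set b x y)

/-- The ancillas from number `a` on are zero. -/
def Wire.Clean (a : ℕ) (b : Wire n l k → Fin 2) : Prop :=
  ∀ i : Fin (2 * n), a ≤ (i : ℕ) → b (.anc i) = 0

/-- A circuit of at most `N` gates which is block diagonal with respect to all wires except the
signal wire and the index register, with blocks `M b`; only states whose ancillas from number
`a` on are zero are considered. -/
def Blk (a N : ℕ) (M : (Wire n l k → Fin 2) → (Fin 2 → (Fin l → Fin 2) → ℂ) →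
    Fin 2 → (Fin l → Fin 2) → ℂ) : Prop :=
  ∃ T, Impl N T ∧ ∀ ψ : (Wire n l k → Fin 2) → ℂ, (∀ b, ψ b ≠ 0 → Wire.Clean a b) →
    (∀ b, T ψ b ≠ 0 → Wire.Clean a b) ∧ ∀ b, Wire.Clean a b → slice b (T ψ) = M b (slice b ψ)

theorem Wire.clean_set {a : ℕ} {b : Wire n l k → Fin 2} {x : Fin 2} {y : Fin l → Fin 2} :
    Wire.Clean a (Wire.set b x y) ↔ Wire.Clean a b := Iff.rfl

theorem Wire.set_self (b : Wire n l k → Fin 2) : Wire.set b (b .sig) (fun q => b (.idx q)) = b := by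
  funext w
  cases w <;> rfl

theorem Wire.set_set (b : Wire n l k → Fin 2) (x x' : Fin 2) (y y' : Fin l → Fin 2) :
    Wire.set (Wire.set b x y) x' y' = Wire.set b x' y' := by
  funext w
  cases w <;> rfl

theorem Wire.update_sig_set (b : Wire n l k → Fin 2) (x x' : Fin 2) (y : Fin l → Fin 2) :
    update (Wire.set b x y) .sig x' = Wire.set b x' y := by
  funext w
  cases w <;> simp [Wire.set]

theorem Wire.idx_injective : Injective (Wire.idx : Fin l → Wire n l k) := fun q q' h => by
  injection h

theorem Wire.extend_idx_set (b : Wire n l k → Fin 2) (x : Fin 2) (y y' : Fin l → Fin 2) :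
    extend Wire.idx y' (Wire.set b x y) = Wire.set b x y' := by
  funext w
  cases w with
  | idx q => rw [Wire.idx_injective.extend_apply]; rfl
  | _ => rw [extend_apply' _ _ _ (by rintro ⟨q, hq⟩; cases hq)]; rfl

/-- A gate controlled by prescribed values of bits, computed in the ancillas from number `a` on. -/
theorem Wire.ctrl_pattern {a : ℕ} {i : Wire n l k} (u : Matrix.unitaryGroup (Fin 2) ℂ)
    (L : List (Wire n l k × Fin 2)) (hlen : L.length + a ≤ 2 * n)
    (hi : ∀ j : Fin (2 * n), a ≤ (j : ℕ) → i ≠ .anc j)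
    (hL : ∀ p ∈ L, p.1 ≠ i ∧ ∀ j, p.1 ≠ .anc j) :
    ∃ P : (Wire n l k → Fin 2) → Prop, Impl (48 * L.length + 7) (ctrl P i u) ∧
      (∀ b, Wire.Clean a b → (P b ↔ ∀ p ∈ L, b p.1 = p.2)) ∧ ∀ b x, P (update b i x) ↔ P b := by
  obtain ⟨P, hP, hPb, hPi⟩ := Impl.ctrl_pattern u L
    (List.ofFn fun j : Fin (2 * n - a) => (.anc ⟨j + a, by omega⟩ : Wire n l k))
    (by rw [List.length_ofFn]; omega)
    (List.nodup_ofFn.2 fun j j' h => by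
      simp only [Wire.anc.injEq, Fin.mk.injEq] at h
      apply Fin.ext
      omega)
    (by
      rw [List.mem_ofFn]
      rintro ⟨j, hj⟩
      exact hi _ (by simp) hj.symm)
    (fun p hp => ⟨(hL p hp).1, by
      rw [List.mem_ofFn]
      rintro ⟨j, hj⟩
      exact (hL p hp).2 _ hj.symm⟩)
  refine ⟨P, hP, fun b hb => hPb b fun w hw => ?_, hPi⟩
  rw [List.mem_ofFn] at hw
  obtain ⟨j, rfl⟩ := hw
  exact hb _ (by simp)

namespace Blk

variable {a N N' : ℕ} {M M' : (Wire n l k → Fin 2) → (Fin 2 → (Fin l → Fin 2) → ℂ) →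
    Fin 2 → (Fin l → Fin 2) → ℂ}

theorem mono (h : Blk a N M) (hN : N ≤ N') : Blk a N' M := by
  obtain ⟨T, hT, h⟩ := h
  exact ⟨T, hT.mono hN, h⟩

theorem congr (h : Blk a N M) (hM : ∀ b, Wire.Clean a b → ∀ χ, M b χ = M' b χ) : Blk a N M' := by
  obtain ⟨T, hT, h⟩ := h
  exact ⟨T, hT, fun ψ hψ => ⟨(h ψ hψ).1, fun b hb => by rw [(h ψ hψ).2 b hb, hM b hb]⟩⟩

theorem id : Blk a 0 (fun (_ : Wire n l k → Fin 2) χ => χ) :=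
  ⟨_, Impl.id, fun _ hψ => ⟨hψ, fun _ _ => rfl⟩⟩

theorem comp (h' : Blk a N' M') (h : Blk a N M) : Blk a (N + N') fun b χ => M' b (M b χ) := by
  obtain ⟨T, hT, h⟩ := h
  obtain ⟨T', hT', h'⟩ := h'
  refine ⟨_, hT'.comp hT, fun ψ hψ => ?_⟩
  have h1 := h ψ hψ
  have h2 := h' (T ψ) h1.1
  exact ⟨h2.1, fun b hb => by rw [h2.2 b hb, h1.2 b hb]⟩

theorem of_mux {M : (Wire n l k → Fin 2) → Matrix (Fin 2) (Fin 2) ℂ} (h : Impl N (mux .sig M))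
    (m : (Wire n l k → Fin 2) → Matrix (Fin 2) (Fin 2) ℂ)
    (hM : ∀ b, Wire.Clean a b → ∀ x y, M (Wire.set b x y) = m b) :
    Blk a N fun b χ x y => ∑ x', m b x x' * χ x' y := by
  refine ⟨_, h, fun ψ hψ => ⟨fun b hb => ?_, fun b hb => ?_⟩⟩
  · obtain ⟨x, -, hx⟩ := Finset.exists_ne_zero_of_sum_ne_zero hb
    have h1 := hψ _ (right_ne_zero_of_mul hx)
    intro i hi
    simpa using h1 i hi
  · funext x y
    simp only [slice, mux, hM b hb, Wire.update_sig_set]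
    rfl

theorem of_phase {i : Wire n l k} {P : (Wire n l k → Fin 2) → Prop}
    (h : Impl N (ctrl P i (diagonal ![1, -1])))
    (s : (Wire n l k → Fin 2) → Fin 2 → (Fin l → Fin 2) → ℂ)
    (hs : ∀ b, Wire.Clean a b → ∀ x y,
      (P (Wire.set b x y) ∧ Wire.set b x y i = 1 → s b x y = -1) ∧
      (¬ (P (Wire.set b x y) ∧ Wire.set b x y i = 1) → s b x y = 1)) :
    Blk a N fun b χ x y => s b x y * χ x y := by
  classical
  have hdiag : ∀ ψ b, ctrl P i (diagonal ![1, -1]) ψ b =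
      (if P b ∧ b i = 1 then -1 else 1) * ψ b := by
    intro ψ b
    have h1 : (if P b then ![1, -1] (b i) else 1 : ℂ) = if P b ∧ b i = 1 then -1 else 1 := by
      have hb : ∀ x : Fin 2, x = 0 ∨ x = 1 := by decide
      rcases hb (b i) with h | h <;> simp [h]
    rw [← h1]
    unfold ctrl
    rw [← mux_diagonal i (fun b j => if P b then ![1, -1] j else 1) ψ b]
    congr 1
    funext b
    split_ifs
    · rfl
    · exact diagonal_one.symm
  refine ⟨_, h, fun ψ hψ => ⟨fun b hb => ?_, fun b hb => ?_⟩⟩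
  · rw [hdiag] at hb
    exact hψ _ (right_ne_zero_of_mul hb)
  · funext x y
    rw [slice, hdiag]
    have h1 := hs b hb x y
    change _ = s b x y * ψ (Wire.set b x y)
    split_ifs with h2
    · rw [h1.1 h2]
    · rw [h1.2 h2]

end Blk

/-- The tensor product of one-qubit gates. -/
def tensorMatrix (u : Fin l → Matrix.unitaryGroup (Fin 2) ℂ) :
    Matrix (Fin l → Fin 2) (Fin l → Fin 2) ℂ :=
  fun y y' => ∏ q, (u q : Matrix (Fin 2) (Fin 2) ℂ) (y q) (y' q)

theorem tensorMatrix_inv (u : Fin l → Matrix.unitaryGroup (Fin 2) ℂ) :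
    tensorMatrix (fun q => (u q)⁻¹) = (tensorMatrix u)ᴴ := by
  ext y y'
  simp [tensorMatrix, Matrix.conjTranspose_apply, Matrix.star_apply]

theorem conjTranspose_tensorMatrix_mul (u : Fin l → Matrix.unitaryGroup (Fin 2) ℂ) :
    (tensorMatrix u)ᴴ * tensorMatrix u = 1 := by
  ext y y'
  rw [← tensorMatrix_inv, Matrix.mul_apply]
  simp only [tensorMatrix, ← Finset.prod_mul_distrib]
  have h : ∀ q, ∑ x, ((u q)⁻¹ : Matrix.unitaryGroup (Fin 2) ℂ).1 (y q) x * (u q).1 x (y' q) =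
      if y q = y' q then 1 else 0 := by
    intro q
    rw [← Matrix.mul_apply, Matrix.UnitaryGroup.inv_val,
      Matrix.mem_unitaryGroup_iff'.1 (u q).2, Matrix.one_apply]
  rw [← Fintype.piFinset_univ, ← Finset.prod_univ_sum (fun _ => Finset.univ)
    (fun q x => ((u q)⁻¹ : Matrix.unitaryGroup (Fin 2) ℂ).1 (y q) x * (u q).1 x (y' q))]
  simp only [h, Matrix.one_apply]
  by_cases hy : y = y'
  · simp [hy]
  · rw [if_neg hy]
    obtain ⟨q, hq⟩ := Function.ne_iff.1 hy
    exact Finset.prod_eq_zero (Finset.mem_univ q) (if_neg hq)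

theorem Blk.layer {a : ℕ} (u : Fin l → Matrix.unitaryGroup (Fin 2) ℂ) :
    Blk a l fun (_ : Wire n l k → Fin 2) χ x => tensorMatrix u *ᵥ χ x := by
  refine ⟨_, Impl.layer Wire.idx Wire.idx_injective u, fun ψ hψ => ⟨fun b hb => ?_, fun b hb => ?_⟩⟩
  · obtain ⟨x, -, hx⟩ := Finset.exists_ne_zero_of_sum_ne_zero hb
    have h1 := hψ _ (right_ne_zero_of_mul hx)
    rw [← Wire.set_self b, Wire.extend_idx_set] at h1
    exact h1
  · funext x y
    simp only [slice, Wire.extend_idx_set]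
    rfl

/-- Conjugation of a block diagonal circuit by a classical reversible computation. -/
theorem Blk.conj {a a' N N' : ℕ} {M : (Wire n l k → Fin 2) → (Fin 2 → (Fin l → Fin 2) → ℂ) →
    Fin 2 → (Fin l → Fin 2) → ℂ} (h : Blk a' N M) {π : (Wire n l k → Fin 2) → Wire n l k → Fin 2}
    (hπ : Impl N' fun ψ => ψ ∘ π) (h1 : ∀ b, Wire.Clean a b → Wire.Clean a' (π b))
    (h2 : ∀ b, Wire.Clean a b → ∀ x y, π (Wire.set b x y) = Wire.set (π b) x y) :
    Blk a (N + 2 * N') fun b χ => M (π b) χ := by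
  obtain ⟨T, hT, h⟩ := h
  set e : Equiv.Perm (Wire n l k → Fin 2) :=
    Equiv.ofBijective π ⟨hπ.injective, Finite.surjective_of_injective hπ.injective⟩ with he
  have hinv : ∀ b, e.symm (π b) = b := fun b => e.symm_apply_apply b
  have hinv' : ∀ b, π (e.symm b) = b := fun b => e.apply_symm_apply b
  have hπ' : Impl N' fun ψ => ψ ∘ e.symm := Impl.perm_symm (π := e) hπ
  refine ⟨_, (hπ.comp (hT.comp hπ')).mono (by omega), fun ψ hψ => ?_⟩
  obtain ⟨h3, h4⟩ := h (ψ ∘ e.symm) fun b hb => by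
    have := h1 _ (hψ _ hb)
    rwa [hinv'] at this
  have h5 : ∀ b, Wire.Clean a b → slice (π b) (ψ ∘ e.symm) = slice b ψ := fun b hb => by
    funext x y
    rw [slice, Function.comp_apply, ← h2 b hb, hinv]
    rfl
  constructor
  · -- a nonzero value at `b` comes from a nonzero value of `ψ` in the same block
    intro b hb
    rw [Function.comp_apply] at hb
    have h6 := h4 _ (h3 _ hb)
    by_contra hc
    have h7 : slice (π b) (ψ ∘ e.symm) = 0 := by
      funext x y
      by_contra hne
      have h8 := hψ _ hne
      have h9 : π (Wire.set (e.symm (Wire.set (π b) x y)) ((π b) .sig) fun q => (π b) (.idx q)) =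
          π b := by
        rw [h2 _ h8, hinv', Wire.set_set, Wire.set_self]
      exact hc (hπ.injective h9 ▸ h8)
    have h10 : slice (π b) (0 : (Wire n l k → Fin 2) → ℂ) = 0 := rfl
    have h11 := (h 0 (fun b hb => absurd rfl hb)).2 _ (h3 _ hb)
    rw [h10] at h11
    rw [h7, ← h11] at h6
    obtain ⟨U, -, hU⟩ := hT
    have h12 : T 0 = 0 := by rw [← hU, Matrix.mulVec_zero]
    apply hb
    have h13 := congrFun (congrFun h6 ((π b) .sig)) fun q => (π b) (.idx q)
    rw [h12, slice, slice, Wire.set_self] at h13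
    exact h13
  · intro b hb
    have h6 := h4 _ (h1 b hb)
    rw [h5 b hb] at h6
    refine Eq.trans ?_ h6
    funext x y
    rw [slice, Function.comp_apply, h2 b hb]
    rfl

end Blk

/-! ### Qubitization -/

section Qubitization

open Matrix Polynomial

theorem aeval_mulVec_of_eigenvector {X : Type*} [Fintype X] [DecidableEq X] {A : Matrix X X ℂ}
    {v : X → ℂ} {μ : ℂ} (h : A *ᵥ v = μ • v) (p : ℂ[X]) : aeval A p *ᵥ v = p.eval μ • v := by
  have hpow : ∀ k : ℕ, A ^ k *ᵥ v = μ ^ k • v := by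
    intro k
    induction k with
    | zero => simp
    | succ k ih => rw [pow_succ, ← Matrix.mulVec_mulVec, h, Matrix.mulVec_smul, ih, smul_smul,
        pow_succ, mul_comm]
  rw [aeval_eq_sum_range, eval_eq_sum_range, Matrix.sum_mulVec, Finset.sum_smul]
  refine Finset.sum_congr rfl fun k _ => ?_
  rw [Matrix.smul_mulVec, hpow, smul_smul]

variable {l : ℕ}

/-- The reflection that changes the sign of the basis vector `0`. -/
def zeroReflection (l : ℕ) : Matrix (Fin l → Fin 2) (Fin l → Fin 2) ℂ :=
  diagonal fun y => if y = 0 then -1 else 1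

theorem zeroReflection_mul_self : zeroReflection l * zeroReflection l = 1 := by
  rw [zeroReflection, diagonal_mul_diagonal, ← diagonal_one]
  congr 1
  funext y
  split_ifs <;> norm_num

/-- Qubitization: if `S` is an involution with corner entry `t`, the walk operator `W = R S`, with
`R` the reflection at the zero vector `e`, satisfies `(W + W⁻¹) e = -2 t e`. -/
theorem walk_add_inv_mulVec (S : Matrix (Fin l → Fin 2) (Fin l → Fin 2) ℂ) :
    ((1 / 2 : ℂ) • (zeroReflection l * S + S * zeroReflection l)) *ᵥ Pi.single 0 1 =
      (-S 0 0) • (Pi.single 0 1 : (Fin l → Fin 2) → ℂ) := by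
  funext y
  rw [Matrix.mulVec_single_one, Matrix.col_apply, Matrix.smul_apply, Matrix.add_apply,
    zeroReflection, diagonal_mul, mul_diagonal, Pi.smul_apply, Pi.single_apply]
  by_cases hy : y = 0
  · simp [hy]
    ring
  · simp [hy]

end Qubitization

/-! ### Circuits for polynomials of the encoded coordinate -/

section SignalCircuit

open Matrix Polynomial

variable {n l k : ℕ}

theorem Blk.phase_pattern {i₀ : Fin (2 * n)} (hi₀ : (i₀ : ℕ) < 2) (E : List (Fin n))
    (code : Fin l → Fin 2) (hE : E.length + l + 3 ≤ 2 * n) :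
    Blk 2 (48 * (E.length + l + 1) + 7) fun (b : Wire n l k → Fin 2) χ x y =>
      (if b (.anc i₀) = 1 ∧ x = 0 ∧ y = code ∧ ∀ i ∈ E, b (.pos i) = 1 then -1 else 1) * χ x y := by
  set L : List (Wire n l k × Fin 2) :=
    E.map (fun i => (.pos i, 1)) ++ (.sig, 0) :: List.ofFn fun q => (.idx q, code q) with hL
  have hLlen : L.length = E.length + l + 1 := by
    simp [hL]; omega
  have hz : diagonal ![1, -1] ∈ Matrix.unitaryGroup (Fin 2) ℂ :=
    diagonal_mem_unitaryGroup norm_one (by simp)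
  obtain ⟨P, hP, hPb, -⟩ := Wire.ctrl_pattern (a := 2) (i := .anc i₀) ⟨_, hz⟩ L
    (by rw [hLlen]; omega) (by rintro i hi h; injection h with h; subst h; omega) (by
      intro p hp
      simp only [hL, List.mem_append, List.mem_map, List.mem_cons, List.mem_ofFn] at hp
      rcases hp with ⟨i, -, rfl⟩ | rfl | ⟨q, rfl⟩ <;> simp)
  rw [hLlen] at hP
  refine Blk.of_phase hP (fun b x y => if b (.anc i₀) = 1 ∧ x = 0 ∧ y = code ∧
    ∀ i ∈ E, b (.pos i) = 1 then -1 else 1) fun b hb x y => ?_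
  have h : P (Wire.set b x y) ∧ Wire.set b x y (.anc i₀) = 1 ↔
      b (.anc i₀) = 1 ∧ x = 0 ∧ y = code ∧ ∀ i ∈ E, b (.pos i) = 1 := by
    rw [hPb _ (Wire.clean_set.2 hb)]
    simp only [hL, List.forall_mem_append, List.forall_mem_map, List.forall_mem_cons,
      List.forall_mem_ofFn_iff, Wire.set, funext_iff]
    tauto
  rw [h]
  exact ⟨fun h => if_pos h, fun h => if_neg h⟩

/-- The action of the matrix `A b` on the index register if the flag is set and the signal bit is
zero. -/
def onFlag (i₀ : Fin (2 * n))
    (A : (Wire n l k → Fin 2) → Matrix (Fin l → Fin 2) (Fin l → Fin 2) ℂ)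
    (b : Wire n l k → Fin 2) (χ : Fin 2 → (Fin l → Fin 2) → ℂ) : Fin 2 → (Fin l → Fin 2) → ℂ :=
  fun x => if b (.anc i₀) = 1 ∧ x = 0 then A b *ᵥ χ x else χ x

theorem onFlag_onFlag (i₀ : Fin (2 * n))
    (A A' : (Wire n l k → Fin 2) → Matrix (Fin l → Fin 2) (Fin l → Fin 2) ℂ)
    (b : Wire n l k → Fin 2) (χ : Fin 2 → (Fin l → Fin 2) → ℂ) :
    onFlag i₀ A' b (onFlag i₀ A b χ) = onFlag i₀ (fun b => A' b * A b) b χ := by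
  funext x
  simp only [onFlag]
  split_ifs
  · rw [Matrix.mulVec_mulVec]
  · rfl

theorem Blk.onFlag_pow {N a : ℕ} {i₀ : Fin (2 * n)}
    {A : (Wire n l k → Fin 2) → Matrix (Fin l → Fin 2) (Fin l → Fin 2) ℂ}
    (h : Blk a N (onFlag i₀ A)) (d : ℕ) : Blk a (d * N) (onFlag i₀ fun b => A b ^ d) := by
  induction d with
  | zero =>
    refine (Blk.id.mono (Nat.zero_le _)).congr fun b _ χ => ?_
    funext x
    simp [onFlag]
  | succ d ih =>
    refine ((h.comp ih).mono (by rw [Nat.succ_mul])).congr fun b _ χ => ?_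
    rw [onFlag_onFlag]
    simp only [pow_succ']

/-- The signs `-1` for the values `code i` of the index register, `i ∈ T`, for which the
corresponding bit of the position register is set. -/
def selectMatrix (T : Finset (Fin n)) (code : Fin n → Fin l → Fin 2) (b : Wire n l k → Fin 2) :
    Matrix (Fin l → Fin 2) (Fin l → Fin 2) ℂ :=
  diagonal fun y => ∏ i ∈ T, if y = code i ∧ b (.pos i) = 1 then -1 else 1

theorem selectMatrix_mul_self (T : Finset (Fin n)) (code : Fin n → Fin l → Fin 2)
    (b : Wire n l k → Fin 2) : selectMatrix T code b * selectMatrix T code b = 1 := by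
  rw [selectMatrix, diagonal_mul_diagonal, ← diagonal_one]
  congr 1
  funext y
  rw [← Finset.prod_mul_distrib]
  refine Finset.prod_eq_one fun i _ => ?_
  split_ifs <;> norm_num

theorem Blk.select {i₀ : Fin (2 * n)} (hi₀ : (i₀ : ℕ) < 2) (hl : l + 4 ≤ 2 * n)
    (code : Fin n → Fin l → Fin 2) (T : Finset (Fin n)) :
    Blk 2 (T.card * (48 * (l + 2) + 7)) (onFlag (k := k) i₀ (selectMatrix T code)) := by
  induction T using Finset.induction_on with
  | empty =>
    refine (Blk.id.mono (Nat.zero_le _)).congr fun b _ χ => ?_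
    funext x
    simp [onFlag, selectMatrix]
  | insert i T hi ih =>
    have h := Blk.phase_pattern (k := k) hi₀ [i] (code i)
      (by simp only [List.length_cons, List.length_nil]; omega)
    refine ((h.comp ih).mono ?_).congr fun b _ χ => ?_
    · rw [Finset.card_insert_of_notMem hi, List.length_cons, List.length_nil, add_mul, one_mul]
      generalize T.card * _ = N
      omega
    · funext x y
      simp only [onFlag, selectMatrix]
      by_cases hx : b (.anc i₀) = 1 ∧ x = 0
      · rw [if_pos hx, if_pos hx, mulVec_diagonal, mulVec_diagonal, Finset.prod_insert hi, mul_assoc]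
        simp only [hx, true_and, List.mem_singleton, forall_eq]
      · have hx' : ¬ (b (.anc i₀) = 1 ∧ x = 0 ∧ y = code i ∧ ∀ j ∈ [i], b (.pos j) = 1) :=
          fun h => hx ⟨h.1, h.2.1⟩
        rw [if_neg hx, if_neg hx, if_neg hx', one_mul]

theorem Blk.zeroReflection {i₀ : Fin (2 * n)} (hi₀ : (i₀ : ℕ) < 2) (hl : l + 4 ≤ 2 * n) :
    Blk 2 (48 * (l + 1) + 7) (onFlag (k := k) i₀ fun _ => _root_.zeroReflection l) := by
  have h := Blk.phase_pattern (k := k) hi₀ [] (0 : Fin l → Fin 2)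
    (by simp only [List.length_nil]; omega)
  refine (h.mono (by simp)).congr fun b _ χ => ?_
  funext x y
  simp only [onFlag, _root_.zeroReflection]
  by_cases hx : b (.anc i₀) = 1 ∧ x = 0
  · rw [if_pos hx, mulVec_diagonal]
    simp [hx]
  · have hx' : ¬ (b (.anc i₀) = 1 ∧ x = 0 ∧ y = 0 ∧ ∀ j ∈ [], b (.pos j) = 1) :=
      fun h => hx ⟨h.1, h.2.1⟩
    rw [if_neg hx, if_neg hx', one_mul]

/-- The linear combination of the signs of the bits of the position register, as an involution on
the index register: the selection of signs between the preparation of the weights and its inverse. -/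
def coordMatrix (u : Fin l → Matrix.unitaryGroup (Fin 2) ℂ) (T : Finset (Fin n))
    (code : Fin n → Fin l → Fin 2) (b : Wire n l k → Fin 2) :
    Matrix (Fin l → Fin 2) (Fin l → Fin 2) ℂ :=
  (tensorMatrix u)ᴴ * (selectMatrix T code b * tensorMatrix u)

theorem coordMatrix_mul_self (u : Fin l → Matrix.unitaryGroup (Fin 2) ℂ) (T : Finset (Fin n))
    (code : Fin n → Fin l → Fin 2) (b : Wire n l k → Fin 2) :
    coordMatrix u T code b * coordMatrix u T code b = 1 := by
  have h := conjTranspose_tensorMatrix_mul u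
  have h' : tensorMatrix u * (tensorMatrix u)ᴴ = 1 := mul_eq_one_comm.1 h
  simp only [coordMatrix]
  calc _ = (tensorMatrix u)ᴴ * (selectMatrix T code b * ((tensorMatrix u * (tensorMatrix u)ᴴ) *
        selectMatrix T code b)) * tensorMatrix u := by simp only [mul_assoc]
    _ = 1 := by rw [h', one_mul, selectMatrix_mul_self, mul_one, h]

theorem coordMatrix_corner (u : Fin l → Matrix.unitaryGroup (Fin 2) ℂ) (T : Finset (Fin n))
    (code : Fin n → Fin l → Fin 2) (b : Wire n l k → Fin 2) :
    coordMatrix u T code b 0 0 =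
      ∑ y, ((∏ q, ‖(u q : Matrix (Fin 2) (Fin 2) ℂ) (y q) 0‖ ^ 2 : ℝ) : ℂ) *
        ∏ i ∈ T, if y = code i ∧ b (.pos i) = 1 then -1 else 1 := by
  rw [coordMatrix, Matrix.mul_apply]
  refine Finset.sum_congr rfl fun y _ => ?_
  rw [selectMatrix, diagonal_mul, Matrix.conjTranspose_apply, ← mul_assoc, mul_right_comm]
  congr 1
  simp only [tensorMatrix]
  rw [star_prod, ← Finset.prod_mul_distrib, Complex.ofReal_prod]
  refine Finset.prod_congr rfl fun q _ => ?_
  rw [Complex.star_def, mul_comm, Complex.mul_conj, Complex.normSq_eq_norm_sq]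
  rfl

theorem Blk.coordMatrix {i₀ : Fin (2 * n)} (hi₀ : (i₀ : ℕ) < 2) (hl : l + 4 ≤ 2 * n)
    (u : Fin l → Matrix.unitaryGroup (Fin 2) ℂ) (code : Fin n → Fin l → Fin 2)
    (T : Finset (Fin n)) :
    Blk 2 (n * (48 * (l + 2) + 7) + 2 * l)
      (onFlag (k := k) i₀ (_root_.coordMatrix u T code)) := by
  have h := (Blk.layer (n := n) (k := k) (a := 2) fun q => (u q)⁻¹).comp
    ((Blk.select (k := k) hi₀ hl code T).comp (Blk.layer u))
  have hT : T.card ≤ n := by simpa using T.card_le_univ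
  have hT' := Nat.mul_le_mul_right (48 * (l + 2) + 7) hT
  refine (h.mono (by omega)).congr fun b _ χ => ?_
  funext x
  simp only [onFlag, tensorMatrix_inv, _root_.coordMatrix]
  split_ifs
  · rw [← Matrix.mulVec_mulVec, ← Matrix.mulVec_mulVec]
  · rw [Matrix.mulVec_mulVec, conjTranspose_tensorMatrix_mul, Matrix.one_mulVec]

/-- The state with index register and signal bit zero. -/
def startState (l : ℕ) (c : ℂ) : Fin 2 → (Fin l → Fin 2) → ℂ :=
  fun x => if x = 0 then c • Pi.single 0 1 else 0

/-- A one-qubit gate on the signal wire, controlled by the flag. -/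
theorem Blk.signalGate {i₀ : Fin (2 * n)} (u : Matrix.unitaryGroup (Fin 2) ℂ) :
    Blk 2 7 fun (b : Wire n l k → Fin 2) χ x y => ∑ x',
      (if b (.anc i₀) = 1 then (u : Matrix (Fin 2) (Fin 2) ℂ) else 1) x x' * χ x' y := by
  have h := Impl.ctrl_one (c := (.anc i₀ : Wire n l k)) (t := .sig) (by simp) u
  unfold ctrl at h
  exact Blk.of_mux h (fun b => if b (.anc i₀) = 1 then u else 1) fun b _ x y => by
    by_cases hb : b (.anc i₀) = 1 <;> simp [Wire.set, hb]

theorem sum_one_mul {X : Type*} (χ : Fin 2 → X → ℂ) :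
    (fun x y => ∑ x', (1 : Matrix (Fin 2) (Fin 2) ℂ) x x' * χ x' y) = χ := by
  funext x y
  simp [Matrix.one_apply]

/-- The circuit of generalized quantum signal processing, controlled by the flag. -/
theorem Blk.signalPair {N : ℕ} {i₀ : Fin (2 * n)}
    {W : (Wire n l k → Fin 2) → Matrix (Fin l → Fin 2) (Fin l → Fin 2) ℂ}
    (hW : Blk 2 N (onFlag i₀ W)) (u : Matrix.unitaryGroup (Fin 2) ℂ)
    (vs : List (Matrix.unitaryGroup (Fin 2) ℂ)) :
    ∃ M, Blk 2 (vs.length * (N + 7) + 7) M ∧ ∀ b,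
      (b (.anc i₀) ≠ 1 → ∀ χ, M b χ = χ) ∧
      (b (.anc i₀) = 1 → ∀ c, M b (startState l c) =
        fun x => aeval (W b) (_root_.signalPair u vs x) *ᵥ (c • Pi.single 0 1)) := by
  induction vs with
  | nil =>
    refine ⟨_, (Blk.signalGate (i₀ := i₀) u).mono (by simp), fun b => ⟨fun hb χ => ?_, fun hb c => ?_⟩⟩
    · simp only [if_neg hb, sum_one_mul]
    · funext x y
      simp [hb, Fin.sum_univ_two, startState, _root_.signalPair, Algebra.algebraMap_eq_smul_one,
        Matrix.smul_mulVec]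
  | cons v vs ih =>
    obtain ⟨M, hM, hMb⟩ := ih
    refine ⟨_, ((Blk.signalGate (i₀ := i₀) v).comp (hW.comp hM)).mono
      (by simp only [List.length_cons]; ring_nf; rfl), fun b => ⟨fun hb χ => ?_, fun hb c => ?_⟩⟩
    · have h1 : ∀ χ, onFlag i₀ W b χ = χ := fun χ => by
        funext x
        rw [onFlag, if_neg (fun h => hb h.1)]
      simp only [if_neg hb, sum_one_mul, (hMb b).1 hb, h1]
    · funext x y
      simp only [(hMb b).2 hb c, hb, Fin.sum_univ_two, onFlag, if_true, true_and, one_ne_zero,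
        if_false, _root_.signalPair, map_add, map_mul, aeval_C, aeval_X,
        Algebra.algebraMap_eq_smul_one, Matrix.add_mulVec, smul_mul_assoc, one_mul,
        Matrix.smul_mulVec, Pi.add_apply, Pi.smul_apply, smul_eq_mul, Matrix.mulVec_mulVec]

/-- The walk operator and its powers turn the flagged blocks of the state into the value of a
polynomial at the encoded coordinate. -/
theorem Blk.polynomial {i₀ : Fin (2 * n)} (hi₀ : (i₀ : ℕ) < 2) (hl : l + 4 ≤ 2 * n)
    (u : Fin l → Matrix.unitaryGroup (Fin 2) ℂ) (code : Fin n → Fin l → Fin 2)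
    (T : Finset (Fin n)) {d : ℕ} {p : ℂ[X]} (hp : p.natDegree ≤ d)
    (hbound : ∀ t : ℝ, |t| ≤ 1 → ‖p.eval (t : ℂ)‖ < 1) :
    ∃ M, Blk 2 ((3 * d + 1) * (n * (48 * (l + 2) + 7) + 2 * l + (48 * (l + 1) + 7) + 7)) M ∧
      ∀ b : Wire n l k → Fin 2, (b (.anc i₀) ≠ 1 → ∀ χ, M b χ = χ) ∧
        (b (.anc i₀) = 1 → ∀ c, M b (startState l c) 0 =
          (c * p.eval (-_root_.coordMatrix u T code b 0 0)) • Pi.single 0 1) := by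
  have hP : ∀ z : ℂ, ‖z‖ = 1 → ‖(joukowsky d p).eval z‖ < 1 := by
    intro z hz
    have hz0 : z ≠ 0 := by rintro rfl; simp at hz
    have h := aeval_joukowsky (A := ℂ) hp (mul_inv_cancel₀ hz0) (inv_mul_cancel₀ hz0)
    rw [coe_aeval_eq_eval, coe_aeval_eq_eval] at h
    have hre : (1 / 2 : ℂ) • (z + z⁻¹) = (z.re : ℂ) := by
      rw [Complex.inv_eq_conj hz, Complex.add_conj, smul_eq_mul]
      push_cast
      ring
    rw [h, hre, norm_mul, norm_pow, hz, one_pow, one_mul]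
    exact hbound _ (by rw [← hz]; exact Complex.abs_re_le_norm z)
  obtain ⟨Q, hQ, hPQ⟩ := exists_complementary (joukowsky_natDegree_le d p) hP
  obtain ⟨v, vs, hlen, hvs⟩ := exists_signalPair (2 * d) _ Q (joukowsky_natDegree_le d p) hQ hPQ
  have hS := Blk.coordMatrix (k := k) hi₀ hl u code T
  have hR := Blk.zeroReflection (k := k) hi₀ hl
  set S := _root_.coordMatrix (k := k) u T code with hSdef
  set R := _root_.zeroReflection l with hRdef
  have hW : Blk 2 (n * (48 * (l + 2) + 7) + 2 * l + (48 * (l + 1) + 7))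
      (onFlag i₀ fun b => R * S b) := (hR.comp hS).congr fun b _ χ => onFlag_onFlag _ _ _ _ _
  have hW' : Blk 2 (n * (48 * (l + 2) + 7) + 2 * l + (48 * (l + 1) + 7))
      (onFlag i₀ fun b => S b * R) :=
    ((hS.comp hR).congr fun b _ χ => onFlag_onFlag _ _ _ _ _).mono (by omega)
  obtain ⟨M, hM, hMb⟩ := Blk.signalPair hW v vs
  refine ⟨_, ((hW'.onFlag_pow d).comp hM).mono ?_, fun b => ⟨fun hb χ => ?_, fun hb c => ?_⟩⟩
  · rw [hlen]
    generalize n * (48 * (l + 2) + 7) + 2 * l + (48 * (l + 1) + 7) = w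
    nlinarith
  · funext x
    rw [onFlag, if_neg (fun h => hb h.1), (hMb b).1 hb]
  · have h1 : R * S b * (S b * R) = 1 := by
      rw [mul_assoc, ← mul_assoc (S b), hSdef, coordMatrix_mul_self, one_mul, hRdef,
        zeroReflection_mul_self]
    have h2 : S b * R * (R * S b) = 1 := by
      rw [mul_assoc, ← mul_assoc R, hRdef, zeroReflection_mul_self, one_mul, hSdef,
        coordMatrix_mul_self]
    have h3 : (S b * R) ^ d * (R * S b) ^ d = 1 := by
      rw [← (show Commute (S b * R) (R * S b) by rw [commute_iff_eq, h1, h2]).mul_pow, h2, one_pow]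
    rw [onFlag, if_pos ⟨hb, rfl⟩, (hMb b).2 hb c, hvs]
    change _ *ᵥ (aeval (R * S b) (joukowsky d p) *ᵥ _) = _
    rw [aeval_joukowsky hp h1 h2, Matrix.mulVec_mulVec, ← mul_assoc, h3, one_mul,
      Matrix.mulVec_smul, aeval_mulVec_of_eigenvector (walk_add_inv_mulVec (S b)), smul_smul]

end SignalCircuit

/-! ### Arithmetic of the position register -/

section Position

open Function

theorem bitsVal_append {ι : Type} (b : ι → Fin 2) (ws ws' : List ι) :
    bitsVal b (ws ++ ws') = bitsVal b ws + 2 ^ ws.length * bitsVal b ws' := by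
  induction ws with
  | nil => simp [bitsVal]
  | cons w ws ih => rw [List.cons_append, bitsVal, ih, bitsVal, List.length_cons]; ring

theorem bitsVal_ofFn {ι : Type} (b : ι → Fin 2) {n : ℕ} (w : Fin n → ι) :
    bitsVal b (List.ofFn w) = ∑ i, (b (w i) : ℕ) * 2 ^ (i : ℕ) := by
  induction n with
  | zero => simp [bitsVal]
  | succ n ih =>
    rw [List.ofFn_succ, bitsVal, ih, Fin.sum_univ_succ, Finset.mul_sum]
    simp only [Fin.val_zero, pow_zero, mul_one, Fin.val_succ, pow_succ]
    congr 1
    exact Finset.sum_congr rfl fun i _ => by ring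

variable {n l k : ℕ}

/-- The number in the position register. -/
def Wire.posVal (b : Wire n l k → Fin 2) : ℕ := bitsVal b (List.ofFn Wire.pos)

theorem Wire.posVal_eq_sum (b : Wire n l k → Fin 2) :
    Wire.posVal b = ∑ i, (b (.pos i) : ℕ) * 2 ^ (i : ℕ) := bitsVal_ofFn b _

theorem Wire.posVal_eq (b : Wire n l k → Fin 2) :
    Wire.posVal b = (finFunctionFinEquiv fun i => b (.pos i) : Fin (2 ^ n)) := by
  rw [Wire.posVal_eq_sum, finFunctionFinEquiv_apply]

theorem Wire.posVal_lt (b : Wire n l k → Fin 2) : Wire.posVal b < 2 ^ n := by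
  rw [Wire.posVal_eq]; exact Fin.is_lt _

theorem Wire.posVal_set (b : Wire n l k → Fin 2) (x : Fin 2) (y : Fin l → Fin 2) :
    Wire.posVal (Wire.set b x y) = Wire.posVal b := by
  simp only [Wire.posVal_eq_sum, Wire.set]

/-- The position register extended by the ancilla number one as its highest bit. -/
def Wire.extPos (n l k : ℕ) (hn : 4 ≤ n) : List (Wire n l k) :=
  List.ofFn Wire.pos ++ [.anc ⟨1, by omega⟩]

theorem Wire.mem_extPos {hn : 4 ≤ n} {w : Wire n l k} :
    w ∈ Wire.extPos n l k hn ↔ (∃ i, w = .pos i) ∨ w = .anc ⟨1, by omega⟩ := by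
  simp only [Wire.extPos, List.mem_append, List.mem_ofFn, List.mem_singleton]
  refine or_congr ⟨?_, ?_⟩ Iff.rfl
  · rintro ⟨i, rfl⟩; exact ⟨i, rfl⟩
  · rintro ⟨i, rfl⟩; exact ⟨i, rfl⟩

theorem Wire.bitsVal_extPos (hn : 4 ≤ n) (b : Wire n l k → Fin 2) :
    bitsVal b (Wire.extPos n l k hn) = Wire.posVal b + 2 ^ n * (b (.anc ⟨1, by omega⟩) : ℕ) := by
  rw [Wire.extPos, bitsVal_append, List.length_ofFn]
  simp [bitsVal, Wire.posVal]

theorem Wire.length_extPos (hn : 4 ≤ n) : (Wire.extPos n l k hn).length = n + 1 := by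
  simp [Wire.extPos]

/-- Addition of a constant to the extended position register. -/
theorem exists_addConst (hn : 4 ≤ n) (s : ℕ) :
    ∃ π : (Wire n l k → Fin 2) → Wire n l k → Fin 2,
      Impl (74 * (n + 1) + 2) (fun ψ => ψ ∘ π) ∧ ∀ b, Wire.Clean 2 b →
        bitsVal (π b) (Wire.extPos n l k hn) =
          (bitsVal b (Wire.extPos n l k hn) + s) % 2 ^ (n + 1) ∧
        ∀ w, w ∉ Wire.extPos n l k hn → π b w = b w := by
  set as : List (Wire n l k) := List.ofFn fun i : Fin n => .anc ⟨i + 4, by omega⟩ with has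
  set F : Wire n l k := .anc ⟨2, by omega⟩ with hF
  have has' : ∀ w ∈ as, ∃ i : Fin (2 * n), 4 ≤ (i : ℕ) ∧ w = .anc i := by
    intro w hw
    rw [has, List.mem_ofFn] at hw
    obtain ⟨i, rfl⟩ := hw
    exact ⟨_, by simp, rfl⟩
  have hFx : F ∉ Wire.extPos n l k hn := by
    rw [Wire.mem_extPos]
    simp [hF]
  have hFas : F ∉ as := fun h => by
    obtain ⟨i, hi, h⟩ := has' _ h
    rw [hF, Wire.anc.injEq] at h
    rw [← h] at hi
    simp at hi
  obtain ⟨π, hπ, hπb⟩ := Impl.add (Wire.extPos n l k hn) s F (.anc ⟨3, by omega⟩) as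
    (by rw [Wire.length_extPos, has, List.length_ofFn]) (by
      rw [List.nodup_cons, List.nodup_cons, List.mem_cons, List.mem_append, List.mem_append,
        List.nodup_append]
      refine ⟨?_, ?_, ?_, ?_, ?_⟩
      · rintro (h | h | h)
        · simp [hF] at h
        · exact hFx h
        · exact hFas h
      · rintro (h | h)
        · rw [Wire.mem_extPos] at h
          simp at h
        · obtain ⟨i, hi, h⟩ := has' _ h
          rw [Wire.anc.injEq] at h
          rw [← h] at hi
          simp at hi
      · rw [Wire.extPos, List.nodup_append, List.nodup_ofFn]
        refine ⟨fun i j h => by injection h, by simp, ?_⟩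
        simp [List.mem_ofFn]
      · rw [has, List.nodup_ofFn]
        intro i j hij
        simp only [Wire.anc.injEq, Fin.mk.injEq] at hij
        apply Fin.ext
        omega
      · intro w hw w' hw' h
        obtain ⟨i, hi, rfl⟩ := has' _ hw'
        subst h
        rw [Wire.mem_extPos] at hw
        rcases hw with ⟨j, hj⟩ | hj
        · cases hj
        · rw [Wire.anc.injEq] at hj
          rw [hj] at hi
          simp at hi)
  rw [Wire.length_extPos] at hπ
  refine ⟨_, ((Impl.not F).perm_comp (hπ.perm_comp (Impl.not F))).mono (by omega),
    fun b hb => ?_⟩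
  simp only [Function.comp_apply]
  set b₁ := flipBy F (fun _ => 1) b with hb₁
  have h1 : ∀ w, w ≠ F → b₁ w = b w := fun w hw => flipBy_apply_of_ne hw _ _
  have h1F : b₁ F = 1 := by rw [hb₁, flipBy_apply_self, hb _ (by simp)]; rfl
  obtain ⟨h2v, h2⟩ := hπb b₁ fun w hw => by
    rw [h1 w (by rintro rfl; exact hFas hw)]
    obtain ⟨i, hi, rfl⟩ := has' _ hw
    exact hb i (by omega)
  have hext : ∀ w ∈ Wire.extPos n l k hn, w ≠ F := by
    rintro w hw rfl; exact hFx hw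
  constructor
  · rw [bitsVal_congr (b' := π b₁) fun w hw => flipBy_apply_of_ne (hext w hw) _ _, h2v, h1F,
      h1 _ (by simp [hF]), hb _ (by simp), bitsVal_congr (b' := b) fun w hw => h1 w (hext w hw),
      Wire.length_extPos]
    simp
  · intro w hw
    by_cases hwF : w = F
    · rw [hwF, flipBy_apply_self, h2 F hFx, h1F, hb _ (by simp)]
      rfl
    · rw [flipBy_apply_of_ne hwF, h2 w hw, h1 w hwF]

/-- Comparison of the position with a constant, read off from the highest bit of a difference. -/
theorem exists_compare (hn : 4 ≤ n) {K : ℕ} (hK : K ≤ 2 ^ n) :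
    ∃ π : (Wire n l k → Fin 2) → Wire n l k → Fin 2,
      Impl (148 * (n + 1) + 5) (fun ψ => ψ ∘ π) ∧ ∀ b, Wire.Clean 1 b →
        π b = update b (.anc ⟨0, by omega⟩)
          (b (.anc ⟨0, by omega⟩) + if Wire.posVal b < K then 1 else 0) := by
  obtain ⟨π₁, hπ₁, h₁⟩ := exists_addConst (l := l) (k := k) hn (2 ^ (n + 1) - K)
  obtain ⟨π₂, hπ₂, h₂⟩ := exists_addConst (l := l) (k := k) hn K
  set f : Wire n l k := .anc ⟨0, by omega⟩ with hf
  set t : Wire n l k := .anc ⟨1, by omega⟩ with ht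
  have htf : t ≠ f := by simp [ht, hf]
  have hfx : f ∉ Wire.extPos n l k hn := by rw [Wire.mem_extPos]; simp [hf]
  have hpow : 2 ^ (n + 1) = 2 * 2 ^ n := pow_succ' 2 n
  refine ⟨_, (hπ₂.perm_comp ((Impl.cnot htf).perm_comp hπ₁)).mono (by omega), fun b hb => ?_⟩
  simp only [Function.comp_apply]
  have hb2 : Wire.Clean 2 b := fun i hi => hb i (by omega)
  obtain ⟨h1v, h1⟩ := h₁ b hb2
  set b₁ := π₁ b with hb₁
  set b₂ := flipBy f (fun b => b t) b₁ with hb₂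
  have h2f : ∀ w, w ≠ f → b₂ w = b₁ w := fun w hw => flipBy_apply_of_ne hw _ _
  have hanc : ∀ i : Fin (2 * n), 2 ≤ (i : ℕ) → (.anc i : Wire n l k) ≠ f ∧
      (.anc i : Wire n l k) ∉ Wire.extPos n l k hn := by
    intro i hi
    rw [Wire.mem_extPos, hf]
    constructor
    · intro h
      rw [Wire.anc.injEq] at h
      rw [h] at hi
      simp at hi
    · rintro (⟨j, hj⟩ | h)
      · cases hj
      · rw [Wire.anc.injEq] at h
        rw [h] at hi
        simp at hi
  obtain ⟨h2v, h2⟩ := h₂ b₂ fun i hi => by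
    rw [h2f _ (hanc i hi).1, h1 _ (hanc i hi).2, hb2 i hi]
  have hbt : b t = 0 := hb _ le_rfl
  have hpos := Wire.posVal_lt b
  have hval : bitsVal b (Wire.extPos n l k hn) = Wire.posVal b := by
    rw [Wire.bitsVal_extPos]
    change _ + 2 ^ n * (b t : ℕ) = _
    simp [hbt]
  have hval₂ : bitsVal b₂ (Wire.extPos n l k hn) = bitsVal b₁ (Wire.extPos n l k hn) :=
    bitsVal_congr fun w hw => h2f w (by rintro rfl; exact hfx hw)
  rw [hval] at h1v
  -- the highest bit of `j + 2 ^ (n + 1) - K` is set if and only if `j < K`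
  have h1t : b₁ t = if Wire.posVal b < K then 1 else 0 := by
    have h3 := Wire.bitsVal_extPos hn b₁
    have h4 := Wire.posVal_lt b₁
    rw [h1v] at h3
    have h5 : (b₁ t : ℕ) < 2 := (b₁ t).2
    change _ = _ + 2 ^ n * (b₁ t : ℕ) at h3
    have hb01 : b₁ t = 0 ∨ b₁ t = 1 := by
      generalize b₁ t = x
      revert x
      decide
    by_cases hlt : Wire.posVal b < K
    · rw [if_pos hlt]
      rw [Nat.mod_eq_of_lt (by omega)] at h3
      rcases hb01 with h | h
      · rw [h] at h3
        simp at h3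
        omega
      · exact h
    · rw [if_neg hlt]
      have h6 : Wire.posVal b + (2 ^ (n + 1) - K) = Wire.posVal b - K + 2 ^ (n + 1) := by omega
      rw [h6, Nat.add_mod_right, Nat.mod_eq_of_lt (by omega)] at h3
      rcases hb01 with h | h
      · exact h
      · rw [h] at h3
        simp at h3
        omega
  funext w
  by_cases hw : w ∈ Wire.extPos n l k hn
  · have hwf : w ≠ f := by rintro rfl; exact hfx hw
    rw [update_of_ne hwf]
    refine eq_of_bitsVal_eq ?_ w hw
    rw [h2v, hval₂, h1v, hval, Nat.mod_add_mod, show Wire.posVal b + (2 ^ (n + 1) - K) + K =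
      Wire.posVal b + 2 ^ (n + 1) by omega, Nat.add_mod_right, Nat.mod_eq_of_lt (by omega)]
  · rw [h2 w hw]
    by_cases hwf : w = f
    · rw [hwf, update_self, hb₂, flipBy_apply_self, h1 f hfx, h1t]
    · rw [h2f w hwf, h1 w hw, update_of_ne hwf]

/-- Computation of the flag `lo ≤ j < hi` for the position `j`, and subtraction of `B` from `j`. -/
theorem exists_region (hn : 4 ≤ n) {B lo hi : ℕ} (hB : B ≤ lo) (hlo : lo ≤ hi) (hhi : hi ≤ 2 ^ n) :
    ∃ π : (Wire n l k → Fin 2) → Wire n l k → Fin 2,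
      Impl (370 * (n + 1) + 12) (fun ψ => ψ ∘ π) ∧ ∀ b, Wire.Clean 0 b →
        (π b (.anc ⟨0, by omega⟩) = 1 ↔ lo ≤ Wire.posVal b ∧ Wire.posVal b < hi) ∧
        (lo ≤ Wire.posVal b → Wire.posVal (π b) = Wire.posVal b - B) ∧
        Wire.Clean 2 (π b) ∧ ∀ x y, π (Wire.set b x y) = Wire.set (π b) x y := by
  obtain ⟨π₁, hπ₁, h₁⟩ := exists_compare (l := l) (k := k) hn (hlo.trans hhi)
  obtain ⟨π₂, hπ₂, h₂⟩ := exists_compare (l := l) (k := k) hn hhi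
  obtain ⟨π₃, hπ₃, h₃⟩ := exists_addConst (l := l) (k := k) hn (2 ^ (n + 1) - B)
  set f : Wire n l k := .anc ⟨0, by omega⟩ with hf
  set t : Wire n l k := .anc ⟨1, by omega⟩ with ht
  have hfx : f ∉ Wire.extPos n l k hn := by rw [Wire.mem_extPos]; simp [hf]
  have hpow : 2 ^ (n + 1) = 2 * 2 ^ n := pow_succ' 2 n
  have hanc : ∀ i : Fin (2 * n), 2 ≤ (i : ℕ) → (.anc i : Wire n l k) ∉ Wire.extPos n l k hn := by
    rintro i hi h
    rw [Wire.mem_extPos] at h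
    rcases h with ⟨j, hj⟩ | h
    · cases hj
    · rw [Wire.anc.injEq] at h
      rw [h] at hi
      simp at hi
  have hancf : ∀ i : Fin (2 * n), 1 ≤ (i : ℕ) → (.anc i : Wire n l k) ≠ f := by
    intro i hi h
    rw [hf, Wire.anc.injEq] at h
    rw [h] at hi
    simp at hi
  have hposf : ∀ (b : Wire n l k → Fin 2) x, Wire.posVal (update b f x) = Wire.posVal b := by
    intro b x
    simp [Wire.posVal_eq_sum, hf]
  refine ⟨_, (hπ₃.perm_comp (hπ₂.perm_comp hπ₁)).mono (by omega), fun b hb => ?_⟩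
  -- the effect on a clean state, in terms of the extended register
  have key : ∀ b : Wire n l k → Fin 2, Wire.Clean 0 b →
      (∀ w, w ∉ Wire.extPos n l k hn → w ≠ f → π₃ (π₂ (π₁ b)) w = b w) ∧
      π₃ (π₂ (π₁ b)) f =
        (if Wire.posVal b < lo then 1 else 0) + (if Wire.posVal b < hi then 1 else 0) ∧
      bitsVal (π₃ (π₂ (π₁ b))) (Wire.extPos n l k hn) =
        (Wire.posVal b + (2 ^ (n + 1) - B)) % 2 ^ (n + 1) := by
    intro b hb
    have h1 := h₁ b fun i hi => hb i (by omega)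
    have h2 := h₂ (π₁ b) fun i hi => by
      rw [h1, update_of_ne (hancf i hi), hb i (by omega)]
    rw [show b f = 0 from hb _ (by simp), zero_add] at h1
    rw [h1, hposf, update_self, update_idem, ← h1] at h2
    obtain ⟨h3v, h3⟩ := h₃ (π₂ (π₁ b)) fun i hi => by
      rw [h2, update_of_ne (hancf i (by omega)), hb i (by omega)]
    refine ⟨fun w hw hwf => ?_, ?_, ?_⟩
    · rw [h3 w hw, h2, update_of_ne hwf]
    · rw [h3 f hfx, h2, update_self]
    · rw [h3v, bitsVal_congr (b' := b) fun w hw => by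
        rw [h2, update_of_ne (by rintro rfl; exact hfx hw)], Wire.bitsVal_extPos,
        hb _ (by simp)]
      simp
  obtain ⟨k1, k2, k3⟩ := key b hb
  simp only [Function.comp_apply]
  refine ⟨?_, fun hj => ?_, fun i hi => ?_, fun x y => ?_⟩
  · rw [k2]
    split_ifs with h1 h2 h2 <;> simp <;> omega
  · have h4 := Wire.bitsVal_extPos hn (π₃ (π₂ (π₁ b)))
    have h5 := Wire.posVal_lt b
    have h6 : Wire.posVal b + (2 ^ (n + 1) - B) = Wire.posVal b - B + 2 ^ (n + 1) := by omega
    rw [k3, h6, Nat.add_mod_right, Nat.mod_eq_of_lt (by omega)] at h4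
    have h7 : ∀ x : Fin 2, (x : ℕ) = 0 ∨ (x : ℕ) = 1 := by decide
    rcases h7 (π₃ (π₂ (π₁ b)) (.anc ⟨1, by omega⟩)) with h | h
    · rw [h] at h4; omega
    · rw [h] at h4; omega
  · rw [k1 _ (hanc i hi) (hancf i (by omega)), hb i (by omega)]
  · obtain ⟨l1, l2, l3⟩ := key (Wire.set b x y) hb
    rw [Wire.posVal_set] at l2 l3
    have hset : ∀ (b : Wire n l k → Fin 2), ∀ w ∈ Wire.extPos n l k hn,
        Wire.set b x y w = b w := by
      intro b w hw
      rw [Wire.mem_extPos] at hw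
      rcases hw with ⟨i, rfl⟩ | rfl <;> rfl
    funext w
    by_cases hw : w ∈ Wire.extPos n l k hn
    · refine eq_of_bitsVal_eq ?_ w hw
      rw [l3, bitsVal_congr (hset (π₃ (π₂ (π₁ b)))), k3]
    · by_cases hwf : w = f
      · rw [hwf, l2]
        change _ = π₃ (π₂ (π₁ b)) f
        rw [k2]
      · rw [l1 w hw hwf]
        cases w with
        | sig => rfl
        | idx q => rfl
        | _ => exact (k1 _ hw hwf).symm

end Position

/-! ### Encoding of the position -/

section Weights

open Matrix

/-- One-qubit gates preparing the index state `∑ y, √(2 ^ (-y) / Z) |y⟩`. -/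
theorem exists_geometric_weights (l : ℕ) :
    ∃ (u : Fin l → Matrix.unitaryGroup (Fin 2) ℂ) (Z : ℝ), 0 < Z ∧ Z ≤ 2 ∧
      (∀ y : Fin l → Fin 2, ∏ q, ‖(u q : Matrix (Fin 2) (Fin 2) ℂ) (y q) 0‖ ^ 2 =
        (1 / 2) ^ ((finFunctionFinEquiv y : Fin (2 ^ l)) : ℕ) / Z) ∧
      ∑ y : Fin l → Fin 2, ∏ q, ‖(u q : Matrix (Fin 2) (Fin 2) ℂ) (y q) 0‖ ^ 2 = 1 := by
  set β : Fin l → ℝ := fun q => (1 / 2) ^ 2 ^ (q : ℕ) with hβ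
  have hβ0 : ∀ q, 0 < β q := fun q => by positivity
  have hcol : ∀ q, ‖((Real.sqrt (1 / (1 + β q)) : ℝ) : ℂ)‖ ^ 2 +
      ‖((Real.sqrt (β q / (1 + β q)) : ℝ) : ℂ)‖ ^ 2 = 1 := by
    intro q
    have := hβ0 q
    rw [Complex.norm_real, Complex.norm_real, Real.norm_eq_abs, Real.norm_eq_abs, sq_abs, sq_abs,
      Real.sq_sqrt (by positivity), Real.sq_sqrt (by positivity)]
    field_simp
  set u : Fin l → Matrix.unitaryGroup (Fin 2) ℂ := fun q => ⟨_, exists_unitary_of_column (hcol q)⟩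
    with hu
  have hentry : ∀ q (x : Fin 2), ‖(u q : Matrix (Fin 2) (Fin 2) ℂ) x 0‖ ^ 2 =
      β q ^ (x : ℕ) / (1 + β q) := by
    intro q x
    have := hβ0 q
    fin_cases x
    · change ‖((Real.sqrt (1 / (1 + β q)) : ℝ) : ℂ)‖ ^ 2 = _
      rw [Complex.norm_real, Real.norm_eq_abs, sq_abs, Real.sq_sqrt (by positivity)]
      simp
    · change ‖((Real.sqrt (β q / (1 + β q)) : ℝ) : ℂ)‖ ^ 2 = _
      rw [Complex.norm_real, Real.norm_eq_abs, sq_abs, Real.sq_sqrt (by positivity)]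
      simp
  have hprod : ∀ y : Fin l → Fin 2, ∏ q, β q ^ (y q : ℕ) =
      (1 / 2) ^ ((finFunctionFinEquiv y : Fin (2 ^ l)) : ℕ) := by
    intro y
    rw [finFunctionFinEquiv_apply, ← Finset.prod_pow_eq_pow_sum]
    refine Finset.prod_congr rfl fun q _ => ?_
    rw [hβ, ← pow_mul, mul_comm]
  have hZ : ∏ q, (1 + β q) = ∑ i ∈ Finset.range (2 ^ l), (1 / 2 : ℝ) ^ i := by
    have h1 : ∏ q, (1 + β q) = ∏ q, ∑ x : Fin 2, β q ^ (x : ℕ) := by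
      refine Finset.prod_congr rfl fun q _ => ?_
      rw [Fin.sum_univ_two]
      simp
    rw [h1, Finset.prod_univ_sum, Fintype.piFinset_univ]
    simp only [hprod]
    rw [finFunctionFinEquiv.sum_comp (fun i : Fin (2 ^ l) => (1 / 2 : ℝ) ^ (i : ℕ)),
      Fin.sum_univ_eq_sum_range (fun i => (1 / 2 : ℝ) ^ i)]
  have hpos : 0 < ∏ q, (1 + β q) := Finset.prod_pos fun q _ => by
    have := hβ0 q
    positivity
  refine ⟨u, ∏ q, (1 + β q), hpos, ?_, fun y => ?_, ?_⟩
  · rw [hZ]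
    exact sum_geometric_two_le _
  · simp only [hentry, Finset.prod_div_distrib, hprod]
  · simp only [hentry]
    rw [← Fintype.piFinset_univ, ← Finset.prod_univ_sum (fun _ => Finset.univ)
      (fun q (x : Fin 2) => β q ^ (x : ℕ) / (1 + β q))]
    refine Finset.prod_eq_one fun q _ => ?_
    have := hβ0 q
    rw [Fin.sum_univ_two]
    simp only [Fin.val_zero, Fin.val_one, pow_zero, pow_one]
    rw [← add_div, div_self (by positivity)]

theorem prod_sign_eq {X I : Type*} [DecidableEq X] [DecidableEq I] {T : Finset I} {code : I → X}
    (hcode : Set.InjOn code T) (β : I → Prop) [DecidablePred β] (y : X) :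
    (∏ i ∈ T, if y = code i ∧ β i then -1 else 1 : ℂ) =
      1 - 2 * ∑ i ∈ T, if y = code i ∧ β i then 1 else 0 := by
  by_cases h : ∃ i ∈ T, y = code i ∧ β i
  · obtain ⟨i, hi, hy, hb⟩ := h
    have hne : ∀ j ∈ T, j ≠ i → ¬ (y = code j ∧ β j) := fun j hj hji hc =>
      hji (hcode hj hi (hc.1 ▸ hy))
    rw [Finset.prod_eq_single_of_mem i hi fun j hj hji => if_neg (hne j hj hji),
      Finset.sum_eq_single_of_mem i hi fun j hj hji => if_neg (hne j hj hji), if_pos ⟨hy, hb⟩,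
      if_pos ⟨hy, hb⟩]
    norm_num
  · push Not at h
    rw [Finset.prod_eq_one fun i hi => if_neg fun hc => h i hi hc.1 hc.2,
      Finset.sum_eq_zero fun i hi => if_neg fun hc => h i hi hc.1 hc.2]
    norm_num

variable {n l k : ℕ}

/-- With the geometric weights, the involution of the index register encodes an affine function of
the position. -/
theorem exists_coordMatrix {κ : ℕ} (hκ : κ ≤ n) (hl : n ≤ 2 ^ l) :
    ∃ (u : Fin l → Matrix.unitaryGroup (Fin 2) ℂ) (code : Fin n → Fin l → Fin 2)
      (T : Finset (Fin n)) (Z : ℝ), 0 < Z ∧ Z ≤ 2 ∧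
      ∀ b : Wire n l k → Fin 2, Wire.posVal b < 2 ^ κ →
        -coordMatrix u T code b 0 0 = ((4 * ((Wire.posVal b : ℝ) / 2 ^ κ) / Z - 1 : ℝ) : ℂ) := by
  obtain ⟨u, Z, hZ0, hZ2, hw, hsum⟩ := exists_geometric_weights l
  have hpow : 0 < 2 ^ l := Nat.two_pow_pos l
  set code : Fin n → Fin l → Fin 2 := fun i =>
    finFunctionFinEquiv.symm ⟨(κ - 1 - i) % 2 ^ l, Nat.mod_lt _ hpow⟩ with hcode
  set T : Finset (Fin n) := Finset.univ.filter fun i => (i : ℕ) < κ with hT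
  have hval : ∀ i ∈ T, ((finFunctionFinEquiv (code i) : Fin (2 ^ l)) : ℕ) = κ - 1 - i := by
    intro i hi
    rw [hcode, Equiv.apply_symm_apply]
    exact Nat.mod_eq_of_lt (by omega)
  have hinj : Set.InjOn code T := by
    intro i hi j hj hij
    have h1 := hval i hi
    rw [hij, hval j hj] at h1
    simp only [hT, Finset.coe_filter, Finset.mem_univ, true_and, Set.mem_ofPred_eq] at hi hj
    apply Fin.ext
    omega
  refine ⟨u, code, T, Z, hZ0, hZ2, fun b hb => ?_⟩
  have hbits : ∀ i : Fin n, b (.pos i) = 1 → i ∈ T := by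
    intro i hi
    by_contra hc
    simp only [hT, Finset.mem_filter, Finset.mem_univ, true_and, not_lt] at hc
    have h1 : (b (.pos i) : ℕ) * 2 ^ (i : ℕ) ≤ Wire.posVal b := by
      rw [Wire.posVal_eq_sum]
      exact Finset.single_le_sum (f := fun i : Fin n => (b (.pos i) : ℕ) * 2 ^ (i : ℕ))
        (fun _ _ => Nat.zero_le _) (Finset.mem_univ i)
    rw [hi] at h1
    simp only [Fin.val_one, one_mul] at h1
    have h2 := Nat.pow_le_pow_right (n := 2) (by norm_num) hc
    omega
  have hposR : (Wire.posVal b : ℝ) = ∑ i ∈ T, if b (.pos i) = 1 then (2 : ℝ) ^ (i : ℕ) else 0 := by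
    rw [Wire.posVal_eq_sum, Nat.cast_sum]
    symm
    refine Finset.sum_subset_zero_on_sdiff (Finset.subset_univ T) ?_ ?_
    · intro i hi
      have h0 : b (.pos i) = 0 := by
        have : b (.pos i) ≠ 1 := fun h => (Finset.mem_sdiff.1 hi).2 (hbits i h)
        revert this
        generalize b (.pos i) = x
        revert x
        decide
      simp [h0]
    · intro i _
      have h7 : ∀ x : Fin 2, x = 0 ∨ x = 1 := by decide
      rcases h7 (b (.pos i)) with h | h <;> simp [h]
  rw [coordMatrix_corner]
  simp only [prod_sign_eq hinj]
  have h1 : ∀ i ∈ T, (∏ q, ‖(u q : Matrix (Fin 2) (Fin 2) ℂ) (code i q) 0‖ ^ 2) =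
      2 * 2 ^ (i : ℕ) / 2 ^ κ / Z := by
    intro i hi
    rw [hw, hval i hi]
    simp only [hT, Finset.mem_filter, Finset.mem_univ, true_and] at hi
    congr 1
    rw [eq_div_iff (by positivity), show (2 : ℝ) ^ κ = 2 ^ (κ - 1 - i) * (2 * 2 ^ (i : ℕ)) by
      rw [← pow_succ', ← pow_add]; congr 1; omega, ← mul_assoc, ← mul_pow]
    norm_num
  have h2 : ∑ y : Fin l → Fin 2, (∏ q, ‖(u q : Matrix (Fin 2) (Fin 2) ℂ) (y q) 0‖ ^ 2) *
      (1 - 2 * ∑ i ∈ T, if y = code i ∧ b (.pos i) = 1 then (1 : ℝ) else 0) =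
      1 - 4 * ((Wire.posVal b : ℝ) / 2 ^ κ) / Z := by
    simp only [mul_sub, mul_one, Finset.sum_sub_distrib, hsum]
    congr 1
    simp only [Finset.mul_sum]
    rw [Finset.sum_comm, hposR, Finset.sum_div, Finset.mul_sum, Finset.sum_div]
    refine Finset.sum_congr rfl fun i hi => ?_
    by_cases hbi : b (.pos i) = 1
    · simp only [hbi, and_true, if_true, mul_ite, mul_one, mul_zero]
      rw [Finset.sum_ite_eq' Finset.univ (code i), if_pos (Finset.mem_univ _), h1 i hi]
      ring
    · simp [hbi]
  have h3 : (4 * ((Wire.posVal b : ℝ) / 2 ^ κ) / Z - 1 : ℝ) = -(1 - 4 * ((Wire.posVal b : ℝ) / 2 ^ κ) / Z) := by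
    ring
  rw [h3, ← h2]
  push_cast
  simp only [apply_ite Complex.ofReal, Complex.ofReal_one, Complex.ofReal_zero]

end Weights

/-! ### Encoding of diagonal matrices -/

section Diagonal

open Matrix Polynomial Function

variable {n l k : ℕ}

/-- A block diagonal circuit of at most `N` gates which encodes the values `φ j` for the positions
`j ∈ Ω` and acts trivially for the other positions. -/
def Enc (n l k : ℕ) (φ : ℕ → ℂ) (Ω : Set ℕ) (N : ℕ) : Prop :=
  ∃ M, Blk (n := n) (l := l) (k := k) 0 N M ∧ ∀ b, Wire.Clean 0 b →
    (Wire.posVal b ∉ Ω → ∀ χ, M b χ = χ) ∧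
    (Wire.posVal b ∈ Ω → ∀ c, M b (startState l c) 0 = (c * φ (Wire.posVal b)) • Pi.single 0 1)

namespace Enc

variable {φ : ℕ → ℂ} {Ω Ω' : Set ℕ} {N N' : ℕ}

theorem mono (h : Enc n l k φ Ω N) (hN : N ≤ N') : Enc n l k φ Ω N' := by
  obtain ⟨M, hM, h⟩ := h
  exact ⟨M, hM.mono hN, h⟩

theorem empty : Enc n l k φ ∅ 0 :=
  ⟨_, Blk.id, fun _ _ => ⟨fun _ _ => rfl, fun h => h.elim⟩⟩

theorem union (h : Enc n l k φ Ω N) (h' : Enc n l k φ Ω' N') (hd : Disjoint Ω Ω') :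
    Enc n l k φ (Ω ∪ Ω') (N + N') := by
  obtain ⟨M, hM, h⟩ := h
  obtain ⟨M', hM', h'⟩ := h'
  refine ⟨_, hM'.comp hM, fun b hb => ⟨fun hj χ => ?_, fun hj c => ?_⟩⟩
  · rw [Set.mem_union, not_or] at hj
    rw [(h b hb).1 hj.1, (h' b hb).1 hj.2]
  · rcases hj with hj | hj
    · rw [(h' b hb).1 (Set.disjoint_left.1 hd hj), (h b hb).2 hj]
    · rw [(h b hb).1 (Set.disjoint_right.1 hd hj), (h' b hb).2 hj]

theorem biUnion {ι : Type*} (s : Finset ι) {Ω : ι → Set ℕ} {N : ι → ℕ}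
    (h : ∀ g ∈ s, Enc n l k φ (Ω g) (N g)) (hd : ∀ g g', g ≠ g' → Disjoint (Ω g) (Ω g')) :
    Enc n l k φ (⋃ g ∈ s, Ω g) (∑ g ∈ s, N g) := by
  classical
  induction s using Finset.induction_on with
  | empty => simpa using Enc.empty
  | insert g s hg ih =>
    rw [Finset.set_biUnion_insert, Finset.sum_insert hg]
    refine (h g (Finset.mem_insert_self g s)).union
      (ih fun g' hg' => h g' (Finset.mem_insert_of_mem hg')) ?_
    rw [Set.disjoint_iUnion₂_right]
    exact fun g' hg' => hd g g' (by rintro rfl; exact hg hg')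

/-- A single value is encoded by a gate on the signal wire which is controlled by the position. -/
theorem singleton {j : ℕ} (hj : j < 2 ^ n) (hφ : ‖φ j‖ ≤ 1) : Enc n l k φ {j} (48 * n + 7) := by
  obtain ⟨u, hu⟩ := exists_unitary_of_corner hφ
  set v : Fin n → Fin 2 := finFunctionFinEquiv.symm ⟨j, hj⟩ with hv
  obtain ⟨P, hP, hPb, -⟩ := Wire.ctrl_pattern (a := 0) (i := (.sig : Wire n l k)) u
    (List.ofFn fun i => (.pos i, v i)) (by rw [List.length_ofFn]; omega) (by simp)
    (by simp [List.mem_ofFn])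
  rw [List.length_ofFn] at hP
  have hPj : ∀ b : Wire n l k → Fin 2, Wire.Clean 0 b → (P b ↔ Wire.posVal b = j) := by
    intro b hb
    rw [hPb b hb, List.forall_mem_ofFn_iff, Wire.posVal_eq]
    constructor
    · intro h
      have : (fun i => b (.pos i)) = v := funext h
      rw [this, hv, Equiv.apply_symm_apply]
    · intro h i
      have : (finFunctionFinEquiv fun i => b (.pos i)) = (⟨j, hj⟩ : Fin (2 ^ n)) := Fin.ext h
      rw [hv, ← this, Equiv.symm_apply_apply]
  classical
  unfold ctrl at hP
  refine ⟨_, Blk.of_mux (a := 0) hP (fun b => if Wire.posVal b = j then u else 1) fun b hb x y => ?_,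
    fun b hb => ⟨fun h χ => ?_, fun h c => ?_⟩⟩
  · have h1 := hPj (Wire.set b x y) hb
    rw [Wire.posVal_set] at h1
    by_cases h2 : Wire.posVal b = j
    · rw [if_pos (h1.2 h2), if_pos h2]
    · rw [if_neg fun h => h2 (h1.1 h), if_neg h2]
  · rw [Set.mem_singleton_iff] at h
    simp only [if_neg h, sum_one_mul]
  · rw [Set.mem_singleton_iff] at h
    funext y
    simp only [h, if_true, Fin.sum_univ_two, startState, Pi.smul_apply, smul_eq_mul]
    simp [hu]
    ring

/-- The values of a polynomial of degree at most `d` on a block of `2 ^ κ` consecutive positions,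
restricted to the positions from `lo` to `hi`. The argument of the polynomial is the relative
position in the block. -/
theorem block (hn : 4 ≤ n) (hl : l + 4 ≤ 2 * n) (hnl : n ≤ 2 ^ l) {d : ℕ} (hd : 1 ≤ d) {p : ℂ[X]}
    (hp : p.natDegree ≤ d) {κ B lo hi : ℕ} (hB : B ≤ lo) (hlo : lo ≤ hi) (hhi : hi ≤ B + 2 ^ κ)
    (hhi' : hi ≤ 2 ^ n) (hκ : κ ≤ n)
    (hbound : ∀ t : ℝ, 0 ≤ t → t ≤ 1 → ‖p.eval (t : ℂ)‖ < 1)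
    (hφ : ∀ j, lo ≤ j → j < hi → φ j = p.eval ((((j - B : ℕ) : ℝ) / 2 ^ κ : ℝ) : ℂ)) :
    Enc n l k φ (Set.Ico lo hi) (1500 * (d * (n * (l + 1)))) := by
  obtain ⟨u, code, T, Z, hZ0, hZ2, hcoord⟩ := exists_coordMatrix (k := k) hκ hnl
  obtain ⟨π, hπ, hπb⟩ := exists_region (l := l) (k := k) hn hB hlo hhi'
  -- the encoded coordinate runs through `[-1, 1]`; it is rescaled to `[0, Z / 2]`
  set q : ℂ[X] := p.comp (C ((Z / 4 : ℝ) : ℂ) * (X + 1)) with hq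
  have hqd : q.natDegree ≤ d := by
    refine natDegree_comp_le.trans ?_
    have h1 : (C ((Z / 4 : ℝ) : ℂ) * (X + 1) : ℂ[X]).natDegree ≤ 1 :=
      (natDegree_C_mul_le _ _).trans (by compute_degree)
    exact (Nat.mul_le_mul hp h1).trans (by omega)
  have hqe : ∀ t : ℝ, q.eval (t : ℂ) = p.eval ((Z / 4 * (t + 1) : ℝ) : ℂ) := by
    intro t
    simp [hq]
  obtain ⟨M, hM, hMb⟩ := Blk.polynomial (k := k) (i₀ := ⟨0, by omega⟩) (by simp) hl u code T hqd
    fun t ht => by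
      rw [hqe]
      rw [abs_le] at ht
      refine hbound _ (mul_nonneg (by positivity) (by linarith)) ?_
      nlinarith [ht.1, ht.2]
  refine ⟨_, (hM.conj hπ (fun b hb => (hπb b hb).2.2.1) fun b hb => (hπb b hb).2.2.2).mono ?_,
    fun b hb => ⟨fun h χ => ?_, fun h c => ?_⟩⟩
  · have h1 : n * (48 * (l + 2) + 7) + 2 * l + (48 * (l + 1) + 7) + 7 ≤ 119 * (n * (l + 1)) := by
      nlinarith [Nat.mul_le_mul_right l hn]
    have h2 : 3 * d + 1 ≤ 4 * d := by omega
    have h3 : n ≤ d * (n * (l + 1)) := by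
      calc n = 1 * (n * 1) := by ring
        _ ≤ d * (n * (l + 1)) := Nat.mul_le_mul hd (Nat.mul_le_mul_left n (by omega))
    have h4 := Nat.mul_le_mul h2 h1
    have h5 : 4 * d * (119 * (n * (l + 1))) = 476 * (d * (n * (l + 1))) := by ring
    omega
  · refine (hMb (π b)).1 ?_ χ
    rw [ne_eq, (hπb b hb).1]
    exact h
  · rw [(hMb (π b)).2 ((hπb b hb).1.2 h)]
    have hpos := (hπb b hb).2.1 h.1
    have h1 : Wire.posVal (π b) < 2 ^ κ := by
      have h2 : lo ≤ Wire.posVal b := h.1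
      have h3 : Wire.posVal b < hi := h.2
      rw [hpos]
      omega
    rw [hcoord _ h1, hqe, hpos, hφ _ h.1 h.2]
    congr 4
    field_simp
    ring

/-- The values of a polynomial on an interval of positions. Two overlapping blocks
of `2 ^ κ` positions cover the interval except its last position, where `2 ^ κ` is the greatest power
of two not exceeding the length. -/
theorem interval (hn : 4 ≤ n) (hl : l + 4 ≤ 2 * n) (hnl : n ≤ 2 ^ l) {d : ℕ} (hd : 1 ≤ d) {p : ℂ[X]}
    (hp : p.natDegree ≤ d) {lo hi : ℕ} (hlo : lo ≤ hi) (hhi : hi < 2 ^ n)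
    (hbound : ∀ t : ℝ, (lo : ℝ) ≤ t → t ≤ hi → ‖p.eval (t : ℂ)‖ < 1)
    (hφ : ∀ j : ℕ, lo ≤ j → j ≤ hi → φ j = p.eval (((j : ℝ)) : ℂ)) :
    Enc n l k φ (Set.Icc lo hi) (3100 * (d * (n * (l + 1)))) := by
  have hsize : n ≤ d * (n * (l + 1)) := by
    calc n = 1 * (n * 1) := by ring
      _ ≤ d * (n * (l + 1)) := Nat.mul_le_mul hd (Nat.mul_le_mul_left n (by omega))
  have hlast : Enc n l k φ {hi} (48 * n + 7) := singleton hhi (by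
    rw [hφ hi hlo le_rfl]
    exact (hbound _ (by exact_mod_cast hlo) le_rfl).le)
  rcases hlo.eq_or_lt with rfl | hlt
  · rw [Set.Icc_self]
    exact hlast.mono (by omega)
  set κ := Nat.log 2 (hi - lo) with hκ
  have hκ1 : 2 ^ κ ≤ hi - lo := Nat.pow_log_le_self 2 (by omega)
  have hκ2 : hi - lo < 2 ^ (κ + 1) := Nat.lt_pow_succ_log_self (by norm_num) _
  have hκn : κ ≤ n := (Nat.pow_le_pow_iff_right (by norm_num : 1 < 2)).1 (by omega : 2 ^ κ ≤ 2 ^ n)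
  rw [pow_succ] at hκ2
  have hpowpos : 0 < 2 ^ κ := Nat.two_pow_pos κ
  have key : ∀ B lo' hi', lo ≤ B → B + 2 ^ κ ≤ hi → B ≤ lo' → lo' ≤ hi' → hi' ≤ B + 2 ^ κ →
      Enc n l k φ (Set.Ico lo' hi') (1500 * (d * (n * (l + 1)))) := by
    intro B lo' hi' h1 h2 h3 h4 h5
    have h1R : (lo : ℝ) ≤ B := by exact_mod_cast h1
    have h2R : (B : ℝ) + 2 ^ κ ≤ hi := by exact_mod_cast h2
    have hq : ∀ t : ℝ, (p.comp (C (B : ℂ) + C ((2 : ℂ) ^ κ) * X)).eval (t : ℂ) =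
        p.eval ((B + 2 ^ κ * t : ℝ) : ℂ) := by
      intro t
      simp
    refine block hn hl hnl hd (p := p.comp (C (B : ℂ) + C ((2 : ℂ) ^ κ) * X)) ?_ h3 h4 h5 (by omega)
      hκn (fun t ht0 ht1 => ?_) fun j hj1 hj2 => ?_
    · refine natDegree_comp_le.trans ?_
      have : (C (B : ℂ) + C ((2 : ℂ) ^ κ) * X).natDegree ≤ 1 := by compute_degree
      exact (Nat.mul_le_mul hp this).trans (by omega)
    · rw [hq]
      have : (0 : ℝ) < 2 ^ κ := by positivity
      exact hbound _ (by nlinarith) (by nlinarith)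
    · rw [hq, hφ j (by omega) (by omega)]
      congr 2
      rw [mul_div_cancel₀ _ (by positivity), Nat.cast_sub (by omega)]
      ring
  have e : Set.Icc lo hi = Set.Ico lo (lo + 2 ^ κ) ∪ (Set.Ico (lo + 2 ^ κ) hi ∪ {hi}) := by
    ext j
    simp only [Set.mem_Icc, Set.mem_union, Set.mem_Ico, Set.mem_singleton_iff]
    omega
  rw [e]
  refine ((key lo lo (lo + 2 ^ κ) le_rfl (by omega) le_rfl (by omega) le_rfl).union
    ((key (hi - 2 ^ κ) (lo + 2 ^ κ) hi (by omega) (by omega) (by omega) (by omega)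
      (by omega)).union hlast ?_) ?_).mono (by omega)
  · rw [Set.disjoint_left]
    intro j hj hj'
    simp only [Set.mem_Ico, Set.mem_singleton_iff] at hj hj'
    omega
  · rw [Set.disjoint_left]
    intro j hj hj'
    simp only [Set.mem_union, Set.mem_Ico, Set.mem_singleton_iff] at hj hj'
    omega

end Enc

end Diagonal

/-! ### Superpositions of cyclic diagonals -/

section Derivative

open Function

variable {n l k : ℕ}

/-- The addition of `s` to the position, controlled by the value `x` of the register for the
diagonals. -/
theorem exists_shift_one (hn : 1 ≤ n) (hk : k ≤ n) (x : Fin k → Fin 2) (s : ℕ) :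
    ∃ π : (Wire n l k → Fin 2) → Wire n l k → Fin 2,
      Impl (2 * (48 * k + 7) + 74 * n) (fun ψ => ψ ∘ π) ∧ ∀ b, Wire.Clean 0 b →
        Wire.posVal (π b) =
          (Wire.posVal b + if (fun q => b (.shf q)) = x then s else 0) % 2 ^ n ∧
        ∀ w, (∀ i, w ≠ .pos i) → π b w = b w := by
  classical
  set F : Wire n l k := .anc ⟨0, by omega⟩ with hF
  obtain ⟨P, hP, hPb, hPF⟩ := Wire.ctrl_pattern (a := 1) (i := F) ⟨_, notGate_mem⟩
    (List.ofFn fun q => (.shf q, x q)) (by rw [List.length_ofFn]; omega)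
    (by
      rintro j hj h
      rw [hF, Wire.anc.injEq] at h
      rw [← h] at hj
      simp at hj)
    (by simp [List.mem_ofFn, hF])
  rw [List.length_ofFn] at hP
  simp only [mux_notGate] at hP
  obtain ⟨π, hπ, hπb⟩ := Impl.add (List.ofFn Wire.pos) s F (.anc ⟨1, by omega⟩ : Wire n l k)
    (List.ofFn fun i : Fin (n - 1) => .anc ⟨i + 2, by omega⟩)
    (by rw [List.length_ofFn, List.length_ofFn]; omega) (by
      rw [List.nodup_cons, List.nodup_cons, List.nodup_append, List.nodup_ofFn, List.nodup_ofFn]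
      simp only [List.mem_cons, List.mem_append, List.mem_ofFn, hF]
      refine ⟨?_, ?_, fun i j h => by injection h, fun i j h => ?_, ?_⟩
      · simp
      · simp
      · simp only [Wire.anc.injEq, Fin.mk.injEq] at h
        apply Fin.ext
        omega
      · rintro _ ⟨i, rfl⟩ _ ⟨j, rfl⟩
        simp)
  rw [List.length_ofFn] at hπ hπb
  refine ⟨_, (hP.perm_comp (hπ.perm_comp hP)).mono (by omega), fun b hb => ?_⟩
  simp only [comp_apply]
  set g : (Wire n l k → Fin 2) → Fin 2 := fun b => if P b then 1 else 0 with hg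
  have hPx : ∀ b : Wire n l k → Fin 2, Wire.Clean 1 b → (P b ↔ (fun q => b (.shf q)) = x) := by
    intro b hb
    rw [hPb b hb, List.forall_mem_ofFn_iff, funext_iff]
  have hgb : g b = if (fun q => b (.shf q)) = x then 1 else 0 := by
    simp only [hg, hPx b fun i _ => hb i (Nat.zero_le _)]
  set b₁ := flipBy F g b with hb₁
  have h1 : ∀ w, w ≠ F → b₁ w = b w := fun w hw => flipBy_apply_of_ne hw _ _
  have h1F : b₁ F = g b := by
    rw [hb₁, flipBy_apply_self, hb _ (Nat.zero_le _), zero_add]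
  have hanc : ∀ i : Fin (2 * n), 1 ≤ (i : ℕ) → (.anc i : Wire n l k) ≠ F := by
    intro i hi h
    rw [hF, Wire.anc.injEq] at h
    rw [h] at hi
    simp at hi
  obtain ⟨h2v, h2⟩ := hπb b₁ fun w hw => by
    rw [List.mem_ofFn] at hw
    obtain ⟨i, rfl⟩ := hw
    rw [h1 _ (hanc _ (by simp)), hb _ (Nat.zero_le _)]
  have h2' : ∀ w, (∀ i, w ≠ .pos i) → π b₁ w = b₁ w := fun w hw => h2 w (by
    rw [List.mem_ofFn]
    rintro ⟨i, hi⟩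
    exact hw i hi.symm)
  have hg2 : g (π b₁) = g b := by
    have hc : Wire.Clean 1 (π b₁) := fun i hi => by
      rw [h2' _ (by simp), h1 _ (hanc i hi), hb i (Nat.zero_le _)]
    rw [hgb]
    simp only [hg, hPx _ hc]
    have : (fun q => π b₁ (.shf q)) = fun q => b (.shf q) := by
      funext q
      rw [h2' _ (by simp), h1 _ (by simp [hF])]
    rw [this]
  constructor
  · have h3 : Wire.posVal (flipBy F g (π b₁)) = Wire.posVal (π b₁) := bitsVal_congr fun w hw => by
      rw [List.mem_ofFn] at hw
      obtain ⟨i, rfl⟩ := hw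
      exact flipBy_apply_of_ne (by simp [hF]) _ _
    have h4 : bitsVal b₁ (List.ofFn Wire.pos) = Wire.posVal b := bitsVal_congr fun w hw => by
      rw [List.mem_ofFn] at hw
      obtain ⟨i, rfl⟩ := hw
      exact h1 _ (by simp [hF])
    rw [h3, Wire.posVal, h2v, h4, h1F, h1 _ (hanc _ le_rfl), hb _ (Nat.zero_le _), hgb]
    split_ifs <;> simp
  · intro w hw
    by_cases hwF : w = F
    · have hzz : ∀ x : Fin 2, x + x = 0 := by decide
      rw [hwF, flipBy_apply_self, h2' F (by simp [hF]), h1F, hg2, hzz, hb _ (Nat.zero_le _)]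
    · rw [flipBy_apply_of_ne hwF, h2' w hw, h1 w hwF]

/-- The cyclic shifts of the position register, selected by the register for the diagonals. -/
theorem exists_shift (hn : 1 ≤ n) (hk : k ≤ n) (T : Finset (Fin k → Fin 2))
    (s : (Fin k → Fin 2) → ℕ) :
    ∃ π : (Wire n l k → Fin 2) → Wire n l k → Fin 2,
      Impl (T.card * (2 * (48 * k + 7) + 74 * n)) (fun ψ => ψ ∘ π) ∧ ∀ b, Wire.Clean 0 b →
        Wire.posVal (π b) =
          (Wire.posVal b + if (fun q => b (.shf q)) ∈ T then s fun q => b (.shf q) else 0) % 2 ^ n ∧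
        ∀ w, (∀ i, w ≠ .pos i) → π b w = b w := by
  classical
  induction T using Finset.induction_on with
  | empty =>
    refine ⟨_root_.id, by simpa using Impl.id (ι := Wire n l k), fun b _ => ⟨?_, fun _ _ => rfl⟩⟩
    simp [Nat.mod_eq_of_lt (Wire.posVal_lt b)]
  | insert x T hx ih =>
    obtain ⟨π, hπ, hπb⟩ := ih
    obtain ⟨ρ, hρ, hρb⟩ := exists_shift_one (l := l) hn hk x (s x)
    refine ⟨_, (hρ.perm_comp hπ).mono (by rw [Finset.card_insert_of_notMem hx]; ring_nf; rfl),
      fun b hb => ?_⟩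
    obtain ⟨h1v, h1⟩ := hπb b hb
    obtain ⟨h2v, h2⟩ := hρb (π b) fun i hi => by rw [h1 _ (by simp), hb i hi]
    refine ⟨?_, fun w hw => by rw [comp_apply, h2 w hw, h1 w hw]⟩
    have h3 : (fun q => π b (.shf q)) = fun q => b (.shf q) := by
      funext q
      rw [h1 _ (by simp)]
    rw [comp_apply, h2v, h1v, h3, Nat.mod_add_mod]
    simp only [Finset.mem_insert]
    by_cases hbx : (fun q => b (.shf q)) = x
    · rw [if_neg (hbx ▸ hx), if_pos hbx, if_pos (Or.inl hbx), hbx, add_zero]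
    · simp only [hbx, if_false, false_or, add_zero]

/-- The Hadamard gate: a unitary matrix whose first row and first column have equal entries. -/
theorem exists_hadamard : ∃ h ∈ Matrix.unitaryGroup (Fin 2) ℂ,
    ∀ x, h x 0 = (((Real.sqrt 2)⁻¹ : ℝ) : ℂ) ∧ h 0 x = (((Real.sqrt 2)⁻¹ : ℝ) : ℂ) := by
  have hs : (Real.sqrt 2)⁻¹ * (Real.sqrt 2)⁻¹ = (1 / 2 : ℝ) := by
    rw [← mul_inv, Real.mul_self_sqrt (by norm_num)]
    norm_num
  set z : ℂ := Complex.ofReal (Real.sqrt 2)⁻¹ with hz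
  have hzz : z * z = 1 / 2 := by
    rw [hz, ← Complex.ofReal_mul, hs]
    norm_num
  have hzs : (starRingEnd ℂ) z = z := Complex.conj_ofReal _
  refine ⟨!![z, z; z, -z], ?_, ?_⟩
  · rw [Matrix.mem_unitaryGroup_iff]
    ext i j
    fin_cases i <;> fin_cases j <;>
      simp [Matrix.mul_apply, Fin.sum_univ_two, Matrix.star_apply, hzs, hzz] <;>
      norm_num
  · intro x
    fin_cases x <;> simp

theorem Wire.pos_injective : Injective (Wire.pos : Fin n → Wire n l k) := fun q q' h => by
  injection h

theorem Wire.shf_injective : Injective (Wire.shf : Fin k → Wire n l k) := fun q q' h => by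
  injection h

theorem Wire.eq_extend_pos {b b' : Wire n l k → Fin 2} {j : Fin (2 ^ n)}
    (h : Wire.posVal b' = j) (h' : ∀ w, (∀ i, w ≠ .pos i) → b' w = b w) :
    b' = extend Wire.pos (finFunctionFinEquiv.symm j) b := by
  funext w
  by_cases hw : ∃ i, Wire.pos i = w
  · obtain ⟨i, rfl⟩ := hw
    rw [Wire.pos_injective.extend_apply]
    rw [Wire.posVal_eq] at h
    rw [← Fin.ext h, Equiv.symm_apply_apply]
  · rw [extend_apply' _ _ _ hw]
    exact h' w fun i hi => hw ⟨i, hi.symm⟩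

/-- A sum of shifted diagonals, as a linear combination of controlled shifts: the amplitude of
`|j⟩` in the input contributes to the amplitude of `|i⟩` in the output with the factor
`2 ^ (-k) d x i`, where `j = i + s x` for the diagonal `x`. The diagonals are superposed by
Hadamard gates, and the factors are carried by rotations of the wire `val`. -/
theorem exists_diagonals (hn : 1 ≤ n) (hk : k ≤ n) (T : Finset (Fin k → Fin 2))
    (s : (Fin k → Fin 2) → Fin (2 ^ n)) (d : (Fin k → Fin 2) → Fin (2 ^ n) → ℂ)
    (hd : ∀ x i, ‖d x i‖ ≤ 1) (hdT : ∀ x, x ∉ T → ∀ i, d x i = 0)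
    (E : Finset (Fin (2 ^ n))) (i₀ : Fin (2 ^ n)) (hE : ∀ i, i ∉ E → ∀ x, d x i = d x i₀) :
    ∃ A, Impl (2 * k + T.card * (2 * (48 * k + 7) + 74 * n) + 2 ^ k * (48 * k + 7) +
        2 ^ k * E.card * (48 * (k + n) + 7)) A ∧
      ∀ ψ : (Wire n l k → Fin 2) → ℂ,
        (∀ b, ψ b ≠ 0 → Wire.Clean 0 b ∧ (∀ q, b (.shf q) = 0) ∧ b .val = 0) →
        (∀ b, A ψ b ≠ 0 → Wire.Clean 0 b) ∧
        ∀ b, Wire.Clean 0 b → (∀ q, b (.shf q) = 0) → b .val = 0 →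
          A ψ b = (2 ^ k)⁻¹ * ∑ x ∈ T, d x (finFunctionFinEquiv fun i => b (.pos i)) *
            ψ (extend Wire.pos (finFunctionFinEquiv.symm
              ((finFunctionFinEquiv fun i => b (.pos i)) + s x)) b) := by
  classical
  obtain ⟨h, hh, hh0⟩ := exists_hadamard
  choose W hw0 using fun x i => exists_unitary_of_corner (hd x i)
  have hH := Impl.layer (Wire.shf : Fin k → Wire n l k) Wire.shf_injective fun _ => ⟨h, hh⟩
  obtain ⟨π, hπ, hπb⟩ := exists_shift (l := l) hn hk T fun x => (s x : ℕ)
  obtain ⟨M₁, hM₁, hM₁b, hM₁i⟩ := Impl.mux_table (N := 48 * k + 7) (i := (.val : Wire n l k))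
    (fun b q => b (.shf q)) (fun x => W x i₀) (Wire.Clean 0) Finset.univ fun x _ => by
      obtain ⟨P, hP, hPb, hPi⟩ := Wire.ctrl_pattern (a := 0) (i := (.val : Wire n l k)) (W x i₀)
        (List.ofFn fun q => (.shf q, x q)) (by rw [List.length_ofFn]; omega) (by simp)
        (by simp [List.mem_ofFn])
      rw [List.length_ofFn] at hP
      exact ⟨P, hP, fun b hb => by rw [hPb b hb, List.forall_mem_ofFn_iff, funext_iff], hPi⟩
  obtain ⟨M₂, hM₂, hM₂b, -⟩ := Impl.mux_table (N := 48 * (k + n) + 7) (i := (.val : Wire n l k))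
    (fun b => ((fun q => b (.shf q), finFunctionFinEquiv fun i => b (.pos i)) :
      (Fin k → Fin 2) × Fin (2 ^ n)))
    (fun p => W p.1 p.2 * (W p.1 i₀)⁻¹) (Wire.Clean 0) (Finset.univ ×ˢ E) fun p _ => by
      obtain ⟨P, hP, hPb, hPi⟩ := Wire.ctrl_pattern (a := 0) (i := (.val : Wire n l k))
        (W p.1 p.2 * (W p.1 i₀)⁻¹) ((List.ofFn fun q => (.shf q, p.1 q)) ++
          List.ofFn fun i => (.pos i, finFunctionFinEquiv.symm p.2 i))
        (by rw [List.length_append, List.length_ofFn, List.length_ofFn]; omega) (by simp)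
        (by
          intro p hp
          rw [List.mem_append, List.mem_ofFn, List.mem_ofFn] at hp
          rcases hp with ⟨q, rfl⟩ | ⟨q, rfl⟩ <;> simp)
      rw [List.length_append, List.length_ofFn, List.length_ofFn] at hP
      refine ⟨P, hP, fun b hb => ?_, hPi⟩
      rw [hPb b hb, List.forall_mem_append, List.forall_mem_ofFn_iff, List.forall_mem_ofFn_iff,
        Prod.ext_iff, funext_iff, ← Equiv.eq_symm_apply, funext_iff]
  -- the corner of the selected rotation is the prescribed factor
  have hM : ∀ b, Wire.Clean 0 b → (M₂ b * M₁ b) 0 0 =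
      d (fun q => b (.shf q)) (finFunctionFinEquiv fun i => b (.pos i)) := by
    intro b hb
    rw [hM₁b b hb, hM₂b b hb, if_pos (Finset.mem_univ _)]
    by_cases hi : (finFunctionFinEquiv fun i => b (.pos i)) ∈ E
    · rw [if_pos (by simp [hi]), ← Submonoid.coe_mul, inv_mul_cancel_right]
      exact hw0 _ _
    · rw [if_neg (by simp [hi]), one_mul, hE _ hi]
      exact hw0 _ _
  have hX : (Finset.univ : Finset (Fin k → Fin 2)).card = 2 ^ k := by simp
  rw [hX] at hM₁
  rw [Finset.card_product, hX] at hM₂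
  refine ⟨_, (hH.comp ((Impl.mux_mul hM₂ hM₁ hM₁i).comp (hπ.comp hH))).mono (by omega),
    fun ψ hψ => ?_⟩
  set c : ℂ := (((Real.sqrt 2)⁻¹ : ℝ) : ℂ) with hc
  have hcc : c ^ k * c ^ k = (2 ^ k)⁻¹ := by
    rw [← mul_pow, hc, ← Complex.ofReal_mul, ← mul_inv, Real.mul_self_sqrt (by norm_num), ← inv_pow]
    norm_num
  have hext : ∀ (b : Wire n l k → Fin 2) x w, (∀ q, w ≠ .shf q) → extend Wire.shf x b w = b w :=
    fun b x w hw => extend_apply' _ _ _ fun ⟨q, hq⟩ => hw q hq.symm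
  set ψ₁ : (Wire n l k → Fin 2) → ℂ := fun b => ∑ x : Fin k → Fin 2,
    (∏ q, h (b (.shf q)) (x q)) * ψ (extend Wire.shf x b) with hψ₁
  have hψ₁b : ∀ b, ψ₁ b = c ^ k * ψ (extend Wire.shf 0 b) := by
    intro b
    rw [hψ₁]
    dsimp only
    rw [Finset.sum_eq_single 0]
    · simp only [Pi.zero_apply, (hh0 _).1, Finset.prod_const, Finset.card_univ, Fintype.card_fin]
    · intro x _ hx
      rw [mul_eq_zero]
      right
      by_contra hne
      apply hx
      funext q
      have := (hψ _ hne).2.1 q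
      rwa [Wire.shf_injective.extend_apply] at this
    · simp
  have hcl : ∀ (b : Wire n l k → Fin 2) x, Wire.Clean 0 (extend Wire.shf x b) ↔ Wire.Clean 0 b := by
    intro b x
    refine forall₂_congr fun i _ => ?_
    rw [hext b x _ (by simp)]
  have hπcl : ∀ b, Wire.Clean 0 (π b) → Wire.Clean 0 b := by
    -- an injective map of a finite set into itself is surjective
    intro b hb
    have hmap : Set.MapsTo π {b | Wire.Clean 0 b} {b | Wire.Clean 0 b} := fun b hb i hi => by
      rw [(hπb b hb).2 _ (by simp), hb i hi]
    obtain ⟨b', hb', hbb⟩ := Finset.surjOn_of_injOn_of_card_le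
      (s := Finset.univ.filter fun b => Wire.Clean 0 b)
      (t := Finset.univ.filter fun b => Wire.Clean 0 b) π (by simpa using hmap)
      hπ.injective.injOn le_rfl (show π b ∈ _ by simpa using hb)
    rw [← hπ.injective hbb]
    simpa using hb'
  constructor
  · intro b hb
    obtain ⟨x, -, hx⟩ := Finset.exists_ne_zero_of_sum_ne_zero hb
    obtain ⟨v, -, hv⟩ := Finset.exists_ne_zero_of_sum_ne_zero (right_ne_zero_of_mul hx)
    have h1 := right_ne_zero_of_mul hv
    rw [comp_apply] at h1
    change ψ₁ _ ≠ 0 at h1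
    rw [hψ₁b] at h1
    have h2 := hπcl _ ((hcl _ _).1 (hψ _ (right_ne_zero_of_mul h1)).1)
    rw [← hcl b x]
    intro i hi
    simpa using h2 i hi
  · intro b hb hb0 hbv
    have key : ∀ x, mux .val (fun b => M₂ b * M₁ b) (ψ₁ ∘ π) (extend Wire.shf x b) =
        c ^ k * if x ∈ T then d x (finFunctionFinEquiv fun i => b (.pos i)) *
          ψ (extend Wire.pos (finFunctionFinEquiv.symm
            ((finFunctionFinEquiv fun i => b (.pos i)) + s x)) b) else 0 := by
      intro x
      set b' := extend Wire.shf x b with hb'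
      have hb'c : Wire.Clean 0 b' := (hcl b x).2 hb
      have hb'v : b' .val = 0 := by rw [hb', hext _ _ _ (by simp), hbv]
      have hb'p : ∀ i, b' (.pos i) = b (.pos i) := fun i => hext _ _ _ (by simp)
      have hb's : (fun q => b' (.shf q)) = x := by
        funext q
        rw [hb', Wire.shf_injective.extend_apply]
      have hM' := hM b' hb'c
      simp only [hb'p, hb's] at hM'
      rw [mux, Finset.sum_eq_single 0]
      · rw [hb'v, hM', comp_apply, hψ₁b]
        have hup : update b' .val 0 = b' := by rw [← hb'v, update_eq_self]
        rw [hup]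
        obtain ⟨h1, h2⟩ := hπb b' hb'c
        rw [hb's] at h1
        split_ifs with hx
        · rw [if_pos hx] at h1
          rw [show extend Wire.shf 0 (π b') = extend Wire.pos (finFunctionFinEquiv.symm
            ((finFunctionFinEquiv fun i => b (.pos i)) + s x)) b from ?_]
          · ring
          · refine Wire.eq_extend_pos ?_ fun w hw => ?_
            · rw [Fin.val_add, ← Wire.posVal_eq, show Wire.posVal b = Wire.posVal b' by
                simp only [Wire.posVal_eq_sum, hb'p], ← h1]
              rw [Wire.posVal_eq_sum, Wire.posVal_eq_sum]
              exact Finset.sum_congr rfl fun i _ => by rw [hext _ _ _ (by simp)]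
            · by_cases hws : ∃ q, Wire.shf q = w
              · obtain ⟨q, rfl⟩ := hws
                rw [Wire.shf_injective.extend_apply, hb0 q]
                rfl
              · have hws' : ∀ q, w ≠ .shf q := fun q hq => hws ⟨q, hq.symm⟩
                rw [hext _ _ _ hws', h2 w hw, hb', hext _ _ _ hws']
        · rw [hdT x hx, zero_mul, mul_zero]
      · intro v _ hv
        rw [mul_eq_zero]
        right
        rw [comp_apply, hψ₁b, mul_eq_zero]
        right
        by_contra hne
        have h1 := (hψ _ hne).2.2
        have h2 : Wire.Clean 0 (update b' .val v) := fun i hi => by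
          simpa using hb'c i hi
        rw [hext _ _ _ (by simp), (hπb _ h2).2 _ (by simp), update_self] at h1
        exact hv h1
      · simp
    change ∑ x : Fin k → Fin 2, (∏ q, h (b (.shf q)) (x q)) *
      mux .val (fun b => M₂ b * M₁ b) (ψ₁ ∘ π) (extend Wire.shf x b) = _
    simp only [hb0, (hh0 _).2, Finset.prod_const, Finset.card_univ, Fintype.card_fin, key]
    rw [← Finset.mul_sum, ← Finset.mul_sum, ← mul_assoc, hcc, Finset.sum_ite_mem,
      Finset.univ_inter]

end Derivative

/-! ### Finite-difference matrices -/

section Robin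

open Function

variable {m n κ r : ℕ} {Δx : ℝ} {D : Matrix (Fin (2 ^ n)) (Fin (2 ^ n)) ℂ}

theorem two_pow_clog_le {κ : ℕ} (hκ : 1 ≤ κ) : 2 ^ Nat.clog 2 κ ≤ 2 * κ := by
  rcases hκ.eq_or_lt with rfl | h
  · simp
  · have h1 := Nat.pow_pred_clog_lt_self (by norm_num : 1 < 2) h
    have h2 : Nat.clog 2 κ = (Nat.clog 2 κ).pred + 1 := by
      have := Nat.clog_pos (by norm_num : 1 < 2) h
      simp only [Nat.pred_eq_sub_one]
      omega
    rw [h2, pow_succ]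
    omega

/-- Consistency forces a nonzero entry in the bulk rows. -/
theorem IsRobinDerivative.exists_ne_zero (h : IsRobinDerivative m n κ r Δx D) (hΔ : Δx ≠ 0) :
    ∃ i j, D i j ≠ 0 := by
  obtain ⟨γ, hγ, K₁, K₂, h12, h2, -, hb⟩ := h.bulk
  have h1 := hγ m le_rfl
  rw [if_pos rfl] at h1
  obtain ⟨l, hl, -⟩ := Finset.exists_ne_zero_of_sum_ne_zero (s := γ.support)
    (f := fun l => γ l * (l : ℝ) ^ m) (by
      change (γ.sum fun l c => c * (l : ℝ) ^ m) ≠ 0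
      rw [h1]
      exact_mod_cast m.factorial_ne_zero)
  obtain ⟨hs, hD⟩ := hb ⟨K₁, h12.trans_lt h2⟩ le_rfl h12
  obtain ⟨hl1, hl2⟩ := hs l hl
  dsimp only at hl1 hl2
  have hN : ((2 ^ n : ℕ) : ℤ) = 2 ^ n := by push_cast; rfl
  refine ⟨⟨K₁, h12.trans_lt h2⟩, ⟨((K₁ : ℤ) + l).toNat, by omega⟩, ?_⟩
  rw [hD, Complex.ofReal_ne_zero]
  refine div_ne_zero ?_ (pow_ne_zero _ hΔ)
  rw [show ((((K₁ : ℤ) + l).toNat : ℕ) : ℤ) - (K₁ : ℤ) = l by omega]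
  exact Finsupp.mem_support_iff.1 hl

/-- Along a cyclic diagonal the bulk rows have equal entries: a diagonal which wraps around for one
bulk row but not for another one vanishes in the bulk, since the stencil stays inside the grid. -/
theorem IsRobinDerivative.exists_boundary (h : IsRobinDerivative m n κ r Δx D) :
    ∃ (E : Finset (Fin (2 ^ n))) (i₀ : Fin (2 ^ n)), E.card ≤ r ∧
      ∀ i, i ∉ E → ∀ s, D i (i + s) = D i₀ (i₀ + s) := by
  obtain ⟨γ, hγ, K₁, K₂, h12, h2, h3, hb⟩ := h.bulk
  have hN : ((2 ^ n : ℕ) : ℤ) = 2 ^ n := by push_cast; rfl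
  obtain ⟨i₀, rfl⟩ : ∃ i₀ : Fin (2 ^ n), (i₀ : ℕ) = K₁ := ⟨⟨K₁, h12.trans_lt h2⟩, rfl⟩
  refine ⟨(Finset.Icc i₀ ⟨K₂, h2⟩)ᶜ, i₀, ?_, fun i hi s => ?_⟩
  · rw [Finset.card_compl, Fin.card_Icc, Fintype.card_fin]
    dsimp only
    omega
  rw [Finset.mem_compl, not_not, Finset.mem_Icc, Fin.le_def, Fin.le_def] at hi
  obtain ⟨hs, hD⟩ := hb i hi.1 hi.2
  obtain ⟨hs', hD'⟩ := hb i₀ le_rfl h12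
  rw [hD, hD']
  congr 2
  -- the offset of a cyclic diagonal is determined up to wrapping around
  have hoff : ∀ i : Fin (2 ^ n), (((i + s : Fin (2 ^ n)) : ℕ) : ℤ) - ((i : ℕ) : ℤ) = (s : ℕ) ∧
      (i : ℕ) + s < 2 ^ n ∨ (((i + s : Fin (2 ^ n)) : ℕ) : ℤ) - ((i : ℕ) : ℤ) = (s : ℕ) - 2 ^ n ∧
      2 ^ n ≤ (i : ℕ) + s := by
    intro i
    have hi := i.2
    have hs := s.2
    rw [Fin.val_add]
    rcases lt_or_ge ((i : ℕ) + s) (2 ^ n) with h | h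
    · left
      rw [Nat.mod_eq_of_lt h]
      exact ⟨by push_cast; ring, h⟩
    · right
      rw [Nat.mod_eq_sub_mod h, Nat.mod_eq_of_lt (by omega)]
      omega
  have hγ0 : ∀ l : ℤ, (¬ (0 ≤ ((i : ℕ) : ℤ) + l ∧ ((i : ℕ) : ℤ) + l < 2 ^ n) ∨
      ¬ (0 ≤ ((i₀ : ℕ) : ℤ) + l ∧ ((i₀ : ℕ) : ℤ) + l < 2 ^ n)) → γ l = 0 := by
    intro l hl
    by_contra hne
    rcases hl with hl | hl
    · exact hl (hs l (Finsupp.mem_support_iff.2 hne))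
    · exact hl (hs' l (Finsupp.mem_support_iff.2 hne))
  have hs2 := s.2
  rcases hoff i with ⟨e, h⟩ | ⟨e, h⟩ <;> rcases hoff i₀ with ⟨e', h'⟩ | ⟨e', h'⟩ <;> rw [e, e']
  · rw [hγ0 (s : ℕ) (Or.inr (by omega)), hγ0 ((s : ℕ) - 2 ^ n) (Or.inl (by omega))]
  · rw [hγ0 ((s : ℕ) - 2 ^ n) (Or.inr (by omega)), hγ0 (s : ℕ) (Or.inl (by omega))]

/-- A block-encoding of `D` up to the factor `2 ^ k N_D`, where `2 ^ k` is the least power of two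
that is at least the number of diagonals. -/
theorem IsRobinDerivative.exists_circuit {l : ℕ} (h : IsRobinDerivative m n κ r Δx D) (hn : 1 ≤ n)
    (hκ : 1 ≤ κ) {N_D : ℝ} (hN0 : 0 < N_D) (hN : ∀ i j, ‖D i j‖ ≤ N_D) :
    ∃ A, Impl ((300 + 206 * r) * (κ * n)) A ∧
      ∀ ψ : (Wire n l (Nat.clog 2 κ) → Fin 2) → ℂ,
        (∀ b, ψ b ≠ 0 → Wire.Clean 0 b ∧ (∀ q, b (.shf q) = 0) ∧ b .val = 0) →
        (∀ b, A ψ b ≠ 0 → Wire.Clean 0 b) ∧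
        ∀ b, Wire.Clean 0 b → (∀ q, b (.shf q) = 0) → b .val = 0 →
          A ψ b = (2 ^ Nat.clog 2 κ)⁻¹ * ∑ j,
            D (finFunctionFinEquiv fun i => b (.pos i)) j / N_D *
              ψ (extend Wire.pos (finFunctionFinEquiv.symm j) b) := by
  classical
  obtain ⟨S, hS, hSD⟩ := h.band
  obtain ⟨E, i₀, hE, hED⟩ := h.exists_boundary
  set k := Nat.clog 2 κ with hk
  have hκn : κ ≤ 2 ^ n := by
    rw [← hS]
    exact (Finset.card_le_univ S).trans_eq (Fintype.card_fin _)
  have hkn : k ≤ n := Nat.clog_le_of_le_pow hκn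
  obtain ⟨e⟩ := Function.Embedding.nonempty_of_card_le (α := S) (β := Fin k → Fin 2) (by
    rw [Fintype.card_coe, hS]
    simpa using Nat.le_pow_clog (by norm_num : 1 < 2) κ)
  set s : (Fin k → Fin 2) → Fin (2 ^ n) := extend e (fun σ => σ.1) fun _ => ⟨0, by positivity⟩
  set T : Finset (Fin k → Fin 2) := Finset.univ.map e with hT
  have hTcard : T.card = κ := by rw [hT, Finset.card_map, Finset.card_univ, Fintype.card_coe, hS]
  set d : (Fin k → Fin 2) → Fin (2 ^ n) → ℂ := fun x i => if x ∈ T then D i (i + s x) / N_D else 0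
    with hd
  obtain ⟨A, hA, hAψ⟩ := exists_diagonals (l := l) hn hkn T s d (fun x i => by
      rw [hd]
      dsimp only
      split_ifs
      · rw [norm_div, Complex.norm_real, Real.norm_of_nonneg hN0.le]
        exact div_le_one_of_le₀ (hN _ _) hN0.le
      · simp)
    (fun x hx i => if_neg hx) E i₀ (fun i hi x => by simp only [hd, hED i hi])
  refine ⟨A, hA.mono ?_, fun ψ hψ => ⟨(hAψ ψ hψ).1, fun b hb hb0 hbv => ?_⟩⟩
  · rw [hTcard]
    have h2k := two_pow_clog_le hκ
    have h1 : 2 * k ≤ 2 * (κ * n) := by nlinarith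
    have h2 : κ * (2 * (48 * k + 7) + 74 * n) ≤ 184 * (κ * n) := by
      calc κ * (2 * (48 * k + 7) + 74 * n) ≤ κ * (184 * n) := Nat.mul_le_mul_left _ (by omega)
        _ = _ := by ring
    have h3 : 2 ^ k * (48 * k + 7) ≤ 110 * (κ * n) := by
      calc 2 ^ k * (48 * k + 7) ≤ 2 * κ * (55 * n) := Nat.mul_le_mul h2k (by omega)
        _ = _ := by ring
    have h4 : 2 ^ k * E.card * (48 * (k + n) + 7) ≤ 206 * r * (κ * n) := by
      calc 2 ^ k * E.card * (48 * (k + n) + 7) ≤ 2 * κ * r * (103 * n) :=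
            Nat.mul_le_mul (Nat.mul_le_mul h2k hE) (by omega)
        _ = _ := by ring
    rw [add_mul]
    omega
  · rw [(hAψ ψ hψ).2 b hb hb0 hbv]
    congr 1
    set i : Fin (2 ^ n) := finFunctionFinEquiv fun i => b (.pos i)
    set g : Fin (2 ^ n) → ℂ := fun j =>
      D i j / N_D * ψ (extend Wire.pos (finFunctionFinEquiv.symm j) b)
    have h1 : ∑ j, g j = ∑ σ, g (i + σ) := (Equiv.sum_comp (Equiv.addLeft i) g).symm
    have h2 : ∑ σ, g (i + σ) = ∑ σ ∈ S, g (i + σ) := by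
      symm
      refine Finset.sum_subset (Finset.subset_univ S) fun σ _ hσ => ?_
      have : D i (i + σ) = 0 := by
        by_contra hne
        have := hSD _ _ hne
        rw [add_sub_cancel_left] at this
        exact hσ this
      simp [g, this]
    change _ = ∑ j, g j
    rw [h1, h2, ← Finset.sum_coe_sort S fun σ => g (i + σ), hT, Finset.sum_map]
    refine Finset.sum_congr rfl fun σ _ => ?_
    have hσ : s (e σ) = σ := e.injective.extend_apply _ _ _
    simp only [hd, hT, Finset.mem_map_of_mem e (Finset.mem_univ σ), if_true, hσ, g]

end Robin

/-! ### Piecewise polynomial functions -/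

section Pieces

open Polynomial

/-- The part of the domain on which the piece `g` of a piecewise polynomial function lives. -/
def pieceDomain {G : ℕ} (K : Fin (G + 1) → ℝ) (g : Fin G) : Set ℝ :=
  {x | x ∈ Set.Ioc (K g.castSucc) (K g.succ) ∨ (g : ℕ) = 0 ∧ x = K 0}

variable {G : ℕ} {K : Fin (G + 1) → ℝ}

theorem pieceDomain_subset (hK : StrictMono K) (g : Fin G) :
    pieceDomain K g ⊆ Set.Icc (K g.castSucc) (K g.succ) := by
  rintro x (hx | ⟨hg, rfl⟩)
  · exact Set.Ioc_subset_Icc_self hx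
  · have h0 : g.castSucc = 0 := Fin.ext hg
    rw [h0]
    exact ⟨le_rfl, hK.monotone (Fin.zero_le _)⟩

theorem pieceDomain_ordConnected (hK : StrictMono K) {g : Fin G} {x y z : ℝ}
    (hx : x ∈ pieceDomain K g) (hz : z ∈ pieceDomain K g) (hxy : x ≤ y) (hyz : y ≤ z) :
    y ∈ pieceDomain K g := by
  have hz' := (pieceDomain_subset hK g hz).2
  rcases hx with hx | ⟨hg, rfl⟩
  · exact Or.inl ⟨hx.1.trans_le hxy, hyz.trans hz'⟩
  · rcases hxy.eq_or_lt with rfl | h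
    · exact Or.inr ⟨hg, rfl⟩
    · have h0 : g.castSucc = 0 := Fin.ext hg
      exact Or.inl ⟨h0 ▸ h, hyz.trans hz'⟩

theorem pieceDomain_disjoint (hK : StrictMono K) {g g' : Fin G} (h : g ≠ g') :
    Disjoint (pieceDomain K g) (pieceDomain K g') := by
  have key : ∀ g g' : Fin G, g < g' → Disjoint (pieceDomain K g) (pieceDomain K g') := by
    intro g g' hlt
    rw [Set.disjoint_left]
    rintro x hx (hx' | ⟨hg, -⟩)
    · have h1 := (pieceDomain_subset hK g hx).2
      have h2 : K g.succ ≤ K g'.castSucc := hK.monotone (Fin.succ_le_castSucc_iff.2 hlt)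
      exact absurd hx'.1 (not_lt.2 (h1.trans h2))
    · have : (g : ℕ) < g' := hlt
      omega
  rcases lt_or_gt_of_ne h with h | h
  · exact key g g' h
  · exact (key g' g h).symm

theorem exists_mem_pieceDomain (hG : 0 < G) {x : ℝ} (hx : K 0 ≤ x) (hx' : x ≤ K (Fin.last G)) :
    ∃ g, x ∈ pieceDomain K g := by
  have key : ∀ h : Fin (G + 1), x ≤ K h → ∃ g, x ∈ pieceDomain K g := by
    intro h
    induction h using Fin.induction with
    | zero => exact fun h => ⟨⟨0, hG⟩, Or.inr ⟨rfl, le_antisymm h hx⟩⟩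
    | succ g ih =>
      intro h
      by_cases h' : x ≤ K g.castSucc
      · exact ih h'
      · exact ⟨g, Or.inl ⟨not_le.1 h', h⟩⟩
  exact key _ hx'

theorem clog_add_one_le {n : ℕ} (hn : 4 ≤ n) : ((Nat.clog 2 n + 1 : ℕ) : ℝ) ≤ 2 * Real.logb 2 n := by
  have hn0 : (0 : ℝ) < n := by
    have : 0 < n := by omega
    exact_mod_cast this
  have h1 : (2 : ℝ) ≤ Real.logb 2 n := by
    rw [Real.le_logb_iff_rpow_le (by norm_num) hn0]
    norm_num
    exact hn
  have h2 : ((Nat.clog 2 n - 1 : ℕ) : ℝ) ≤ Real.logb 2 n := by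
    rw [Real.le_logb_iff_rpow_le (by norm_num) hn0, Real.rpow_natCast]
    exact_mod_cast (Nat.pow_pred_clog_lt_self (by norm_num : 1 < 2) (by omega : 1 < n)).le
  have h3 : ((Nat.clog 2 n + 1 : ℕ) : ℝ) ≤ ((Nat.clog 2 n - 1 : ℕ) : ℝ) + 2 := by
    exact_mod_cast (by omega : Nat.clog 2 n + 1 ≤ Nat.clog 2 n - 1 + 2)
  linarith

theorem clog_add_four_le {n : ℕ} (hn : 4 ≤ n) : Nat.clog 2 n + 4 ≤ 2 * n := by
  have h : Nat.clog 2 n ≤ n - 2 + 1 - 1 := by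
    refine Nat.clog_le_of_le_pow ?_
    obtain ⟨t, rfl⟩ := Nat.exists_eq_add_of_le hn
    have : t + 1 ≤ 2 ^ t := Nat.lt_two_pow_self
    have h4 : 2 ^ (4 + t - 2 + 1 - 1) = 4 * 2 ^ t := by
      rw [show 4 + t - 2 + 1 - 1 = 2 + t by omega, pow_add]
      norm_num
    omega
  omega

/-- The values of a piecewise polynomial function on the grid. For `n ≤ 3` there are at most eight
grid points, which are treated one by one. -/
theorem IsPiecewisePolynomial.exists_enc {f : ℝ → ℂ} {a b : ℝ} {Q : Fin G → ℕ} {n k : ℕ}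
    (h : IsPiecewisePolynomial f a b Q) (hab : a < b) (hQ : ∀ g, 1 ≤ Q g) (hn : 1 ≤ n) {z : ℂ}
    (hz : ∀ x ∈ Set.Icc a b, ‖z * f x‖ < 1) :
    ∃ N, Enc n (Nat.clog 2 n) k (fun j => z * f (a + j * gridStep a b n)) (Set.Iio (2 ^ n)) N ∧
      (N : ℝ) ≤ 6200 * ((∑ g, (Q g : ℝ)) * (n * Real.logb 2 n)) + 440 * n := by
  obtain ⟨K, p, hK, rfl, rfl, hp, hfp, hfp0⟩ := h
  have hlog : 0 ≤ Real.logb 2 n := Real.logb_nonneg (by norm_num) (by exact_mod_cast hn)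
  have hQ0 : 0 ≤ ∑ g, (Q g : ℝ) := Finset.sum_nonneg fun g _ => Nat.cast_nonneg _
  set a := K 0
  set b := K (Fin.last G)
  set Δ := gridStep a b n with hΔ
  have h2n : (1 : ℝ) < 2 ^ n := one_lt_pow₀ (by norm_num) (by omega)
  have hΔ0 : 0 < Δ := div_pos (by linarith) (by linarith)
  have hΔb : Δ * (2 ^ n - 1) = b - a := div_mul_cancel₀ _ (by linarith)
  have hgrid : ∀ t : ℝ, 0 ≤ t → t ≤ 2 ^ n - 1 → a + t * Δ ∈ Set.Icc a b := fun t h0 h1 =>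
    ⟨by nlinarith, by nlinarith⟩
  have hgridN : ∀ j : ℕ, j < 2 ^ n → a + j * Δ ∈ Set.Icc a b := fun j hj =>
    hgrid j (Nat.cast_nonneg j) (by
      have : ((j + 1 : ℕ) : ℝ) ≤ (2 ^ n : ℕ) := by exact_mod_cast hj
      push_cast at this
      linarith)
  rcases lt_or_ge n 4 with hn4 | hn4
  · refine ⟨∑ j ∈ Finset.range (2 ^ n), (48 * n + 7), ?_, ?_⟩
    · rw [show Set.Iio (2 ^ n) = ⋃ j ∈ Finset.range (2 ^ n), ({j} : Set ℕ) by
        ext j; simp]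
      exact Enc.biUnion _ (N := fun _ => 48 * n + 7) (fun j hj => Enc.singleton
        (Finset.mem_range.1 hj) (hz _ (hgridN j (Finset.mem_range.1 hj))).le) fun g g' hg => by
          rw [Set.disjoint_singleton]; exact hg
    · have h1 : ∑ j ∈ Finset.range (2 ^ n), (48 * n + 7) ≤ 440 * n := by
        rw [Finset.sum_const, Finset.card_range, smul_eq_mul]
        interval_cases n <;> norm_num
      have h2 : ((∑ j ∈ Finset.range (2 ^ n), (48 * n + 7) : ℕ) : ℝ) ≤ 440 * n := by exact_mod_cast h1
      have h3 : 0 ≤ (∑ g, (Q g : ℝ)) * (n * Real.logb 2 n) := by positivity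
      linarith
  · set Ω : Fin G → Set ℕ := fun g => {j | j < 2 ^ n ∧ a + j * Δ ∈ pieceDomain K g} with hΩ
    have hG : 0 < G := by
      rcases Nat.eq_zero_or_pos G with rfl | h
      · exact absurd hab (lt_irrefl _)
      · exact h
    have hf : ∀ g, ∀ x ∈ pieceDomain K g, f x = (p g).eval (x : ℂ) := by
      rintro g x (hx | ⟨hg, rfl⟩)
      · exact hfp g x hx
      · exact hfp0 g hg
    refine ⟨∑ g, 3100 * (Q g * (n * (Nat.clog 2 n + 1))), ?_, ?_⟩
    · rw [show Set.Iio (2 ^ n) = ⋃ g ∈ (Finset.univ : Finset (Fin G)), Ω g by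
        ext j
        simp only [Set.mem_Iio, Finset.mem_univ, Set.iUnion_true, Set.mem_iUnion, hΩ,
          Set.mem_ofPred_eq]
        constructor
        · intro hj
          obtain ⟨g, hg⟩ := exists_mem_pieceDomain hG (hgridN j hj).1 (hgridN j hj).2
          exact ⟨g, hj, hg⟩
        · rintro ⟨g, hj, -⟩
          exact hj]
      refine Enc.biUnion _ (fun g _ => ?_) fun g g' hg => ?_
      · rcases (Ω g).eq_empty_or_nonempty with he | hne
        · rw [he]
          exact Enc.empty.mono (Nat.zero_le _)
        -- the grid points in one piece are consecutive
        · have hfin : (Ω g).Finite := (Set.finite_lt_nat (2 ^ n)).subset fun j hj => hj.1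
          obtain ⟨lo, hlo, hlo'⟩ := hfin.exists_minimal hne |>.imp fun _ h => h
          obtain ⟨hi, hhi, hhi'⟩ := hfin.exists_maximal hne |>.imp fun _ h => h
          have hmin : ∀ j ∈ Ω g, lo ≤ j := fun j hj => (le_total lo j).elim _root_.id (hlo' hj)
          have hmax : ∀ j ∈ Ω g, j ≤ hi := fun j hj => (le_total j hi).elim _root_.id (hhi' hj)
          have hreal : ∀ t : ℝ, (lo : ℝ) ≤ t → t ≤ hi → a + t * Δ ∈ pieceDomain K g := fun t h1 h2 =>
            pieceDomain_ordConnected hK hlo.2 hhi.2 (by nlinarith) (by nlinarith)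
          have hΩI : Ω g = Set.Icc lo hi := by
            ext j
            refine ⟨fun hj => ⟨hmin j hj, hmax j hj⟩, fun hj => ⟨hj.2.trans_lt hhi.1, ?_⟩⟩
            exact hreal j (by exact_mod_cast hj.1) (by exact_mod_cast hj.2)
          set q : ℂ[X] := C z * (p g).comp (C (a : ℂ) + X * C (Δ : ℂ)) with hq
          have hqe : ∀ t : ℝ, q.eval (t : ℂ) = z * (p g).eval ((a + t * Δ : ℝ) : ℂ) := by
            intro t
            simp only [hq, eval_mul, eval_C, eval_comp, eval_add, eval_X]
            push_cast
            rfl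
          rw [hΩI]
          refine Enc.interval hn4 (clog_add_four_le hn4) (Nat.le_pow_clog (by norm_num) n) (hQ g)
            (p := q) ?_ (hmin hi hhi) hhi.1 (fun t h1 h2 => ?_) fun j h1 h2 => ?_
          · refine (natDegree_C_mul_le _ _).trans (natDegree_comp_le.trans ?_)
            have h1 : (C (a : ℂ) + X * C (Δ : ℂ)).natDegree ≤ 1 := by compute_degree
            exact (Nat.mul_le_mul (hp g) h1).trans (by omega)
          · rw [hqe, ← hf g _ (hreal t h1 h2)]
            refine hz _ (hgrid t ((Nat.cast_nonneg lo).trans h1) (h2.trans ?_))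
            have : ((hi + 1 : ℕ) : ℝ) ≤ (2 ^ n : ℕ) := by exact_mod_cast hhi.1
            push_cast at this
            linarith
          · rw [hqe, ← hf g _ (hreal j (by exact_mod_cast h1) (by exact_mod_cast h2))]
      · rw [Set.disjoint_left]
        exact fun j hj hj' => Set.disjoint_left.1 (pieceDomain_disjoint hK hg) hj.2 hj'.2
    · have h1 := clog_add_one_le hn4
      push_cast at h1 ⊢
      rw [← Finset.mul_sum, ← Finset.sum_mul]
      have h2 : (∑ g, (Q g : ℝ)) * (n * ((Nat.clog 2 n : ℝ) + 1)) ≤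
          (∑ g, (Q g : ℝ)) * (n * (2 * Real.logb 2 n)) := by gcongr
      have h3 : (∑ g, (Q g : ℝ)) * (n * (2 * Real.logb 2 n)) =
          2 * ((∑ g, (Q g : ℝ)) * (n * Real.logb 2 n)) := by ring
      have h4 : (0 : ℝ) ≤ 440 * n := by positivity
      linarith

end Pieces

/-! ### Enlarging the set of wires -/

section Transport

open Function Matrix

variable {ι ι' : Type} [Fintype ι] [DecidableEq ι] [Fintype ι'] [DecidableEq ι']

/-- A gate, carried over to a larger set of wires. -/
def QGate.map (e : ι ↪ ι') : QGate ι → QGate ι'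
  | .single i u => .single (e i) u
  | .cnot c t h => .cnot (e c) (e t) (e.injective.ne h)

theorem extend_comp_update (e : ι ↪ ι') (b : ι' → Fin 2) (i : ι) (x : Fin 2) :
    extend e (update (b ∘ e) i x) b = update b (e i) x := by
  funext w
  by_cases hw : ∃ q, e q = w
  · obtain ⟨q, rfl⟩ := hw
    rw [e.injective.extend_apply]
    by_cases hq : q = i
    · rw [hq, update_self, update_self]
    · rw [update_of_ne hq, update_of_ne (e.injective.ne hq)]
      rfl
  · rw [extend_apply' _ _ _ hw, update_of_ne (by rintro rfl; exact hw ⟨i, rfl⟩)]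

theorem extend_extend (e : ι ↪ ι') (b : ι' → Fin 2) (v v' : ι → Fin 2) :
    extend e v' (extend e v b) = extend e v' b := by
  funext w
  by_cases hw : ∃ q, e q = w
  · obtain ⟨q, rfl⟩ := hw
    rw [e.injective.extend_apply, e.injective.extend_apply]
  · rw [extend_apply' _ _ _ hw, extend_apply' _ _ _ hw, extend_apply' _ _ _ hw]

theorem QGate.map_mulVec (e : ι ↪ ι') (g : QGate ι) (ψ : (ι' → Fin 2) → ℂ) (b : ι' → Fin 2) :
    ((g.map e).matrix *ᵥ ψ) b = (g.matrix *ᵥ fun v => ψ (extend e v b)) (b ∘ e) := by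
  cases g with
  | single i u =>
    simp only [QGate.map, QGate.single_mulVec, extend_comp_update]
    rfl
  | cnot c t h =>
    simp only [QGate.map, QGate.cnot_mulVec, extend_comp_update]
    rfl

/-- A circuit on some of the wires acts on the corresponding tensor factor. -/
theorem QCircuit.map_mulVec (e : ι ↪ ι') (U : QCircuit ι) (ψ : (ι' → Fin 2) → ℂ)
    (b : ι' → Fin 2) :
    (QCircuit.matrix (U.map (QGate.map e)) *ᵥ ψ) b =
      (QCircuit.matrix U *ᵥ fun v => ψ (extend e v b)) (b ∘ e) := by
  induction U generalizing ψ b with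
  | nil =>
    simp only [List.map_nil, QCircuit.matrix, one_mulVec]
    congr 1
    funext w
    by_cases hw : ∃ q, e q = w
    · obtain ⟨q, rfl⟩ := hw
      rw [e.injective.extend_apply]
      rfl
    · rw [extend_apply' _ _ _ hw]
  | cons g U ih =>
    rw [List.map_cons, QCircuit.matrix, QCircuit.matrix, ← mulVec_mulVec, ← mulVec_mulVec, ih]
    congr 2
    funext v
    rw [QGate.map_mulVec]
    simp only [extend_extend]
    congr 1
    funext q
    exact e.injective.extend_apply _ _ _

end Transport

/-! ### The block-encoding -/

section BlockEncoding

open Function Matrix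

variable {n l k s : ℕ}

/-- All wires outside the position register are zero. -/
def Wire.Start (b : Wire n l k → Fin 2) : Prop := ∀ w, (∀ i, w ≠ .pos i) → b w = 0

/-- The wires as qubits of a block-encoding with `s` signal qubits. -/
def Wire.toQubit (hs : l + k + 2 ≤ s) : Wire n l k ↪ Fin (2 * n) ⊕ (Fin s ⊕ Fin n) where
  toFun
    | .anc i => .inl i
    | .pos i => .inr (.inr i)
    | .idx q => .inr (.inl ⟨q, by omega⟩)
    | .shf q => .inr (.inl ⟨l + q, by omega⟩)
    | .sig => .inr (.inl ⟨l + k, by omega⟩)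
    | .val => .inr (.inl ⟨l + k + 1, by omega⟩)
  inj' := by
    intro w w' h
    cases w <;> cases w' <;>
      simp only [Sum.inl.injEq, Sum.inr.injEq, reduceCtorEq, Wire.anc.injEq,
        Wire.pos.injEq, Wire.idx.injEq, Wire.shf.injEq, Fin.ext_iff] at h ⊢ <;> omega

theorem exists_isBlockEncoding {N : ℕ} {T : ((Wire n l k → Fin 2) → ℂ) → (Wire n l k → Fin 2) → ℂ}
    (hT : Impl N T) {α : ℝ} (hα : 0 < α) (A : Matrix (Fin (2 ^ n)) (Fin (2 ^ n)) ℂ)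
    (hs : l + k + 2 ≤ s)
    (h : ∀ ψ : (Wire n l k → Fin 2) → ℂ, (∀ b, ψ b ≠ 0 → Wire.Start b) →
      (∀ b, T ψ b ≠ 0 → Wire.Clean 0 b) ∧
      ∀ b, Wire.Start b → T ψ b = (α : ℂ)⁻¹ * ∑ j,
        A (finFunctionFinEquiv fun i => b (.pos i)) j *
          ψ (extend Wire.pos (finFunctionFinEquiv.symm j) b)) :
    ∃ U : QCircuit (Fin (2 * n) ⊕ (Fin s ⊕ Fin n)),
      IsBlockEncoding α 0 A U.matrix ∧ U.length ≤ N := by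
  obtain ⟨U, hU, hUT⟩ := hT
  set e := Wire.toQubit hs with he
  refine ⟨U.map (QGate.map e), ⟨hα, QCircuit.matrix_mem_unitaryGroup _,
    (α : ℂ)⁻¹ • qubitOperator A, fun ψ => ?_, ?_⟩, by rwa [List.length_map]⟩
  · set Ψ : (Fin (2 * n) ⊕ (Fin s ⊕ Fin n) → Fin 2) → ℂ := zeroTensor (zeroTensor ψ) with hΨ
    have hval : ∀ b, (QCircuit.matrix (U.map (QGate.map e)) *ᵥ Ψ) b =
        T (fun v => Ψ (extend e v b)) (b ∘ e) := fun b => by rw [QCircuit.map_mulVec, hUT]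
    have hstart : ∀ b v, Ψ (extend e v b) ≠ 0 → Wire.Start v := by
      intro b v hv w hw
      simp only [hΨ, zeroTensor] at hv
      have h1 := (ite_ne_right_iff.1 hv).1
      have h2 := (ite_ne_right_iff.1 (ite_ne_right_iff.1 hv).2).1
      rw [← e.injective.extend_apply v b w]
      cases w with
      | pos i => exact absurd rfl (hw i)
      | anc i => exact h1 _
      | _ => exact h2 _
    refine ⟨fun v => (QCircuit.matrix (U.map (QGate.map e)) *ᵥ Ψ) (Sum.elim (fun _ => 0) v), ?_, ?_⟩
    · funext b
      rw [zeroTensor]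
      split_ifs with hb
      · congr 1
        funext w
        cases w with
        | inl i => exact hb i
        | inr w => rfl
      · rw [hval]
        by_contra hne
        exact hb fun i => (h _ (hstart b)).1 _ hne i (Nat.zero_le _)
    · funext v
      rw [zeroProj, hval]
      set b : Fin (2 * n) ⊕ (Fin s ⊕ Fin n) → Fin 2 :=
        Sum.elim (fun _ => 0) (Sum.elim (fun _ => 0) v) with hb
      have hbs : Wire.Start (b ∘ e) := by
        intro w hw
        cases w with
        | pos i => exact absurd rfl (hw i)
        | _ => rfl
      rw [(h _ (hstart b)).2 _ hbs, smul_mulVec, Pi.smul_apply, smul_eq_mul]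
      congr 1
      rw [mulVec, dotProduct, ← Equiv.sum_comp finFunctionFinEquiv]
      refine Finset.sum_congr rfl fun y _ => ?_
      have hy : extend e (extend Wire.pos y (b ∘ e)) b =
          Sum.elim (fun _ => 0) (Sum.elim (fun _ => 0) y) := by
        funext w
        by_cases hw : ∃ q, e q = w
        · obtain ⟨q, rfl⟩ := hw
          rw [e.injective.extend_apply]
          cases q with
          | pos i => exact Wire.pos_injective.extend_apply _ _ _
          | _ => rw [extend_apply' _ _ _ (by rintro ⟨i, hi⟩; cases hi)]; rfl
        · rw [extend_apply' _ _ _ hw]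
          rcases w with i | i | i
          · rfl
          · rfl
          · exact absurd ⟨.pos i, rfl⟩ hw
      rw [Equiv.symm_apply_apply, hy]
      simp [hΨ, zeroTensor, qubitOperator]
      left
      rfl
  · rw [smul_smul, mul_inv_cancel₀ (Complex.ofReal_ne_zero.2 hα.ne'), one_smul, sub_self, map_zero,
      norm_zero]

/-- The composition of the circuit for the derivative matrix and the circuit for the values of the
coefficient function. -/
theorem exists_oneTerm {r m κ G : ℕ} {a b : ℝ} {f : ℝ → ℂ} {Q : Fin G → ℕ}
    {D : Matrix (Fin (2 ^ n)) (Fin (2 ^ n)) ℂ} {N_D N_f : ℝ} (hn : 1 ≤ n) (hab : a < b)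
    (hf : IsPiecewisePolynomial f a b Q) (hQ : ∀ g, 1 ≤ Q g)
    (hD : IsRobinDerivative m n κ r (gridStep a b n) D) (hκ : 1 ≤ κ) (hN0 : 0 < N_D)
    (hN : ∀ i j, ‖D i j‖ ≤ N_D) (hNf0 : 0 < N_f) (hNf : ∀ x ∈ Set.Icc a b, 4 * ‖f x‖ ≤ N_f) :
    ∃ (N : ℕ) (T : ((Wire n (Nat.clog 2 n) (Nat.clog 2 κ) → Fin 2) → ℂ) → _ → ℂ), Impl N T ∧
      (N : ℝ) ≤ 6200 * ((∑ g, (Q g : ℝ)) * (n * Real.logb 2 n)) + (740 + 206 * r) * (κ * n) ∧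
      ∀ ψ, (∀ b, ψ b ≠ 0 → Wire.Start b) → (∀ b, T ψ b ≠ 0 → Wire.Clean 0 b) ∧
        ∀ v, Wire.Start v → T ψ v = ((N_D * N_f * κ : ℝ) : ℂ)⁻¹ * ∑ j,
          oneTermMatrix f a b D (finFunctionFinEquiv fun i => v (.pos i)) j *
            ψ (extend Wire.pos (finFunctionFinEquiv.symm j) v) := by
  set k := Nat.clog 2 κ with hk
  have hκ0 : (0 : ℝ) < κ := by exact_mod_cast hκ
  have h2k : ((2 ^ k : ℕ) : ℝ) ≤ (2 * κ : ℕ) := by exact_mod_cast two_pow_clog_le hκ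
  push_cast at h2k
  -- the factor by which the values of `f` are scaled makes up for the loss in the Hadamard gates
  obtain ⟨N, ⟨M, ⟨T, hT, hTψ⟩, hM⟩, hNle⟩ := hf.exists_enc (k := k) hab hQ hn
    (z := ((2 ^ k / (κ * N_f) : ℝ) : ℂ)) (by
      intro x hx
      have h1 := hNf x hx
      rw [norm_mul, Complex.norm_real, Real.norm_of_nonneg (by positivity), div_mul_eq_mul_div,
        div_lt_one (by positivity)]
      have h2 := norm_nonneg (f x)
      have h3 : 2 ^ k * ‖f x‖ ≤ 2 * κ * ‖f x‖ := mul_le_mul_of_nonneg_right h2k h2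
      nlinarith)
  obtain ⟨A, hA, hAψ⟩ := hD.exists_circuit (l := Nat.clog 2 n) hn hκ hN0 hN
  refine ⟨_, _, hT.comp hA, ?_, fun ψ hψ => ?_⟩
  · push_cast
    have h1 : (440 : ℝ) * n ≤ 440 * (κ * n) := by
      have : (1 : ℝ) ≤ κ := by exact_mod_cast hκ
      have hn0 : (0 : ℝ) ≤ n := Nat.cast_nonneg n
      nlinarith
    linarith
  obtain ⟨h1, h2⟩ := hAψ ψ fun v hv => ⟨fun i _ => hψ v hv _ (by simp),
    fun q => hψ v hv _ (by simp), hψ v hv _ (by simp)⟩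
  obtain ⟨h3, h4⟩ := hTψ (A ψ) h1
  refine ⟨h3, fun v hv => ?_⟩
  have hvc : Wire.Clean 0 v := fun i _ => hv _ (by simp)
  have hvs : ∀ q, v (.shf q) = 0 := fun q => hv _ (by simp)
  have hset : Wire.set v 0 0 = v := by
    have := Wire.set_self v
    rw [hv .sig (by simp)] at this
    convert this using 2
    funext q
    exact (hv _ (by simp)).symm
  -- the derivative circuit has not touched the signal wire and the index register
  have hslice : slice v (A ψ) = startState (Nat.clog 2 n) (A ψ v) := by
    funext x y
    rw [slice, startState]
    by_cases hxy : x = 0 ∧ y = 0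
    · rw [hxy.1, hxy.2, hset]
      simp
    · have hzero : A ψ (Wire.set v x y) = 0 := by
        rw [h2 (Wire.set v x y) hvc hvs (hv .val (by simp)), Finset.sum_eq_zero, mul_zero]
        intro j _
        rw [mul_eq_zero]
        right
        by_contra hne
        have h5 := hψ _ hne
        apply hxy
        have hext : ∀ w, (∀ i, w ≠ .pos i) →
            extend Wire.pos (finFunctionFinEquiv.symm j) (Wire.set v x y) w = Wire.set v x y w :=
          fun w hw => extend_apply' _ _ _ fun ⟨i, hi⟩ => hw i hi.symm
        constructor
        · have := h5 .sig (by simp)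
          rwa [hext _ (by simp)] at this
        · funext q
          have := h5 (.idx q) (by simp)
          rwa [hext _ (by simp)] at this
      rw [hzero]
      split_ifs with hx
      · rw [Pi.smul_apply, Pi.single_eq_of_ne fun hy => hxy ⟨hx, hy⟩, smul_zero]
      · rfl
  have h5 := congrFun (congrFun (h4 v hvc) 0) 0
  rw [slice, hset, hslice, (hM v hvc).2 (Wire.posVal_lt v)] at h5
  rw [h5, Pi.smul_apply, Pi.single_eq_same, smul_eq_mul, mul_one, h2 v hvc hvs (hv _ (by simp)),
    Wire.posVal_eq, mul_right_comm, Finset.mul_sum, Finset.mul_sum]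
  refine Finset.sum_congr rfl fun j _ => ?_
  rw [oneTermMatrix, Matrix.diagonal_mul, gridPoint]
  have h6 : (κ : ℂ) ≠ 0 := by exact_mod_cast hκ0.ne'
  have h7 : (N_D : ℂ) ≠ 0 := Complex.ofReal_ne_zero.2 hN0.ne'
  have h8 : (N_f : ℂ) ≠ 0 := Complex.ofReal_ne_zero.2 hNf0.ne'
  push_cast
  field_simp
  rfl

end BlockEncoding

theorem mainTheorem5 :
    ∃ c : ℝ, 0 < c ∧ ∀ r : ℕ, ∃ C : ℝ, 0 < C ∧
      ∀ (n m κ G : ℕ) (a b : ℝ) (f : ℝ → ℂ) (Q : Fin G → ℕ)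
        (D : Matrix (Fin (2 ^ n)) (Fin (2 ^ n)) ℂ) (N_D N_f : ℝ),
        1 ≤ n → |a| < 1 → |b| < 1 → a < b →
        IsPiecewisePolynomial f a b Q → (∀ g, 1 ≤ Q g) →
        IsRobinDerivative m n κ r (gridStep a b n) D →
        (∀ i j, ‖D i j‖ ≤ N_D) →
        0 < N_f → (∀ x ∈ Set.Icc a b, c * ‖f x‖ ≤ N_f) →
        ∃ U : QCircuit (Fin (2 * n) ⊕
            (Fin (Nat.clog 2 n + Nat.clog 2 G + Nat.clog 2 κ + 4) ⊕ Fin n)),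
          IsBlockEncoding (N_D * N_f * κ) 0 (oneTermMatrix f a b D) U.matrix ∧
          (U.length : ℝ) ≤ C * ((∑ g, (Q g : ℝ)) * (n * Real.logb 2 n) + κ * n) := by
  refine ⟨4, by norm_num, fun r => ⟨6940 + 206 * r, by positivity, ?_⟩⟩
  intro n m κ G a b f Q D N_D N_f hn _ _ hab hf hQ hD hN hNf0 hNf
  have h2n : (1 : ℝ) < 2 ^ n := one_lt_pow₀ (by norm_num) (by omega)
  have hΔ : gridStep a b n ≠ 0 := (div_pos (by linarith) (by linarith)).ne'
  obtain ⟨i, j, hij⟩ := hD.exists_ne_zero hΔ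
  have hN0 : 0 < N_D := (norm_pos_iff.2 hij).trans_le (hN i j)
  have hκ : 1 ≤ κ := by
    obtain ⟨S, hS, hSD⟩ := hD.band
    rw [← hS]
    exact Finset.card_pos.2 ⟨_, hSD i j hij⟩
  have hκ0 : (0 : ℝ) < κ := by exact_mod_cast hκ
  obtain ⟨N, T, hT, hle, h⟩ := exists_oneTerm hn hab hf hQ hD hκ hN0 hN hNf0 hNf
  obtain ⟨U, hU, hUN⟩ := exists_isBlockEncoding
    (s := Nat.clog 2 n + Nat.clog 2 G + Nat.clog 2 κ + 4) hT (by positivity)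
    (oneTermMatrix f a b D) (by omega) h
  refine ⟨U, hU, (Nat.cast_le.2 hUN).trans (hle.trans ?_)⟩
  have hlog : 0 ≤ Real.logb 2 n := Real.logb_nonneg (by norm_num) (by exact_mod_cast hn)
  have h1 : 0 ≤ (∑ g, (Q g : ℝ)) * (n * Real.logb 2 n) :=
    mul_nonneg (Finset.sum_nonneg fun g _ => Nat.cast_nonneg _) (by positivity)
  have h2 : (0 : ℝ) ≤ κ * n := by positivity
  have h3 : (0 : ℝ) ≤ r := Nat.cast_nonneg r
  nlinarith [mul_nonneg h3 h1]
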